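/- Let $t^{1/2}$ be a nonzero complex number and put $\delta=-t^{1/2}-t^{-1/2}$. **Affine diagrams.** Let $A=\{z\in\mathbb C: 1\le |z|\le 2\}$, with $n$ marked points on each of the two boundary circles, labelled $1,\dots,n$ counterclockwise starting at the positive real axis. An affine $(n,n)$-diagram is a planar diagram in $A$, up to planar isotopy fixing the boundary, consisting of pairwise disjoint arcs that join the $2n$ marked points in pairs and finitely many disjoint noncontractible loops (so no crossings and no contractible loops). Equivalently (passing to the universal cover of $A$, an infinite strip, with points $x\in\mathbb Z$ over the marked point with label $x \bmod n$ on both boundary lines), it is a pairing of the inner and outer points of the strip that is invariant under the shift by $n$ and has no interlaced pairs, together with a number $r\ge 0$ of noncontractible loops, where $r=0$ unless no arc joins the inner to the outer boundary. Let $\mathcal{TL}_n$ be the algebra of endomorphisms of the object $n$ in the affine Temperley–Lieb category: it is the complex vector space with basis the affine $(n,n)$-diagrams, with product $D\cdot D'=\delta^{\,l}D''$, where $D''$ is obtained by placing $D'$ inside $D$ and removing the $l$ contractible loops that arise. **Algebras given by presentations.** Let $\mathrm{TL}_0=\mathbb C[X]$ and $\mathrm{TL}_1=\mathbb C[\rho,\rho^{-1}]$.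 Let $\mathrm{TL}_2$ be the complex associative unital algebra with generators $e_1,e_2,\rho,\rho^{-1}$ and relations $$e_i^2=\delta e_i,\qquad \rho e_i=e_{i+1}\rho,\qquad \rho\rho^{-1}=1=\rho^{-1}\rho,\qquad \rho^2e_1=e_1,$$ with indices modulo $2$. For $n\ge 3$ let $\mathrm{TL}_n$ be the complex associative unital algebra with generators $e_1,\dots,e_n,\rho,\rho^{-1}$ and relations $$e_i^2=\delta e_i,\quad e_ie_j=e_je_i\ (i-j\ne\pm1),\quad e_ie_{i\pm1}e_i=e_i,\quad \rho e_i=e_{i+1}\rho,\quad \rho\rho^{-1}=1=\rho^{-1}\rho,\quad (\rho e_1)^{n-1}=\rho^n(\rho e_1),$$ with indices modulo $n$. **Theorem.** (a) There is a unique algebra isomorphism $\mathrm{TL}_0\to\mathcal{TL}_0$ that maps $X$ to the diagram consisting of one noncontractible loop. (b) There is a unique algebra isomorphism $\mathrm{TL}_1\to\mathcal{TL}_1$ that maps $\rho$ to the diagram with a single arc, which starts at the inner marked point, winds once counterclockwise around the annulus, and ends at the outer marked point. (c) There is a unique algebra isomorphism $\mathrm{TL}_2\to\mathcal{TL}_2$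 that maps $\rho$ to the diagram whose two arcs run from the inner point $j$ to the outer point $j+1$ by a counterclockwise half turn, and, for $i=1,2$, maps $e_i$ to the diagram with two arcs, one joining the inner points $i$ and $i+1$ and one joining the outer points $i$ and $i+1$, each along the boundary segment that runs counterclockwise from $i$ to $i+1$ (labels modulo $2$). (d) For every $n\ge 3$ there is a unique algebra isomorphism $\mathrm{TL}_n\to\mathcal{TL}_n$ that maps $\rho$ to the diagram whose arcs run from the inner point $j$ to the outer point $j+1$ by a counterclockwise turn over $2\pi/n$ ($j=1,\dots,n$), and, for $i=1,\dots,n$, maps $e_i$ to the diagram in which the neighbouring inner points $i,i+1$ are joined by a short arc, the neighbouring outer points $i,i+1$ are joined by a short arc, and all other inner points $j$ are joined to the outer points $j$ by straight lines (labels modulo $n$). -/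

import Mathlib

namespace ATL

/-! ### Marked points on the universal cover of the annulus -/

/-- The points over the `n` marked points of a boundary circle of the annulus, on the boundary line
`ℝ` of the universal cover (the infinite strip): all integers if `n ≠ 0`, and no point if `n = 0`.
The integer `x` lies over the marked point with label `x` modulo `n`; moving in the positive
direction is turning counterclockwise. -/
@[ext] structure MarkedPt (n : ℕ) where
  pos : ℤ
  ne : n ≠ 0

/-- The deck transformations: `j : ℤ` acts by the shift over `n * j`. -/
instance instMarkedPtAddAction (n : ℕ) : AddAction ℤ (MarkedPt n) where
  vadd j x := ⟨x.pos + n * j, x.ne⟩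
  zero_vadd x := by
    ext
    change x.pos + n * 0 = x.pos
    simp
  add_vadd i j x := by
    ext
    change x.pos + n * (i + j) = x.pos + n * j + n * i
    ring

theorem MarkedPt.vadd_pos {n : ℕ} (j : ℤ) (x : MarkedPt n) : (j +ᵥ x).pos = x.pos + n * j := rfl

/-- The action of `ℤ` has trivial stabilizers. -/
def FreeShift (X : Type) [AddAction ℤ X] : Prop := ∀ (j : ℤ) (x : X), j +ᵥ x = x → j = 0

theorem freeShift_markedPt (n : ℕ) : FreeShift (MarkedPt n) := by
  intro j x h
  have h1 := congrArg MarkedPt.pos h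
  rw [MarkedPt.vadd_pos] at h1
  have h2 : (n : ℤ) * j = 0 := by linarith
  have h3 : (n : ℤ) ≠ 0 := by exact_mod_cast x.ne
  exact (mul_eq_zero.1 h2).resolve_left h3

theorem freeShift_sum {X Y : Type} [AddAction ℤ X] [AddAction ℤ Y] (hX : FreeShift X)
    (hY : FreeShift Y) : FreeShift (X ⊕ Y) := by
  rintro j (x | x) h
  · exact hX j x (Sum.inl_injective h)
  · exact hY j x (Sum.inr_injective h)

/-- There is a finite set of labels that determine the points up to shifts. -/
def FinOrbits (X : Type) [AddAction ℤ X] : Prop :=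
  ∃ (N : ℕ) (l : X → Fin N), ∀ x y, l x = l y → ∃ j : ℤ, y = j +ᵥ x

theorem finOrbits_markedPt (n : ℕ) : FinOrbits (MarkedPt n) := by
  rcases Nat.eq_zero_or_pos n with rfl | hn
  · exact ⟨0, fun x => (x.ne rfl).elim, fun x => (x.ne rfl).elim⟩
  · have hn' : (0 : ℤ) < n := by exact_mod_cast hn
    refine ⟨n, fun x => ⟨(x.pos % n).toNat, ?_⟩, fun x y h => ?_⟩
    · have h1 := Int.emod_lt_of_pos x.pos hn'
      have h2 := Int.emod_nonneg x.pos hn'.ne'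
      omega
    · have h1 := Int.emod_nonneg x.pos hn'.ne'
      have h2 := Int.emod_nonneg y.pos hn'.ne'
      have h3 : (x.pos % n).toNat = (y.pos % n).toNat := by simpa using h
      have h4 : x.pos % n = y.pos % n := by omega
      obtain ⟨j, hj⟩ : (n : ℤ) ∣ y.pos - x.pos := Int.ModEq.dvd h4
      exact ⟨j, by ext; rw [MarkedPt.vadd_pos]; linarith⟩

theorem finOrbits_sum {X Y : Type} [AddAction ℤ X] [AddAction ℤ Y] (hX : FinOrbits X)
    (hY : FinOrbits Y) : FinOrbits (X ⊕ Y) := by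
  obtain ⟨M, l, hl⟩ := hX
  obtain ⟨N, r, hr⟩ := hY
  refine ⟨M + N, fun z => finSumFinEquiv (z.map l r), ?_⟩
  rintro (x | x) (y | y) h
  · obtain ⟨j, hj⟩ := hl x y (by simpa using h)
    exact ⟨j, congrArg Sum.inl hj⟩
  · simpa using finSumFinEquiv.injective h
  · simpa using finSumFinEquiv.injective h
  · obtain ⟨j, hj⟩ := hr x y (by simpa using h)
    exact ⟨j, congrArg Sum.inr hj⟩

/-! ### Gluing: following strands -/

/-- Two points are linked by a walk along `σ`-strands and `τ`-strands. -/
def Linked {X : Type} (σ τ : X → X) : X → X → Prop :=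
  Relation.EqvGen fun x y => y = σ x ∨ y = τ x

section Linked

variable {X : Type} {σ τ : X → X}

theorem Linked.refl (x : X) : Linked σ τ x x := Relation.EqvGen.refl x

theorem Linked.symm {x y : X} (h : Linked σ τ x y) : Linked σ τ y x := Relation.EqvGen.symm _ _ h

theorem Linked.trans {x y z : X} (h : Linked σ τ x y) (h' : Linked σ τ y z) : Linked σ τ x z :=
  Relation.EqvGen.trans _ _ _ h h'

theorem Linked.left (x : X) : Linked σ τ x (σ x) := Relation.EqvGen.rel _ _ (Or.inl rfl)

theorem Linked.right (x : X) : Linked σ τ x (τ x) := Relation.EqvGen.rel _ _ (Or.inr rfl)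

/-- A set that is mapped into itself by the involutions `σ` and `τ` is closed under links. -/
theorem Linked.induct (hσ : Function.Involutive σ) (hτ : Function.Involutive τ) {P : X → Prop}
    (h1 : ∀ x, P x → P (σ x)) (h2 : ∀ x, P x → P (τ x)) {x y : X} (h : Linked σ τ x y)
    (hx : P x) : P y := by
  suffices h : P x ↔ P y from h.1 hx
  clear hx
  induction h with
  | rel x y h =>
    rcases h with rfl | rfl
    · exact ⟨h1 x, fun h => hσ x ▸ h1 _ h⟩
    · exact ⟨h2 x, fun h => hτ x ▸ h2 _ h⟩
  | refl x => exact Iff.rfl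
  | symm x y _ ih => exact ih.symm
  | trans x y z _ _ ih1 ih2 => exact ih1.trans ih2

theorem Linked.swap {x y : X} (h : Linked σ τ x y) : Linked τ σ x y :=
  Relation.EqvGen.mono (fun _ _ h => Or.symm h) _ _ h

variable [AddAction ℤ X]

theorem Linked.vadd (eσ : ∀ (j : ℤ) x, σ (j +ᵥ x) = j +ᵥ σ x)
    (eτ : ∀ (j : ℤ) x, τ (j +ᵥ x) = j +ᵥ τ x) (j : ℤ) {x y : X} (h : Linked σ τ x y) :
    Linked σ τ (j +ᵥ x) (j +ᵥ y) := by
  induction h with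
  | rel x y h =>
    rcases h with rfl | rfl
    · rw [← eσ]; exact Linked.left _
    · rw [← eτ]; exact Linked.right _
  | refl x => exact Linked.refl _
  | symm x y _ ih => exact ih.symm
  | trans x y z _ _ ih1 ih2 => exact ih1.trans ih2

/-- An equivariant involution that fixes a point up to a shift fixes it. -/
theorem shift_eq_zero (hfree : FreeShift X) (hσ : Function.Involutive σ)
    (eσ : ∀ (j : ℤ) x, σ (j +ᵥ x) = j +ᵥ σ x) {j : ℤ} {x : X} (h : σ x = j +ᵥ x) : j = 0 := by
  have h1 : x = (j + j) +ᵥ x := by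
    conv_lhs => rw [← hσ x, h, eσ, h]
    rw [add_vadd]
  have := hfree _ _ h1.symm
  omega

theorem linked_core (hfree : FreeShift X) (hfin : FinOrbits X)
    (hσ : Function.Involutive σ) (hτ : Function.Involutive τ)
    (eσ : ∀ (j : ℤ) x, σ (j +ᵥ x) = j +ᵥ σ x) (eτ : ∀ (j : ℤ) x, τ (j +ᵥ x) = j +ᵥ τ x)
    (hdis : ∀ x, ¬(σ x = x ∧ τ x = x)) {v : X} (hv : τ v = v) :
    (∃! w, w ≠ v ∧ (σ w = w ∨ τ w = w) ∧ Linked σ τ v w) ∧ {w | Linked σ τ v w}.Finite := by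
  set s : Equiv.Perm X := hσ.toPerm with hs
  set t : Equiv.Perm X := hτ.toPerm with ht
  have ss : s⁻¹ = s := rfl
  have tt : t⁻¹ = t := rfl
  have s2 : s * s = 1 := by rw [← mul_inv_cancel s, ss]
  have t2 : t * t = 1 := by rw [← mul_inv_cancel t, tt]
  set g : Equiv.Perm X := t * s with hg
  have tv : t v = v := hv
  have sg : ∀ i : ℤ, s * g ^ i = g ^ (-i) * s := by
    intro i
    have h1 : s * g * s⁻¹ = g⁻¹ := by rw [hg, mul_inv_rev, ss, tt, mul_assoc, mul_assoc, s2, mul_one]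
    have h2 := conj_zpow (i := i) (a := s) (b := g)
    rw [h1, inv_zpow', ] at h2
    rw [h2, inv_mul_cancel_right]
  have tg : ∀ i : ℤ, t * g ^ i = g ^ (-i) * t := by
    intro i
    have h1 : t * g * t⁻¹ = g⁻¹ := by rw [hg, mul_inv_rev, ss, tt, ← mul_assoc, t2, one_mul]
    have h2 := conj_zpow (i := i) (a := t) (b := g)
    rw [h1, inv_zpow', ] at h2
    rw [h2, inv_mul_cancel_right]
  have sv : s v = (g ^ (-1 : ℤ)) v := by
    rw [zpow_neg_one, hg, mul_inv_rev, ss, tt, Equiv.Perm.mul_apply, tv]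
  have tgv : ∀ i : ℤ, t ((g ^ i) v) = (g ^ (-i)) v := by
    intro i
    rw [← Equiv.Perm.mul_apply, tg, Equiv.Perm.mul_apply, tv]
  have sgv : ∀ i : ℤ, s ((g ^ i) v) = (g ^ (-i - 1)) v := by
    intro i
    rw [← Equiv.Perm.mul_apply, sg, Equiv.Perm.mul_apply, sv, ← Equiv.Perm.mul_apply, ← zpow_add]
    rfl
  have orb : ∀ w, Linked σ τ v w → ∃ i : ℤ, w = (g ^ i) v := by
    intro w hw
    refine Linked.induct hσ hτ (P := fun w => ∃ i : ℤ, w = (g ^ i) v) ?_ ?_ hw ⟨0, rfl⟩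
    · rintro _ ⟨i, rfl⟩
      exact ⟨_, sgv i⟩
    · rintro _ ⟨i, rfl⟩
      exact ⟨_, tgv i⟩
  have lnk1 : ∀ w, Linked σ τ w (g w) := fun w => (Linked.left w).trans (Linked.right _)
  have lnk : ∀ n : ℕ, Linked σ τ v ((g ^ (n : ℤ)) v) := by
    intro n
    induction n with
    | zero => exact Linked.refl v
    | succ n ih =>
      refine ih.trans ?_
      have : (g ^ ((n + 1 : ℕ) : ℤ)) v = g ((g ^ (n : ℤ)) v) := by
        rw [← Equiv.Perm.mul_apply, ← zpow_one_add]
        congr 2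
        push_cast
        ring
      rw [this]
      exact lnk1 _
  have eg : ∀ (j : ℤ) x, g (j +ᵥ x) = j +ᵥ g x := by
    intro j x
    change τ (σ (j +ᵥ x)) = j +ᵥ τ (σ x)
    rw [eσ, eτ]
  have egn : ∀ (n : ℕ) (j : ℤ) x, (g ^ n) (j +ᵥ x) = j +ᵥ (g ^ n) x := by
    intro n j x
    induction n with
    | zero => rfl
    | succ n ih => rw [pow_succ', Equiv.Perm.mul_apply, ih, eg]; rfl
  have hper : ∃ L : ℕ, 0 < L ∧ ∃ j : ℤ, (g ^ L) v = j +ᵥ v := by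
    obtain ⟨N, l, hl⟩ := hfin
    obtain ⟨a, b, hab, h⟩ := Finite.exists_ne_map_eq_of_infinite fun i : ℕ => l ((g ^ i) v)
    wlog hlt : a < b generalizing a b
    · exact this b a hab.symm h.symm (lt_of_le_of_ne (not_lt.1 hlt) hab.symm)
    obtain ⟨j, hj⟩ := hl _ _ h
    refine ⟨b - a, by omega, j, ?_⟩
    apply (g ^ a).injective
    rw [egn, ← hj, ← Equiv.Perm.mul_apply, ← pow_add]
    congr 3
    omega
  classical
  obtain ⟨hL, j, hj⟩ := Nat.find_spec hper
  have hmin : ∀ i : ℕ, 0 < i → i < Nat.find hper → ∀ j : ℤ, (g ^ i) v ≠ j +ᵥ v := by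
    intro i hi hi' j h
    exact Nat.find_min hper hi' ⟨hi, j, h⟩
  set L := Nat.find hper with hLdef
  clear_value L
  have hj' : ∀ i : ℤ, (g ^ i) v = j +ᵥ (g ^ (i - L)) v := by
    intro i
    have h1 : (g ^ i) v = (g ^ (i - L)) ((g ^ L) v) := by
      rw [← zpow_natCast, ← Equiv.Perm.mul_apply, ← zpow_add]
      congr 2
      ring
    rw [h1, hj]
    have h2 : ∀ (i : ℤ) (x : X), (g ^ i) (j +ᵥ x) = j +ᵥ (g ^ i) x := by
      intro i x
      obtain ⟨n, rfl | rfl⟩ := i.eq_nat_or_neg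
      · exact egn n j x
      · apply (g ^ n).injective
        simp only [egn, zpow_neg, zpow_natCast, ← Equiv.Perm.mul_apply, mul_inv_cancel, Equiv.Perm.one_apply]
    exact h2 _ _
  have hj0 : j = 0 := by
    rcases Nat.even_or_odd' L with ⟨i, hi | hi⟩
    · have h1 : τ ((g ^ (i : ℤ)) v) = (-j) +ᵥ (g ^ (i : ℤ)) v := by
        have h2 := tgv i
        change τ _ = _ at h2
        rw [h2, hj' i, neg_vadd_vadd, hi]
        congr 2
        push_cast
        ring
      have := shift_eq_zero hfree hτ eτ h1
      omega
    · have h1 : σ ((g ^ (i : ℤ)) v) = (-j) +ᵥ (g ^ (i : ℤ)) v := by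
        have h2 := sgv i
        change σ _ = _ at h2
        rw [h2, hj' i, neg_vadd_vadd, hi]
        congr 2
        push_cast
        ring
      have := shift_eq_zero hfree hσ eσ h1
      omega
  subst hj0
  simp only [zero_vadd] at hj hj'
  have hmin' : ∀ i : ℕ, 0 < i → i < L → (g ^ i) v ≠ v := fun i h h' h'' =>
    hmin i h h' 0 (by rw [h'', zero_vadd])
  have hMP : Function.minimalPeriod (fun x => g • x) v = L := by
    have h1 : Function.IsPeriodicPt (fun x => g • x) L v := by
      change (fun x => g • x)^[L] v = v
      rw [smul_iterate]
      exact hj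
    apply le_antisymm (h1.minimalPeriod_le hL)
    by_contra hlt
    refine hmin' _ (h1.minimalPeriod_pos hL) (not_le.1 hlt) ?_
    have h2 := Function.isPeriodicPt_minimalPeriod (fun x => g • x) v
    change (fun x => g • x)^[_] v = v at h2
    rw [smul_iterate] at h2
    exact h2
  have hdvd : ∀ i : ℤ, (g ^ i) v = v ↔ (L : ℤ) ∣ i := by
    intro i
    have := MulAction.zpow_smul_eq_iff_minimalPeriod_dvd (a := g) (b := v) (n := i)
    rw [hMP] at this
    exact this
  have hsub : ∀ a b : ℤ, (L : ℤ) ∣ a - b → (g ^ a) v = (g ^ b) v := by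
    intro a b h
    have h1 : (g ^ a) v = (g ^ b) ((g ^ (a - b)) v) := by
      rw [← Equiv.Perm.mul_apply, ← zpow_add]
      congr 2
      ring
    rw [h1, (hdvd _).2 h]
  have hbackτ : ∀ i : ℤ, τ ((g ^ i) v) = (g ^ i) v ↔ (L : ℤ) ∣ 2 * i := by
    intro i
    have h2 := tgv i
    change τ _ = _ at h2
    rw [h2, ← hdvd]
    constructor
    · intro h
      have : (g ^ (2 * i)) v = (g ^ i) ((g ^ i) v) := by
        rw [← Equiv.Perm.mul_apply, ← zpow_add]
        congr 2
        ring
      rw [this, ← h, ← Equiv.Perm.mul_apply, ← zpow_add]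
      simp
    · intro h
      have h3 := hsub i (-i) (by rw [hdvd] at h; convert h using 1; ring)
      exact h3.symm
  have hbackσ : ∀ i : ℤ, σ ((g ^ i) v) = (g ^ i) v ↔ (L : ℤ) ∣ 2 * i + 1 := by
    intro i
    have h2 := sgv i
    change σ _ = _ at h2
    rw [h2, ← hdvd]
    constructor
    · intro h
      have : (g ^ (2 * i + 1)) v = (g ^ (i + 1)) ((g ^ i) v) := by
        rw [← Equiv.Perm.mul_apply, ← zpow_add]
        congr 2
        ring
      rw [this, ← h, ← Equiv.Perm.mul_apply, ← zpow_add]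
      ring_nf
      simp
    · intro h
      have h3 := hsub i (-i - 1) (by rw [hdvd] at h; convert h using 1; ring)
      exact h3.symm
  have hfinite : {w | Linked σ τ v w}.Finite := by
    refine (Set.finite_range fun i : Fin L => (g ^ (i : ℤ)) v).subset ?_
    intro w hw
    obtain ⟨i, rfl⟩ := orb w hw
    have hLpos : (0 : ℤ) < L := by exact_mod_cast hL
    have h1 := Int.emod_nonneg i hLpos.ne'
    have h2 := Int.emod_lt_of_pos i hLpos
    refine ⟨⟨(i % L).toNat, by omega⟩, ?_⟩
    apply hsub
    have h3 : (((i % L).toNat : ℕ) : ℤ) = i % L := Int.toNat_of_nonneg h1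
    simp only [h3]
    exact ⟨-(i / L), by linarith [Int.emod_add_mul_ediv i L]⟩
  refine ⟨?_, hfinite⟩
  rcases Nat.even_or_odd' L with ⟨h, hh | hh⟩
  · refine ⟨(g ^ (h : ℤ)) v, ⟨?_, Or.inr ?_, lnk h⟩, ?_⟩
    · rw [Ne, hdvd]
      intro hd
      have := Int.le_of_dvd (by omega) hd
      omega
    · rw [hbackτ]
      exact ⟨1, by rw [hh]; push_cast; ring⟩
    · rintro w ⟨hwv, hw, hl⟩
      obtain ⟨i, rfl⟩ := orb w hl
      rw [hbackτ, hbackσ] at hw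
      rw [Ne, hdvd] at hwv
      rcases hw with ⟨c, hc⟩ | ⟨c, hc⟩
      · exfalso
        rw [hh] at hc
        push_cast at hc
        rw [mul_assoc] at hc
        omega
      · apply hsub
        rw [hh] at hc hwv ⊢
        push_cast at hc hwv ⊢
        rw [mul_assoc] at hc
        have hc' : i = h * c := by omega
        rcases Int.even_or_odd' c with ⟨d, hd | hd⟩
        · exact (hwv ⟨d, by rw [hc', hd]; ring⟩).elim
        · exact ⟨d, by rw [hc', hd]; ring⟩
  · have key : ∀ a : ℤ, (L : ℤ) ∣ 2 * a → (L : ℤ) ∣ a := by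
      intro a ha
      refine IsCoprime.dvd_of_dvd_mul_left ?_ ha
      exact ⟨1, -h, by rw [hh]; push_cast; ring⟩
    refine ⟨(g ^ (h : ℤ)) v, ⟨?_, Or.inl ?_, lnk h⟩, ?_⟩
    · intro hd
      rcases Nat.eq_zero_or_pos h with h0 | h0
      · refine hdis v ⟨?_, hv⟩
        have h1 := (hbackσ 0).2 (by rw [hh, h0]; simp)
        simpa using h1
      · rw [hdvd] at hd
        have := Int.le_of_dvd (by omega) hd
        omega
    · rw [hbackσ]
      exact ⟨1, by rw [hh]; push_cast; ring⟩
    · rintro w ⟨hwv, hw, hl⟩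
      obtain ⟨i, rfl⟩ := orb w hl
      rw [hbackτ, hbackσ] at hw
      rw [Ne, hdvd] at hwv
      rcases hw with hw | hw
      · apply hsub
        apply key
        have : (2 * (i - h) : ℤ) = (2 * i + 1) - L := by rw [hh]; push_cast; ring
        rw [this]
        exact dvd_sub_self_right.2 hw
      · exact (hwv (key i hw)).elim

/-- In the graph with edges `x — σ x` and `x — τ x`, each fixed point `v` of `σ` or `τ` is
connected to exactly one other such point, and its component is finite. -/
theorem linked_main (hfree : FreeShift X) (hfin : FinOrbits X)
    (hσ : Function.Involutive σ) (hτ : Function.Involutive τ)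
    (eσ : ∀ (j : ℤ) x, σ (j +ᵥ x) = j +ᵥ σ x) (eτ : ∀ (j : ℤ) x, τ (j +ᵥ x) = j +ᵥ τ x)
    (hdis : ∀ x, ¬(σ x = x ∧ τ x = x)) {v : X} (hv : σ v = v ∨ τ v = v) :
    (∃! w, w ≠ v ∧ (σ w = w ∨ τ w = w) ∧ Linked σ τ v w) ∧ {w | Linked σ τ v w}.Finite := by
  rcases hv with hv | hv
  · obtain ⟨⟨w, ⟨h1, h2, h3⟩, h4⟩, h5⟩ :=
      linked_core hfree hfin hτ hσ eτ eσ (fun x h => hdis x h.symm) hv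
    refine ⟨⟨w, ⟨h1, h2.symm, h3.swap⟩, ?_⟩, h5.subset fun w h => Linked.swap h⟩
    rintro u ⟨k1, k2, k3⟩
    exact h4 u ⟨k1, k2.symm, k3.swap⟩
  · exact linked_core hfree hfin hσ hτ eσ eτ hdis hv

end Linked

/-! ### Affine diagrams -/

/-- The order in which the points on the boundary of the strip are met when one follows first the
inner boundary line from left to right and then the outer boundary line from right to left. -/
def Before {m n : ℕ} : MarkedPt m ⊕ MarkedPt n → MarkedPt m ⊕ MarkedPt n → Prop
  | Sum.inl x, Sum.inl y => x.pos < y.pos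
  | Sum.inl _, Sum.inr _ => True
  | Sum.inr _, Sum.inl _ => False
  | Sum.inr x, Sum.inr y => y.pos < x.pos

/-- An affine `(m, n)`-diagram: an isotopy class of diagrams on the annulus, with `m` marked points
on the inner and `n` on the outer boundary, that consist of disjoint arcs joining the marked points
in pairs, and of noncontractible loops. It is given by the pairing that the lifted arcs induce on
the points over the marked points (inner points on the left of `⊕`, outer points on the right), and
the number of noncontractible loops. -/
structure AffineDiagram (m n : ℕ) where
  /-- the other end point of the lifted arc that starts at a point -/
  mate : MarkedPt m ⊕ MarkedPt n → MarkedPt m ⊕ MarkedPt n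
  mate_mate : ∀ x, mate (mate x) = x
  mate_ne : ∀ x, mate x ≠ x
  mate_vadd : ∀ (j : ℤ) x, mate (j +ᵥ x) = j +ᵥ mate x
  /-- disjointness of the lifted arcs: two pairs of end points are not interlaced -/
  noncrossing : ∀ x y, Before x y → Before y (mate x) →
    Before x (mate y) ∧ Before (mate y) (mate x)
  /-- the number of noncontractible loops -/
  loops : ℕ
  /-- disjointness of loops and arcs: a noncontractible loop separates the two boundary circles -/
  loops_disjoint : loops ≠ 0 → ∀ x : MarkedPt m, ∃ y : MarkedPt m, mate (Sum.inl x) = Sum.inl y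

theorem AffineDiagram.ext' {m n : ℕ} {D E : AffineDiagram m n} (h1 : ∀ x, D.mate x = E.mate x)
    (h2 : D.loops = E.loops) : D = E := by
  cases D
  cases E
  obtain rfl := funext h1
  obtain rfl := h2
  rfl

theorem Before.trans {m n : ℕ} {x y z : MarkedPt m ⊕ MarkedPt n} (h : Before x y)
    (h' : Before y z) : Before x z := by
  rcases x with x | x <;> rcases y with y | y <;> rcases z with z | z <;>
    simp only [Before] at h h' ⊢ <;> omega

theorem Before.irrefl {m n : ℕ} (x : MarkedPt m ⊕ MarkedPt n) : ¬ Before x x := by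
  rcases x with x | x <;> simp [Before]

theorem Before.total {m n : ℕ} {x y : MarkedPt m ⊕ MarkedPt n} (h : x ≠ y) :
    Before x y ∨ Before y x := by
  rcases x with x | x <;> rcases y with y | y <;> simp only [Before, or_true, true_or]
  · exact lt_or_gt_of_ne fun h' => h (congrArg Sum.inl (MarkedPt.ext h'))
  · exact lt_or_gt_of_ne fun h' => h (congrArg Sum.inr (MarkedPt.ext h'.symm))

open Classical in
/-- The indicator of a proposition, modulo two. -/
noncomputable def ind (P : Prop) : ZMod 2 := if P then 1 else 0

theorem ind_pos {P : Prop} (h : P) : ind P = 1 := if_pos h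

theorem ind_neg {P : Prop} (h : ¬ P) : ind P = 0 := if_neg h

/-- Parity of the number of points of `S` before `v`. -/
noncomputable def parity {m n : ℕ} (S : Finset (MarkedPt m ⊕ MarkedPt n))
    (v : MarkedPt m ⊕ MarkedPt n) : ZMod 2 := ∑ x ∈ S, ind (Before x v)

theorem card_parity {m n : ℕ} (D : AffineDiagram m n) (S : Finset (MarkedPt m ⊕ MarkedPt n))
    (hS : ∀ x ∈ S, D.mate x ∈ S) : ∑ _x ∈ S, (1 : ZMod 2) = 0 := by
  refine Finset.sum_involution (fun x _ => D.mate x) ?_ ?_ ?_ ?_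
  · intro x hx
    decide
  · intro x hx _
    exact D.mate_ne x
  · intro x hx
    exact hS x hx
  · intro x hx
    exact D.mate_mate x

theorem parity_mate {m n : ℕ} (D : AffineDiagram m n) (S : Finset (MarkedPt m ⊕ MarkedPt n))
    (hS : ∀ x ∈ S, D.mate x ∈ S) {v : MarkedPt m ⊕ MarkedPt n} (hv : v ∉ S) :
    parity S (D.mate v) = parity S v := by
  classical
  have hv' : D.mate v ∉ S := fun h => hv (D.mate_mate v ▸ hS _ h)
  wlog h : Before v (D.mate v) generalizing v
  · have h2 : Before (D.mate v) v := (Before.total (D.mate_ne v).symm).resolve_left h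
    have := this hv' (by rw [D.mate_mate]; exact hv) (by rw [D.mate_mate]; exact h2)
    rw [D.mate_mate] at this
    exact this.symm
  suffices h0 : parity S (D.mate v) + parity S v = 0 from CharTwo.add_eq_zero.1 h0
  rw [parity, parity, ← Finset.sum_add_distrib]
  have key : ∀ x ∈ S, ind (Before x (D.mate v)) + ind (Before x v) =
      ind (Before v x ∧ Before x (D.mate v)) := by
    intro x hx
    have h1 : x ≠ v := fun h => hv (h ▸ hx)
    by_cases h2 : Before x v
    · have h3 : Before x (D.mate v) := h2.trans h
      have h4 : ¬ Before v x := fun h4 => Before.irrefl x (h2.trans h4)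
      rw [ind_pos h2, ind_pos h3, ind_neg fun h => h4 h.1]
      decide
    · have h3 : Before v x := (Before.total h1).resolve_left h2
      simp [h2, h3, ind_neg]
  rw [Finset.sum_congr rfl key]
  have hiff : ∀ x, (Before v (D.mate x) ∧ Before (D.mate x) (D.mate v)) ↔
      (Before v x ∧ Before x (D.mate v)) := by
    intro x
    constructor
    · rintro ⟨h1, h2⟩
      have := D.noncrossing v (D.mate x) h1 h2
      rwa [D.mate_mate] at this
    · rintro ⟨h1, h2⟩
      exact D.noncrossing v x h1 h2
  refine Finset.sum_involution (fun x _ => D.mate x) ?_ ?_ ?_ ?_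
  · intro x hx
    simp only [hiff]
    exact CharTwo.add_self_eq_zero _
  · intro x hx _
    exact D.mate_ne x
  · intro x hx
    exact hS x hx
  · intro x hx
    exact D.mate_mate x

/-! ### Composition of affine diagrams -/

section Glue

variable {k m n : ℕ}

/-- The points of the glued strip: inner points, points on the gluing line, outer points. -/
abbrev GluePt (k m n : ℕ) : Type := MarkedPt k ⊕ (MarkedPt m ⊕ MarkedPt n)

/-- The boundary points of the glued strip. -/
def bdPt (k m n : ℕ) : MarkedPt k ⊕ MarkedPt n → GluePt k m n := Sum.map id Sum.inr

/-- The points on the gluing line. -/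
def midPt (k m n : ℕ) (y : MarkedPt m) : GluePt k m n := Sum.inr (Sum.inl y)

/-- Follow the arc of the inner diagram `D`, at a point where there is one. -/
def innerStep (n : ℕ) (D : AffineDiagram k m) : GluePt k m n → GluePt k m n
  | Sum.inl x => Sum.map id Sum.inl (D.mate (Sum.inl x))
  | Sum.inr (Sum.inl y) => Sum.map id Sum.inl (D.mate (Sum.inr y))
  | Sum.inr (Sum.inr z) => Sum.inr (Sum.inr z)

/-- Follow the arc of the outer diagram `E`, at a point where there is one. -/
def outerStep (k : ℕ) (E : AffineDiagram m n) : GluePt k m n → GluePt k m n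
  | Sum.inl x => Sum.inl x
  | Sum.inr u => Sum.inr (E.mate u)

/-- Two points lie on the same lifted strand of the diagram `E ∘ D` (`D` placed inside `E`). -/
def Conn (E : AffineDiagram m n) (D : AffineDiagram k m) : GluePt k m n → GluePt k m n → Prop :=
  Linked (innerStep n D) (outerStep k E)

variable (E : AffineDiagram m n) (D : AffineDiagram k m)

theorem innerStep_map (u : MarkedPt k ⊕ MarkedPt m) :
    innerStep n D (Sum.map id Sum.inl u) = Sum.map id Sum.inl (D.mate u) := by
  rcases u with x | y <;> rfl

theorem outerStep_inr (u : MarkedPt m ⊕ MarkedPt n) :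
    outerStep k E (Sum.inr u) = Sum.inr (E.mate u) := rfl

theorem vadd_map (j : ℤ) (u : MarkedPt k ⊕ MarkedPt m) :
    (j +ᵥ (Sum.map id Sum.inl u : GluePt k m n)) = Sum.map id Sum.inl (j +ᵥ u) := by
  rcases u with x | y <;> rfl

theorem vadd_bdPt (j : ℤ) (u : MarkedPt k ⊕ MarkedPt n) :
    j +ᵥ bdPt k m n u = bdPt k m n (j +ᵥ u) := by
  rcases u with x | y <;> rfl

theorem vadd_midPt (j : ℤ) (y : MarkedPt m) :
    j +ᵥ midPt k m n y = midPt k m n (j +ᵥ y) := rfl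

theorem bdPt_injective : Function.Injective (bdPt k m n) :=
  Sum.map_injective.2 ⟨Function.injective_id, Sum.inr_injective⟩

theorem innerStep_involutive : Function.Involutive (innerStep n D) := by
  rintro (x | y | z)
  · change innerStep n D (Sum.map id Sum.inl (D.mate (Sum.inl x))) = _
    rw [innerStep_map, D.mate_mate]; rfl
  · change innerStep n D (Sum.map id Sum.inl (D.mate (Sum.inr y))) = _
    rw [innerStep_map, D.mate_mate]; rfl
  · rfl

theorem outerStep_involutive : Function.Involutive (outerStep k E) := by
  rintro (x | u)
  · rfl
  · rw [outerStep_inr, outerStep_inr, E.mate_mate]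

theorem innerStep_vadd (j : ℤ) (x : GluePt k m n) :
    innerStep n D (j +ᵥ x) = j +ᵥ innerStep n D x := by
  rcases x with x | y | z
  · change Sum.map id Sum.inl (D.mate (j +ᵥ Sum.inl x)) = j +ᵥ Sum.map id Sum.inl _
    rw [D.mate_vadd, vadd_map]
  · change Sum.map id Sum.inl (D.mate (j +ᵥ Sum.inr y)) = j +ᵥ Sum.map id Sum.inl _
    rw [D.mate_vadd, vadd_map]
  · rfl

theorem outerStep_vadd (j : ℤ) (x : GluePt k m n) :
    outerStep k E (j +ᵥ x) = j +ᵥ outerStep k E x := by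
  rcases x with x | u
  · rfl
  · change Sum.inr (E.mate (j +ᵥ u)) = j +ᵥ Sum.inr (E.mate u)
    rw [E.mate_vadd]; rfl

theorem Conn.vadd {E : AffineDiagram m n} {D : AffineDiagram k m} (j : ℤ) {x y : GluePt k m n}
    (h : Conn E D x y) : Conn E D (j +ᵥ x) (j +ᵥ y) :=
  Linked.vadd (innerStep_vadd D) (outerStep_vadd E) j h

theorem map_inl_injective :
    Function.Injective (Sum.map id Sum.inl : MarkedPt k ⊕ MarkedPt m → GluePt k m n) :=
  Sum.map_injective.2 ⟨Function.injective_id, Sum.inl_injective⟩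

theorem innerStep_fixed (x : GluePt k m n) : innerStep n D x = x ↔ ∃ z, x = Sum.inr (Sum.inr z) := by
  rcases x with x | y | z
  · refine ⟨fun h => ?_, fun ⟨z, h⟩ => by cases h⟩
    exact (D.mate_ne _ (map_inl_injective (n := n) (h : _ = Sum.map id Sum.inl (Sum.inl x)))).elim
  · refine ⟨fun h => ?_, fun ⟨z, h⟩ => by cases h⟩
    exact (D.mate_ne _ (map_inl_injective (n := n) (h : _ = Sum.map id Sum.inl (Sum.inr y)))).elim
  · exact ⟨fun _ => ⟨z, rfl⟩, fun _ => rfl⟩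

theorem outerStep_fixed (x : GluePt k m n) : outerStep k E x = x ↔ ∃ z, x = Sum.inl z := by
  rcases x with x | u
  · exact ⟨fun _ => ⟨x, rfl⟩, fun _ => rfl⟩
  · refine ⟨fun h => (E.mate_ne _ (Sum.inr_injective h)).elim, fun ⟨z, h⟩ => by cases h⟩

theorem fixed_iff_bdPt (x : GluePt k m n) :
    (innerStep n D x = x ∨ outerStep k E x = x) ↔ ∃ b, x = bdPt k m n b := by
  rw [innerStep_fixed, outerStep_fixed]
  constructor
  · rintro (⟨z, rfl⟩ | ⟨z, rfl⟩)
    · exact ⟨Sum.inr z, rfl⟩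
    · exact ⟨Sum.inl z, rfl⟩
  · rintro ⟨x | z, rfl⟩
    · exact Or.inr ⟨x, rfl⟩
    · exact Or.inl ⟨z, rfl⟩

theorem conn_main (b : MarkedPt k ⊕ MarkedPt n) :
    (∃! w, w ≠ bdPt k m n b ∧ (innerStep n D w = w ∨ outerStep k E w = w) ∧
      Conn E D (bdPt k m n b) w) ∧ {w | Conn E D (bdPt k m n b) w}.Finite := by
  refine linked_main (freeShift_sum (freeShift_markedPt k)
    (freeShift_sum (freeShift_markedPt m) (freeShift_markedPt n)))
    (finOrbits_sum (finOrbits_markedPt k)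
    (finOrbits_sum (finOrbits_markedPt m) (finOrbits_markedPt n)))
    (innerStep_involutive D) (outerStep_involutive E) (innerStep_vadd D) (outerStep_vadd E) ?_
    ((fixed_iff_bdPt E D _).2 ⟨b, rfl⟩)
  rintro x ⟨h1, h2⟩
  obtain ⟨z, rfl⟩ := (innerStep_fixed D x).1 h1
  obtain ⟨y, h⟩ := (outerStep_fixed E _).1 h2
  cases h

/-- Each boundary point of the glued strip lies on a strand with exactly one other end point. -/
theorem existsUnique_mate (b : MarkedPt k ⊕ MarkedPt n) :
    ∃! c, c ≠ b ∧ Conn E D (bdPt k m n b) (bdPt k m n c) := by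
  obtain ⟨w, ⟨h1, h2, h3⟩, h4⟩ := (conn_main E D b).1
  obtain ⟨c, rfl⟩ := (fixed_iff_bdPt E D w).1 h2
  refine ⟨c, ⟨fun h => h1 (h ▸ rfl), h3⟩, ?_⟩
  rintro d ⟨k1, k2⟩
  exact bdPt_injective (h4 _ ⟨fun h => k1 (bdPt_injective h),
    (fixed_iff_bdPt E D _).2 ⟨d, rfl⟩, k2⟩)

/-- The other end point of the strand of `E ∘ D` that starts at a boundary point. -/
noncomputable def compMate (b : MarkedPt k ⊕ MarkedPt n) : MarkedPt k ⊕ MarkedPt n :=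
  (existsUnique_mate E D b).choose

theorem compMate_ne (b : MarkedPt k ⊕ MarkedPt n) : compMate E D b ≠ b :=
  (existsUnique_mate E D b).choose_spec.1.1

theorem compMate_conn (b : MarkedPt k ⊕ MarkedPt n) :
    Conn E D (bdPt k m n b) (bdPt k m n (compMate E D b)) :=
  (existsUnique_mate E D b).choose_spec.1.2

theorem compMate_unique {b c : MarkedPt k ⊕ MarkedPt n} (h : c ≠ b)
    (h' : Conn E D (bdPt k m n b) (bdPt k m n c)) : c = compMate E D b :=
  (existsUnique_mate E D b).choose_spec.2 c ⟨h, h'⟩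

theorem conn_bdPt_iff {b c : MarkedPt k ⊕ MarkedPt n} :
    Conn E D (bdPt k m n b) (bdPt k m n c) ↔ c = b ∨ c = compMate E D b := by
  constructor
  · intro h
    by_cases hc : c = b
    · exact Or.inl hc
    · exact Or.inr (compMate_unique E D hc h)
  · rintro (rfl | rfl)
    · exact Linked.refl _
    · exact compMate_conn E D b

/-- Parity of the position relative to a set of points of the glued strip. -/
noncomputable def side (A : Finset (MarkedPt k)) (B : Finset (MarkedPt m))
    (C : Finset (MarkedPt n)) : GluePt k m n → ZMod 2
  | Sum.inl x => ∑ z ∈ A, ind (z.pos < x.pos)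
  | Sum.inr (Sum.inl y) => ∑ z ∈ B, ind (z.pos < y.pos)
  | Sum.inr (Sum.inr x) => ∑ _z ∈ B, 1 + ∑ z ∈ C, ind (x.pos < z.pos)

/-- The component of a boundary point, as three finite sets. -/
theorem exists_component (b : MarkedPt k ⊕ MarkedPt n) :
    ∃ (A : Finset (MarkedPt k)) (B : Finset (MarkedPt m)) (C : Finset (MarkedPt n)),
      (∀ x, x ∈ A ↔ Conn E D (bdPt k m n b) (Sum.inl x)) ∧
      (∀ x, x ∈ B ↔ Conn E D (bdPt k m n b) (Sum.inr (Sum.inl x))) ∧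
      (∀ x, x ∈ C ↔ Conn E D (bdPt k m n b) (Sum.inr (Sum.inr x))) := by
  have h := (conn_main E D b).2
  refine ⟨(h.preimage (f := Sum.inl) Sum.inl_injective.injOn).toFinset,
    (h.preimage (f := Sum.inr ∘ Sum.inl)
      (Sum.inr_injective.comp Sum.inl_injective).injOn).toFinset,
    (h.preimage (f := Sum.inr ∘ Sum.inr)
      (Sum.inr_injective.comp Sum.inr_injective).injOn).toFinset, ?_, ?_, ?_⟩ <;> intro x <;> simp

theorem component_parity {b : MarkedPt k ⊕ MarkedPt n}
    {A : Finset (MarkedPt k)} {B : Finset (MarkedPt m)}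
    (hA : ∀ x, x ∈ A ↔ Conn E D (bdPt k m n b) (Sum.inl x))
    (hB : ∀ x, x ∈ B ↔ Conn E D (bdPt k m n b) (Sum.inr (Sum.inl x))) :
    (∀ u, u ∈ A.disjSum B ↔ Conn E D (bdPt k m n b) (Sum.map id Sum.inl u)) ∧
    (∀ u ∈ A.disjSum B, D.mate u ∈ A.disjSum B) ∧
    ∑ _x ∈ A, (1 : ZMod 2) + ∑ _x ∈ B, (1 : ZMod 2) = 0 := by
  have h1 : ∀ u, u ∈ A.disjSum B ↔ Conn E D (bdPt k m n b) (Sum.map id Sum.inl u) := by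
    rintro (x | x)
    · simp [Finset.inl_mem_disjSum, hA]
    · simp [Finset.inr_mem_disjSum, hB]
  have h2 : ∀ u ∈ A.disjSum B, D.mate u ∈ A.disjSum B := by
    intro u hu
    rw [h1] at hu ⊢
    rw [← innerStep_map]
    exact hu.trans (Linked.left _)
  refine ⟨h1, h2, ?_⟩
  have := card_parity D _ h2
  rwa [Finset.sum_disjSum] at this

theorem side_eq {b : MarkedPt k ⊕ MarkedPt n}
    {A : Finset (MarkedPt k)} {B : Finset (MarkedPt m)} {C : Finset (MarkedPt n)}
    (hA : ∀ x, x ∈ A ↔ Conn E D (bdPt k m n b) (Sum.inl x))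
    (hB : ∀ x, x ∈ B ↔ Conn E D (bdPt k m n b) (Sum.inr (Sum.inl x)))
    (hC : ∀ x, x ∈ C ↔ Conn E D (bdPt k m n b) (Sum.inr (Sum.inr x)))
    {u w : GluePt k m n} (h : Conn E D u w) (hu : ¬ Conn E D (bdPt k m n b) u) :
    side A B C u = side A B C w := by
  classical
  obtain ⟨a1, a2, a3⟩ := component_parity E D hA hB
  have b1 : ∀ u, u ∈ B.disjSum C ↔ Conn E D (bdPt k m n b) (Sum.inr u) := by
    rintro (x | x)
    · simp [Finset.inl_mem_disjSum, hB]
    · simp [Finset.inr_mem_disjSum, hC]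
  have b2 : ∀ u ∈ B.disjSum C, E.mate u ∈ B.disjSum C := by
    intro u hu
    rw [b1] at hu ⊢
    rw [← outerStep_inr]
    exact hu.trans (Linked.right _)
  have sL : ∀ u, Sum.map id Sum.inl u ∉ {w | Conn E D (bdPt k m n b) w} →
      side A B C (Sum.map id Sum.inl u) = parity (A.disjSum B) u := by
    rintro (x | y) hn
    · simp [side, parity, Finset.sum_disjSum, Before, ind_neg]
    · simp only [side, parity, Finset.sum_disjSum, Before, Sum.map_inr, ind_pos]
      have hy : y ∉ B := fun h => hn ((hB y).1 h)
      have h3 : ∑ z ∈ B, (1 : ZMod 2) = ∑ z ∈ B, ind (z.pos < y.pos) +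
          ∑ z ∈ B, ind (y.pos < z.pos) := by
        rw [← Finset.sum_add_distrib]
        refine Finset.sum_congr rfl fun z hz => ?_
        have h4 : z.pos ≠ y.pos := fun h => hy (MarkedPt.ext h ▸ hz)
        rcases lt_or_gt_of_ne h4 with h5 | h5
        · rw [ind_pos h5, ind_neg h5.le.not_gt, add_zero]
        · rw [ind_pos h5, ind_neg (not_lt.2 (le_of_lt h5)), zero_add]
      rw [h3] at a3
      rw [← CharTwo.add_eq_zero, ← a3]
      ring
  have sH : ∀ u, side A B C (Sum.inr u) = parity (B.disjSum C) u := by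
    rintro (x | y)
    · simp [side, parity, Finset.sum_disjSum, Before, ind_neg]
    · simp [side, parity, Finset.sum_disjSum, Before, ind_pos]
  suffices hh : ¬ Conn E D (bdPt k m n b) w ∧ side A B C w = side A B C u from hh.2.symm
  refine Linked.induct (innerStep_involutive D) (outerStep_involutive E)
    (P := fun w => ¬ Conn E D (bdPt k m n b) w ∧ side A B C w = side A B C u) ?_ ?_ h ⟨hu, rfl⟩
  · rintro x ⟨h1, h2⟩
    have h1' : ¬ Conn E D (bdPt k m n b) (innerStep n D x) := fun h3 =>
      h1 (h3.trans (Linked.left x).symm)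
    refine ⟨h1', h2 ▸ ?_⟩
    by_cases hx : ∃ u, x = Sum.map id Sum.inl u
    · obtain ⟨u, rfl⟩ := hx
      rw [innerStep_map] at h1' ⊢
      rw [sL _ h1', sL _ h1]
      exact parity_mate D _ a2 fun h => h1 ((a1 u).1 h)
    · rcases x with x | y | z
      · exact (hx ⟨Sum.inl x, rfl⟩).elim
      · exact (hx ⟨Sum.inr y, rfl⟩).elim
      · rfl
  · rintro x ⟨h1, h2⟩
    have h1' : ¬ Conn E D (bdPt k m n b) (outerStep k E x) := fun h3 =>
      h1 (h3.trans (Linked.right x).symm)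
    refine ⟨h1', h2 ▸ ?_⟩
    rcases x with x | x
    · rfl
    · rw [outerStep_inr, sH, sH]
      exact parity_mate E _ b2 fun h => h1 ((b1 x).1 h)

theorem compMate_compMate (b : MarkedPt k ⊕ MarkedPt n) :
    compMate E D (compMate E D b) = b :=
  (compMate_unique E D (compMate_ne E D b).symm (compMate_conn E D b).symm).symm

theorem compMate_vadd (j : ℤ) (b : MarkedPt k ⊕ MarkedPt n) :
    compMate E D (j +ᵥ b) = j +ᵥ compMate E D b := by
  refine (compMate_unique E D ?_ ?_).symm
  · intro h
    exact compMate_ne E D b (vadd_left_cancel j h)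
  · rw [← vadd_bdPt, ← vadd_bdPt]
    exact (compMate_conn E D b).vadd j

theorem component_bd {b : MarkedPt k ⊕ MarkedPt n}
    {A : Finset (MarkedPt k)} {C : Finset (MarkedPt n)}
    (hA : ∀ x, x ∈ A ↔ Conn E D (bdPt k m n b) (Sum.inl x))
    (hC : ∀ x, x ∈ C ↔ Conn E D (bdPt k m n b) (Sum.inr (Sum.inr x))) :
    open Classical in
    A.disjSum C = {b, compMate E D b} := by
  classical
  ext u
  have : u ∈ A.disjSum C ↔ Conn E D (bdPt k m n b) (bdPt k m n u) := by
    rcases u with u | u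
    · rw [Finset.inl_mem_disjSum, hA]; rfl
    · rw [Finset.inr_mem_disjSum, hC]; rfl
  rw [this, conn_bdPt_iff]
  simp

theorem compMate_noncrossing (x y : MarkedPt k ⊕ MarkedPt n) (h1 : Before x y)
    (h2 : Before y (compMate E D x)) :
    Before x (compMate E D y) ∧ Before (compMate E D y) (compMate E D x) := by
  classical
  obtain ⟨A, B, C, hA, hB, hC⟩ := exists_component E D x
  obtain ⟨-, -, a3⟩ := component_parity E D hA hB
  have hAC := component_bd E D hA hC
  have hs : ∀ u : MarkedPt k ⊕ MarkedPt n, side A B C (bdPt k m n u) =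
      ind (Before x u) + ind (Before (compMate E D x) u) := by
    intro u
    have h3 : side A B C (bdPt k m n u) = parity (A.disjSum C) u := by
      rcases u with u | u
      · simp [side, parity, Finset.sum_disjSum, Before, bdPt, ind_neg]
      · simp only [side, parity, Finset.sum_disjSum, Before, bdPt, Sum.map_inr, ind_pos]
        rw [CharTwo.add_eq_zero.1 a3]
    rw [h3, hAC, parity, Finset.sum_pair (compMate_ne E D x).symm]
  have hxy : y ≠ x := by
    rintro rfl
    exact Before.irrefl _ h1
  have hcy : y ≠ compMate E D x := fun h => Before.irrefl y (by rw [← h] at h2; exact h2)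
  have hn : ¬ Conn E D (bdPt k m n x) (bdPt k m n y) := by
    rw [conn_bdPt_iff]
    exact not_or.2 ⟨hxy, hcy⟩
  have h3 := side_eq E D hA hB hC (compMate_conn E D y) hn
  rw [hs, hs] at h3
  have h4 : ¬ Before (compMate E D x) y := fun h => Before.irrefl y (h2.trans h)
  have h5 : compMate E D y ≠ compMate E D x := fun h => hxy (by
    rw [← compMate_compMate E D y, h, compMate_compMate])
  have h6 : Before x (compMate E D x) := h1.trans h2
  rw [ind_pos h1, ind_neg h4] at h3
  by_cases h7 : Before x (compMate E D y)
  · refine ⟨h7, (Before.total h5).resolve_right fun h8 => ?_⟩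
    rw [ind_pos h7, ind_pos h8] at h3
    exact absurd h3 (by decide)
  · have h8 : ¬ Before (compMate E D x) (compMate E D y) := fun h8 => h7 (h6.trans h8)
    rw [ind_neg h7, ind_neg h8] at h3
    exact absurd h3 (by decide)

/-- The point `y` of the gluing line lies on a closed strand of `E ∘ D` that is a contractible
loop: it is not connected to the boundary, and the lifted strand is not shift invariant. -/
def OnContractible (y : MarkedPt m) : Prop :=
  (∀ b, ¬ Conn E D (midPt k m n y) (bdPt k m n b)) ∧
    ∀ j : ℤ, j ≠ 0 → ¬ Conn E D (midPt k m n y) (midPt k m n (j +ᵥ y))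

/-- The point `y` of the gluing line lies on a noncontractible loop of `E ∘ D`: the lifted strand
is invariant under a nontrivial shift. -/
def OnNoncontractible (y : MarkedPt m) : Prop :=
  ∃ j : ℤ, j ≠ 0 ∧ Conn E D (midPt k m n y) (midPt k m n (j +ᵥ y))

/-- Two points of the gluing line lie over the same strand of `E ∘ D` on the annulus. -/
def SameStrand (y z : MarkedPt m) : Prop :=
  ∃ j : ℤ, Conn E D (midPt k m n y) (midPt k m n (j +ᵥ z))

/-- The number of contractible loops that arise when `D` is placed inside `E`. -/
noncomputable def contractibleLoops : ℕ :=
  Nat.card (Quot fun y z : {y // OnContractible E D y} => SameStrand E D y.1 z.1)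

/-- The number of noncontractible loops that arise when `D` is placed inside `E`. -/
noncomputable def newLoops : ℕ :=
  Nat.card (Quot fun y z : {y // OnNoncontractible E D y} => SameStrand E D y.1 z.1)

theorem conn_iterate {y : MarkedPt m} {j : ℤ}
    (h : Conn E D (midPt k m n y) (midPt k m n (j +ᵥ y))) (i : ℤ) :
    Conn E D (midPt k m n y) (midPt k m n ((i * j) +ᵥ y)) := by
  have hnat : ∀ i : ℕ, Conn E D (midPt k m n y) (midPt k m n (((i : ℤ) * j) +ᵥ y)) := by
    intro i
    induction i with
    | zero =>
      rw [Nat.cast_zero, zero_mul, zero_vadd]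
      exact Linked.refl _
    | succ i ih =>
      refine ih.trans ?_
      have := h.vadd ((i : ℤ) * j)
      rw [vadd_midPt, vadd_midPt, vadd_vadd] at this
      have e : (i : ℤ) * j + j = ((i + 1 : ℕ) : ℤ) * j := by
        push_cast
        ring
      rwa [e] at this
  obtain ⟨i, rfl | rfl⟩ := i.eq_nat_or_neg
  · exact hnat i
  · have := ((hnat i).vadd (-(i : ℤ) * j)).symm
    rw [vadd_midPt, vadd_midPt, vadd_vadd] at this
    rwa [show -(i : ℤ) * j + i * j = 0 by ring, zero_vadd] at this

/-- The lifted strands that end on the boundary are finite, hence not shift invariant. -/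
theorem OnNoncontractible.closed {y : MarkedPt m} (h : OnNoncontractible E D y)
    (b : MarkedPt k ⊕ MarkedPt n) : ¬ Conn E D (midPt k m n y) (bdPt k m n b) := by
  intro hb
  obtain ⟨j, hj, h⟩ := h
  have hf := (conn_main E D b).2
  have hinj : Function.Injective fun i : ℤ => midPt k m n ((i * j) +ᵥ y) := by
    intro a c hac
    have h1 : (a * j) +ᵥ y = (c * j) +ᵥ y := Sum.inl_injective (Sum.inr_injective hac)
    have h2 := freeShift_markedPt m (-(c * j) + a * j) y (by rw [add_vadd, h1, neg_vadd_vadd])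
    exact mul_right_cancel₀ hj (by linarith)
  exact Set.infinite_range_of_injective hinj (hf.subset (by
    rintro _ ⟨i, rfl⟩
    exact hb.symm.trans (conn_iterate E D h i)))

theorem exists_newLoop (h : newLoops E D ≠ 0) : ∃ y, OnNoncontractible E D y := by
  by_contra hne
  push Not at hne
  apply h
  have : IsEmpty {y // OnNoncontractible E D y} := ⟨fun y => hne y.1 y.2⟩
  have : IsEmpty (Quot fun y z : {y // OnNoncontractible E D y} => SameStrand E D y.1 z.1) :=
    ⟨fun q => q.inductionOn fun y => this.elim y⟩
  exact Nat.card_of_isEmpty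

theorem newLoops_disjoint (h : newLoops E D ≠ 0) (x : MarkedPt k) :
    ∃ y, compMate E D (Sum.inl x) = Sum.inl y := by
  classical
  obtain ⟨y, hy⟩ := exists_newLoop E D h
  have hcl := hy.closed
  obtain ⟨j, hj, hy⟩ := hy
  rcases hc : compMate E D (Sum.inl x) with c | c
  · exact ⟨c, rfl⟩
  exfalso
  obtain ⟨A, B, C, hA, hB, hC⟩ := exists_component E D (Sum.inl x)
  obtain ⟨-, -, a3⟩ := component_parity E D hA hB
  have hAx : A = {x} := by
    ext z
    have h1 : z ∈ A ↔ Conn E D (bdPt k m n (Sum.inl x)) (bdPt k m n (Sum.inl z)) := hA z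
    rw [h1, conn_bdPt_iff, hc]
    simp
  have hB1 : ∑ _x ∈ B, (1 : ZMod 2) = 1 := by
    rw [hAx, Finset.sum_singleton] at a3
    exact (CharTwo.add_eq_zero.1 a3).symm
  have hm : (0 : ℤ) < m := by
    have := y.ne
    omega
  have hside : ∀ i : ℤ, side A B C (midPt k m n y) = side A B C (midPt k m n ((i * j) +ᵥ y)) :=
    fun i => side_eq E D hA hB hC (conn_iterate E D hy i) fun h => hcl (Sum.inl x) h.symm
  obtain ⟨M, hM⟩ : ∃ M : ℤ, ∀ z ∈ B, |z.pos| < M := by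
    obtain ⟨M, hM⟩ := (B.finite_toSet.image fun z => |z.pos|).bddAbove
    exact ⟨M + 1, fun z hz => Int.lt_add_one_of_le (hM ⟨z, hz, rfl⟩)⟩
  have hjj : 1 ≤ j * j := by nlinarith [mul_self_pos.2 hj]
  set T : ℤ := |M| + |y.pos| with hT
  have hT0 : 0 ≤ T := by positivity
  have hpos : ∀ i : ℤ, ((i * j) +ᵥ y).pos = y.pos + m * (i * j) := fun i => rfl
  have hbig : T ≤ m * (T * j * j) := by nlinarith [mul_nonneg hT0 (by linarith : 0 ≤ j * j - 1), mul_nonneg (mul_nonneg hT0 (by linarith : 0 ≤ j * j)) (by linarith : (0 : ℤ) ≤ m - 1)]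
  have hright : side A B C (midPt k m n (((T * j) * j) +ᵥ y)) = 1 := by
    change ∑ z ∈ B, ind _ = _
    rw [← hB1]
    refine Finset.sum_congr rfl fun z hz => ind_pos ?_
    rw [hpos]
    have := hM z hz
    have h1 := le_abs_self z.pos
    have h2 := neg_abs_le y.pos
    have h3 := le_abs_self M
    linarith
  have hleft : side A B C (midPt k m n (((-(T * j)) * j) +ᵥ y)) = 0 := by
    change ∑ z ∈ B, ind _ = _
    refine Finset.sum_eq_zero fun z hz => ind_neg ?_
    rw [hpos]
    have := hM z hz
    have h1 := neg_abs_le z.pos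
    have h2 := le_abs_self y.pos
    have h3 := le_abs_self M
    have h4 : (m : ℤ) * (-(T * j) * j) = -(m * (T * j * j)) := by ring
    rw [h4]
    linarith
  rw [← hside] at hright hleft
  exact absurd (hright.symm.trans hleft) (by decide)

theorem closed_of_inner (hD : ∀ x : MarkedPt k, ∃ y : MarkedPt k, D.mate (Sum.inl x) = Sum.inl y)
    (x : MarkedPt k) : ∃ y, compMate E D (Sum.inl x) = Sum.inl y := by
  have h := compMate_conn E D (Sum.inl x)
  have h2 : ∃ y : MarkedPt k, bdPt k m n (compMate E D (Sum.inl x)) = Sum.inl y := by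
    refine Linked.induct (innerStep_involutive D) (outerStep_involutive E)
      (P := fun w => ∃ y : MarkedPt k, w = Sum.inl y) ?_ ?_ h ⟨x, rfl⟩
    · rintro _ ⟨y, rfl⟩
      obtain ⟨z, hz⟩ := hD y
      exact ⟨z, by simp [innerStep, hz]⟩
    · rintro _ ⟨y, rfl⟩
      exact ⟨y, rfl⟩
  obtain ⟨y, hy⟩ := h2
  exact ⟨y, bdPt_injective hy⟩

theorem closed_of_outer (hE : ∀ x : MarkedPt m, ∃ y : MarkedPt m, E.mate (Sum.inl x) = Sum.inl y)
    (x : MarkedPt k) : ∃ y, compMate E D (Sum.inl x) = Sum.inl y := by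
  have h := compMate_conn E D (Sum.inl x)
  have h2 : ∀ z, bdPt k m n (compMate E D (Sum.inl x)) ≠ Sum.inr (Sum.inr z) := by
    refine Linked.induct (innerStep_involutive D) (outerStep_involutive E)
      (P := fun w => ∀ z, w ≠ Sum.inr (Sum.inr z)) ?_ ?_ h (fun z h => by cases h)
    · intro w hw z hz
      apply hw z
      rw [← innerStep_involutive D w, hz]
      rfl
    · rintro (w | w | w) hw z
      · exact fun h => by cases h
      · obtain ⟨y, hy⟩ := hE w
        rw [outerStep_inr, hy]
        exact fun h => by cases h
      · exact (hw w rfl).elim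
  rcases hc : compMate E D (Sum.inl x) with c | c
  · exact ⟨c, rfl⟩
  · exact (h2 c (by rw [hc]; rfl)).elim

/-- The affine diagram obtained by placing `D` inside `E` and removing the contractible loops. -/
noncomputable def AffineDiagram.comp : AffineDiagram k n where
  mate := compMate E D
  mate_mate := compMate_compMate E D
  mate_ne := compMate_ne E D
  mate_vadd := compMate_vadd E D
  noncrossing := compMate_noncrossing E D
  loops := D.loops + E.loops + newLoops E D
  loops_disjoint h x := by
    by_cases h1 : D.loops = 0
    · by_cases h2 : E.loops = 0
      · exact newLoops_disjoint E D (by omega) x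
      · exact closed_of_outer E D (E.loops_disjoint h2) x
    · exact closed_of_inner E D (D.loops_disjoint h1) x

end Glue

/-! ### Composition is associative and unital -/

/-- Counting classes that are split into those of `Y` and those of `Z`. -/
theorem card_quot_add {V Y Z : Type} {r : V → V → Prop} {p : V → Prop}
    {r1 : Y → Y → Prop} {p1 : Y → Prop} {r2 : Z → Z → Prop} {p2 : Z → Prop}
    {f : Y → V} {g : Z → V} (hr : Equivalence r)
    (hfin : Finite (Quot fun v w : {v // p v} => r v.1 w.1))
    (hinv : ∀ v w, r v w → p v → p w)
    (hcov : ∀ v, p v → (∃ y, v = f y) ∨ ∃ z, v = g z)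
    (h1 : ∀ z, p (g z) ↔ p2 z) (h2 : ∀ z z', r (g z) (g z') ↔ r2 z z')
    (h3 : ∀ y, p1 y → p (f y)) (h4 : ∀ y y', p1 y → (r (f y) (f y') ↔ r1 y y'))
    (h5 : ∀ y z, p1 y → ¬ r (f y) (g z))
    (h6 : ∀ y, p (f y) → p1 y ∨ ∃ z, r (f y) (g z)) :
    Nat.card (Quot fun v w : {v // p v} => r v.1 w.1) =
      Nat.card (Quot fun v w : {v // p2 v} => r2 v.1 w.1) +
      Nat.card (Quot fun v w : {v // p1 v} => r1 v.1 w.1) := by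
  have ex : ∀ v w : {v // p v}, (Quot.mk (fun v w : {v // p v} => r v.1 w.1) v = Quot.mk _ w) →
      r v.1 w.1 := by
    intro v w h
    have h' := Quot.eqvGen_exact h
    have he : Equivalence (fun v w : {v // p v} => r v.1 w.1) :=
      ⟨fun v => hr.refl _, fun h => hr.symm h, fun h h' => hr.trans h h'⟩
    exact (Equivalence.eqvGen_iff he).1 h'
  let F2 : (Quot fun v w : {v // p2 v} => r2 v.1 w.1) → Quot fun v w : {v // p v} => r v.1 w.1 :=
    Quot.map (fun z => ⟨g z.1, (h1 z.1).2 z.2⟩) fun z z' h => (h2 z.1 z'.1).2 h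
  let F1 : (Quot fun v w : {v // p1 v} => r1 v.1 w.1) → Quot fun v w : {v // p v} => r v.1 w.1 :=
    Quot.map (fun y => ⟨f y.1, h3 y.1 y.2⟩) fun y y' h => (h4 y.1 y'.1 y.2).2 h
  have hbij : Function.Bijective (Sum.elim F2 F1) := by
    constructor
    · rintro (a | a) (b | b)
      · induction a using Quot.ind
        induction b using Quot.ind
        intro h
        exact congrArg Sum.inl (Quot.sound ((h2 _ _).1 (ex _ _ h)))
      · induction a using Quot.ind
        induction b using Quot.ind with | mk b =>
        intro h
        exact (h5 _ _ b.2 (hr.symm (ex _ _ h))).elim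
      · induction a using Quot.ind with | mk a =>
        induction b using Quot.ind
        intro h
        exact (h5 _ _ a.2 (ex _ _ h)).elim
      · induction a using Quot.ind with | mk a =>
        induction b using Quot.ind
        intro h
        exact congrArg Sum.inr (Quot.sound ((h4 _ _ a.2).1 (ex _ _ h)))
    · intro q
      induction q using Quot.ind with | mk v =>
      obtain ⟨v, hv⟩ := v
      rcases hcov v hv with ⟨y, rfl⟩ | ⟨z, rfl⟩
      · rcases h6 y hv with h | ⟨z, h⟩
        · exact ⟨Sum.inr (Quot.mk _ ⟨y, h⟩), rfl⟩
        · exact ⟨Sum.inl (Quot.mk _ ⟨z, (h1 z).1 (hinv _ _ h hv)⟩), Quot.sound (hr.symm h)⟩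
      · exact ⟨Sum.inl (Quot.mk _ ⟨z, (h1 z).1 hv⟩), rfl⟩
  have e := Equiv.ofBijective _ hbij
  have hs := Finite.of_equiv _ e.symm
  have i1 : Finite (Quot fun v w : {v // p2 v} => r2 v.1 w.1) :=
    Finite.of_injective (Sum.inl : _ → _ ⊕ (Quot fun v w : {v // p1 v} => r1 v.1 w.1))
      Sum.inl_injective
  have i2 : Finite (Quot fun v w : {v // p1 v} => r1 v.1 w.1) :=
    Finite.of_injective (Sum.inr : _ → (Quot fun v w : {v // p2 v} => r2 v.1 w.1) ⊕ _)
      Sum.inr_injective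
  rw [← Nat.card_congr e, Nat.card_sum]

/-- Two points are linked by a walk along three families of strands. -/
def Linked3 {V : Type} (s1 s2 s3 : V → V) : V → V → Prop :=
  Relation.EqvGen fun x y => y = s1 x ∨ y = s2 x ∨ y = s3 x

section Linked3

variable {V : Type} {s1 s2 s3 : V → V}

theorem Linked3.equivalence : Equivalence (Linked3 s1 s2 s3) := Relation.EqvGen.is_equivalence _

theorem Linked3.rotate {x y : V} (h : Linked3 s1 s2 s3 x y) : Linked3 s2 s3 s1 x y :=
  Relation.EqvGen.mono (fun _ _ h => by tauto) _ _ h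

theorem Linked3.induct (h1 : Function.Involutive s1) (h2 : Function.Involutive s2)
    (h3 : Function.Involutive s3) {P : V → Prop} (k1 : ∀ x, P x → P (s1 x))
    (k2 : ∀ x, P x → P (s2 x)) (k3 : ∀ x, P x → P (s3 x)) {x y : V}
    (h : Linked3 s1 s2 s3 x y) (hx : P x) : P y := by
  suffices h : P x ↔ P y from h.1 hx
  clear hx
  induction h with
  | rel x y h =>
    rcases h with rfl | rfl | rfl
    · exact ⟨k1 x, fun h => h1 x ▸ k1 _ h⟩
    · exact ⟨k2 x, fun h => h2 x ▸ k2 _ h⟩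
    · exact ⟨k3 x, fun h => h3 x ▸ k3 _ h⟩
  | refl x => exact Iff.rfl
  | symm x y _ ih => exact ih.symm
  | trans x y z _ _ ih1 ih2 => exact ih1.trans ih2

theorem Linked3.vadd [AddAction ℤ V] (e1 : ∀ (j : ℤ) x, s1 (j +ᵥ x) = j +ᵥ s1 x)
    (e2 : ∀ (j : ℤ) x, s2 (j +ᵥ x) = j +ᵥ s2 x) (e3 : ∀ (j : ℤ) x, s3 (j +ᵥ x) = j +ᵥ s3 x)
    (j : ℤ) {x y : V} (h : Linked3 s1 s2 s3 x y) : Linked3 s1 s2 s3 (j +ᵥ x) (j +ᵥ y) := by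
  induction h with
  | rel x y h =>
    refine Relation.EqvGen.rel _ _ ?_
    rcases h with rfl | rfl | rfl
    · exact Or.inl (e1 _ _).symm
    · exact Or.inr (Or.inl (e2 _ _).symm)
    · exact Or.inr (Or.inr (e3 _ _).symm)
  | refl x => exact Relation.EqvGen.refl _
  | symm x y _ ih => exact Linked3.equivalence.symm ih
  | trans x y z _ _ ih1 ih2 => exact Linked3.equivalence.trans ih1 ih2

end Linked3

/-- Two diagrams `E0`, `D0` that are glued first, as a part of a graph on `V` that is glued from
three diagrams; `G` is the graph that is left when `E0`, `D0` are replaced by their composite. -/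
structure Nested {x0 y z0 : ℕ} (E0 : AffineDiagram y z0) (D0 : AffineDiagram x0 y) {V G : Type}
    (s1 s2 s3 : V → V) (ρ σ : G → G) (i0 : GluePt x0 y z0 → V) (i : G → V)
    (κ : MarkedPt x0 ⊕ MarkedPt z0 → G) : Prop where
  inv1 : Function.Involutive s1
  inv2 : Function.Involutive s2
  inv3 : Function.Involutive s3
  a1 : ∀ q, s1 (i0 q) = i0 (innerStep z0 D0 q)
  a2 : ∀ q, s2 (i0 q) = i0 (outerStep x0 E0 q)
  a3 : ∀ w, s3 (i w) = i (σ w)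
  a4 : ∀ w, (∃ s, w = κ s) ∨ (s1 (i w) = i w ∧ s2 (i w) = i w ∧ ρ w = w)
  a5 : ∀ u, s3 (i0 (midPt x0 y z0 u)) = i0 (midPt x0 y z0 u)
  a6 : ∀ s, ρ (κ s) = κ (compMate E0 D0 s)
  a7 : ∀ s, i (κ s) = i0 (bdPt x0 y z0 s)
  a8 : ∀ v, (∃ u, v = i0 (midPt x0 y z0 u)) ∨ ∃ w, v = i w
  a9 : ∀ q w, i0 q = i w → ∃ s, q = bdPt x0 y z0 s ∧ w = κ s
  inj0 : Function.Injective i0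
  inj : Function.Injective i

theorem gluePt_cases {k m n : ℕ} (q : GluePt k m n) :
    (∃ b, q = bdPt k m n b) ∨ ∃ y, q = midPt k m n y := by
  rcases q with x | y | z
  · exact Or.inl ⟨Sum.inl x, rfl⟩
  · exact Or.inr ⟨y, rfl⟩
  · exact Or.inl ⟨Sum.inr z, rfl⟩

section Nested

variable {x0 y z0 : ℕ} {E0 : AffineDiagram y z0} {D0 : AffineDiagram x0 y} {V G : Type}
  {s1 s2 s3 : V → V} {ρ σ : G → G} {i0 : GluePt x0 y z0 → V} {i : G → V}
  {κ : MarkedPt x0 ⊕ MarkedPt z0 → G}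

theorem Nested.of_conn (N : Nested E0 D0 s1 s2 s3 ρ σ i0 i κ) {p q : GluePt x0 y z0}
    (h : Conn E0 D0 p q) : Linked3 s1 s2 s3 (i0 p) (i0 q) := by
  induction h with
  | rel x y h =>
    refine Relation.EqvGen.rel _ _ ?_
    rcases h with rfl | rfl
    · exact Or.inl (N.a1 _).symm
    · exact Or.inr (Or.inl (N.a2 _).symm)
  | refl x => exact Relation.EqvGen.refl _
  | symm x y _ ih => exact Linked3.equivalence.symm ih
  | trans x y z _ _ ih1 ih2 => exact Linked3.equivalence.trans ih1 ih2

theorem Nested.of_linked (N : Nested E0 D0 s1 s2 s3 ρ σ i0 i κ) {u w : G}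
    (h : Linked ρ σ u w) : Linked3 s1 s2 s3 (i u) (i w) := by
  induction h with
  | rel x y h =>
    rcases h with rfl | rfl
    · rcases N.a4 x with ⟨s, rfl⟩ | ⟨-, -, h⟩
      · rw [N.a6, N.a7, N.a7]
        exact N.of_conn (compMate_conn E0 D0 s)
      · rw [h]
        exact Relation.EqvGen.refl _
    · exact Relation.EqvGen.rel _ _ (Or.inr (Or.inr (N.a3 _).symm))
  | refl x => exact Relation.EqvGen.refl _
  | symm x y _ ih => exact Linked3.equivalence.symm ih
  | trans x y z _ _ ih1 ih2 => exact Linked3.equivalence.trans ih1 ih2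

theorem Nested.linked_iff (N : Nested E0 D0 s1 s2 s3 ρ σ i0 i κ) {u w : G} :
    Linked3 s1 s2 s3 (i u) (i w) ↔ Linked ρ σ u w := by
  refine ⟨fun h => ?_, N.of_linked⟩
  let Q : GluePt x0 y z0 → Prop := fun q =>
    ∃ s, Conn E0 D0 (bdPt x0 y z0 s) q ∧ Linked ρ σ u (κ s)
  have Q1 : ∀ s, Q (bdPt x0 y z0 s) → Linked ρ σ u (κ s) := by
    rintro s ⟨s', h1, h2⟩
    rcases (conn_bdPt_iff E0 D0).1 h1 with rfl | rfl
    · exact h2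
    · exact h2.trans (by rw [← N.a6]; exact Linked.left _)
  let P : V → Prop := fun v => (∃ q, v = i0 q ∧ Q q) ∨ ∃ w, v = i w ∧ Linked ρ σ u w
  have P0 : ∀ w, P (i w) → Linked ρ σ u w := by
    rintro w (⟨q, h1, h2⟩ | ⟨w', h1, h2⟩)
    · obtain ⟨s, rfl, rfl⟩ := N.a9 q w h1.symm
      exact Q1 s h2
    · rw [N.inj h1]
      exact h2
  refine P0 w (Linked3.induct N.inv1 N.inv2 N.inv3 (P := P) ?_ ?_ ?_ h
    (Or.inr ⟨u, rfl, Linked.refl u⟩))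
  · rintro _ (⟨q, rfl, s, h1, h2⟩ | ⟨w, rfl, h2⟩)
    · exact Or.inl ⟨_, N.a1 q, s, h1.trans (Linked.left _), h2⟩
    · rcases N.a4 w with ⟨s, rfl⟩ | ⟨h, -, -⟩
      · exact Or.inl ⟨_, by rw [N.a7, N.a1], s, Linked.left _, h2⟩
      · exact Or.inr ⟨w, h, h2⟩
  · rintro _ (⟨q, rfl, s, h1, h2⟩ | ⟨w, rfl, h2⟩)
    · exact Or.inl ⟨_, N.a2 q, s, h1.trans (Linked.right _), h2⟩
    · rcases N.a4 w with ⟨s, rfl⟩ | ⟨-, h, -⟩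
      · exact Or.inl ⟨_, by rw [N.a7, N.a2], s, Linked.right _, h2⟩
      · exact Or.inr ⟨w, h, h2⟩
  · rintro _ (⟨q, rfl, hq⟩ | ⟨w, rfl, h2⟩)
    · rcases gluePt_cases q with ⟨s, rfl⟩ | ⟨t, rfl⟩
      · exact Or.inr ⟨σ (κ s), by rw [← N.a7, N.a3], (Q1 s hq).trans (Linked.right _)⟩
      · exact Or.inl ⟨_, N.a5 t, hq⟩
    · exact Or.inr ⟨_, N.a3 w, h2.trans (Linked.right _)⟩

/-- A component that stays inside is not enlarged. -/
theorem Nested.closed (N : Nested E0 D0 s1 s2 s3 ρ σ i0 i κ) {t : MarkedPt y}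
    (ht : ∀ b, ¬ Conn E0 D0 (midPt x0 y z0 t) (bdPt x0 y z0 b)) {v : V}
    (h : Linked3 s1 s2 s3 (i0 (midPt x0 y z0 t)) v) :
    ∃ t', v = i0 (midPt x0 y z0 t') ∧ Conn E0 D0 (midPt x0 y z0 t) (midPt x0 y z0 t') := by
  have key : ∀ q, Conn E0 D0 (midPt x0 y z0 t) q → ∃ t', q = midPt x0 y z0 t' := by
    intro q hq
    rcases gluePt_cases q with ⟨s, rfl⟩ | ⟨t', rfl⟩
    · exact (ht s hq).elim
    · exact ⟨t', rfl⟩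
  refine Linked3.induct N.inv1 N.inv2 N.inv3 (P := fun v => ∃ t', v = i0 (midPt x0 y z0 t') ∧
    Conn E0 D0 (midPt x0 y z0 t) (midPt x0 y z0 t')) ?_ ?_ ?_ h ⟨t, rfl, Linked.refl _⟩
  · rintro _ ⟨t', rfl, h'⟩
    have h2 := h'.trans (Linked.left _)
    obtain ⟨t'', h3⟩ := key _ h2
    exact ⟨t'', by rw [N.a1, h3], by rw [← h3]; exact h2⟩
  · rintro _ ⟨t', rfl, h'⟩
    have h2 := h'.trans (Linked.right _)
    obtain ⟨t'', h3⟩ := key _ h2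
    exact ⟨t'', by rw [N.a2, h3], by rw [← h3]; exact h2⟩
  · rintro _ ⟨t', rfl, h'⟩
    exact ⟨t', N.a5 t', h'⟩

end Nested

section Count

variable {V : Type} [AddAction ℤ V] (C : V → V → Prop) {B : Type} (β : B → V)

/-- The analogue of `OnContractible` for a graph on `V`. -/
def POnContractible (v : V) : Prop := (∀ b, ¬ C v (β b)) ∧ ∀ j : ℤ, j ≠ 0 → ¬ C v (j +ᵥ v)

/-- The analogue of `OnNoncontractible` for a graph on `V`. -/
def POnNoncontractible (v : V) : Prop := ∃ j : ℤ, j ≠ 0 ∧ C v (j +ᵥ v)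

variable {C} {β}

theorem shiftRel_equivalence (hC : Equivalence C) (eC : ∀ (j : ℤ) x y, C x y → C (j +ᵥ x) (j +ᵥ y)) :
    Equivalence fun v w => ∃ j : ℤ, C v (j +ᵥ w) := by
  refine ⟨fun v => ⟨0, by rw [zero_vadd]; exact hC.refl v⟩, ?_, ?_⟩
  · rintro v w ⟨j, h⟩
    have := hC.symm (eC (-j) _ _ h)
    rw [neg_vadd_vadd] at this
    exact ⟨-j, this⟩
  · rintro u v w ⟨j, h⟩ ⟨l, h'⟩
    exact ⟨j + l, by rw [add_vadd]; exact hC.trans h (eC j _ _ h')⟩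

theorem finite_quot (hC : Equivalence C) (hV : FinOrbits V) (p : V → Prop) :
    Finite (Quot fun v w : {v // p v} => ∃ j : ℤ, C v.1 (j +ᵥ w.1)) := by
  obtain ⟨N, l, hl⟩ := hV
  refine Finite.of_injective
    (fun q : Quot fun v w : {v // p v} => ∃ j : ℤ, C v.1 (j +ᵥ w.1) => l q.out.1) ?_
  intro q q' h
  obtain ⟨j, hj⟩ := hl _ _ h
  rw [← Quot.out_eq q, ← Quot.out_eq q']
  refine Quot.sound ⟨-j, ?_⟩
  rw [hj, neg_vadd_vadd]
  exact hC.refl _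

variable {x0 y z0 m1 z n1 : ℕ} {E0 : AffineDiagram y z0} {D0 : AffineDiagram x0 y}
  {E1 : AffineDiagram z n1} {D1 : AffineDiagram m1 z}
  {s1 s2 s3 : V → V} {ρ σ : GluePt m1 z n1 → GluePt m1 z n1} {i0 : GluePt x0 y z0 → V}
  {i : GluePt m1 z n1 → V} {κ : MarkedPt x0 ⊕ MarkedPt z0 → GluePt m1 z n1}

theorem Nested.counts (N : Nested E0 D0 s1 s2 s3 ρ σ i0 i κ)
    (hV : FinOrbits V)
    (hco : ∀ u w, Linked ρ σ u w ↔ Conn E1 D1 u w)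
    (ei0 : ∀ (j : ℤ) q, i0 (j +ᵥ q) = j +ᵥ i0 q) (ei : ∀ (j : ℤ) q, i (j +ᵥ q) = j +ᵥ i q)
    (hC : ∀ v w, C v w ↔ Linked3 s1 s2 s3 v w)
    (eC : ∀ (j : ℤ) x y, C x y → C (j +ᵥ x) (j +ᵥ y))
    {β : MarkedPt m1 ⊕ MarkedPt n1 → V} (hβ : ∀ b, β b = i (bdPt m1 z n1 b)) :
    (Nat.card (Quot fun v w : {v // POnContractible C β v} => ∃ j : ℤ, C v.1 (j +ᵥ w.1)) =
      contractibleLoops E1 D1 + contractibleLoops E0 D0) ∧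
    (Nat.card (Quot fun v w : {v // POnNoncontractible C v} => ∃ j : ℤ, C v.1 (j +ᵥ w.1)) =
      newLoops E1 D1 + newLoops E0 D0) := by
  have hCe : Equivalence C := by
    have : C = Linked3 s1 s2 s3 := funext fun v => funext fun w => propext (hC v w)
    rw [this]
    exact Linked3.equivalence
  have eβ : ∀ (j : ℤ) b, β (j +ᵥ b) = j +ᵥ β b := by
    intro j b
    rw [hβ, hβ, ← vadd_bdPt, ei]
  have F1 : ∀ u w, C (i u) (i w) ↔ Conn E1 D1 u w := fun u w => by
    rw [hC, N.linked_iff, hco]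
  have F2 : ∀ {p q}, Conn E0 D0 p q → C (i0 p) (i0 q) := fun h => (hC _ _).2 (N.of_conn h)
  have F3 : ∀ {t : MarkedPt y}, (∀ b, ¬ Conn E0 D0 (midPt x0 y z0 t) (bdPt x0 y z0 b)) →
      ∀ {v}, C (i0 (midPt x0 y z0 t)) v → ∃ t', v = i0 (midPt x0 y z0 t') ∧
        Conn E0 D0 (midPt x0 y z0 t) (midPt x0 y z0 t') := fun ht _ h =>
    N.closed ht ((hC _ _).1 h)
  have F3' : ∀ {t : MarkedPt y}, (∀ b, ¬ Conn E0 D0 (midPt x0 y z0 t) (bdPt x0 y z0 b)) →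
      ∀ {t'}, C (i0 (midPt x0 y z0 t)) (i0 (midPt x0 y z0 t')) →
        Conn E0 D0 (midPt x0 y z0 t) (midPt x0 y z0 t') := by
    intro t ht t' h
    obtain ⟨t'', h1, h2⟩ := F3 ht h
    rw [N.inj0 h1]
    exact h2
  have F5 : ∀ {t : MarkedPt y}, (∀ b, ¬ Conn E0 D0 (midPt x0 y z0 t) (bdPt x0 y z0 b)) →
      ∀ w, ¬ C (i0 (midPt x0 y z0 t)) (i w) := by
    intro t ht w h
    obtain ⟨t', h1, -⟩ := F3 ht h
    obtain ⟨s, h2, -⟩ := N.a9 _ _ h1.symm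
    rcases s with s | s <;> cases h2
  have F6 : ∀ t : MarkedPt y, (∀ b, ¬ Conn E0 D0 (midPt x0 y z0 t) (bdPt x0 y z0 b)) ∨
      (∃ r, C (i0 (midPt x0 y z0 t)) (i (midPt m1 z n1 r))) ∨
      ∃ b, C (i0 (midPt x0 y z0 t)) (β b) := by
    intro t
    by_cases ht : ∀ b, ¬ Conn E0 D0 (midPt x0 y z0 t) (bdPt x0 y z0 b)
    · exact Or.inl ht
    · push Not at ht
      obtain ⟨b, hb⟩ := ht
      have h1 := F2 hb
      rw [← N.a7] at h1
      rcases gluePt_cases (κ b) with ⟨s, hs⟩ | ⟨r, hr⟩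
      · exact Or.inr (Or.inr ⟨s, by rw [hβ, ← hs]; exact h1⟩)
      · exact Or.inr (Or.inl ⟨r, by rw [← hr]; exact h1⟩)
  have F7 : ∀ b, ¬ POnNoncontractible C (β b) := by
    rintro b ⟨j, hj, h⟩
    rw [← eβ, hβ, hβ, F1, conn_bdPt_iff] at h
    rcases h with h | h
    · exact hj (freeShift_sum (freeShift_markedPt _) (freeShift_markedPt _) _ _ h)
    · exact hj (shift_eq_zero (freeShift_sum (freeShift_markedPt _) (freeShift_markedPt _))
        (compMate_compMate E1 D1) (compMate_vadd E1 D1) h.symm)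
  have invN : ∀ v w, (∃ j : ℤ, C v (j +ᵥ w)) → POnNoncontractible C v →
      POnNoncontractible C w := by
    rintro v w ⟨j, h⟩ ⟨l, hl, h'⟩
    refine ⟨l, hl, ?_⟩
    have h2 := eC (-j) _ _ (hCe.trans (hCe.trans (hCe.symm h) h') (eC l _ _ h))
    rw [neg_vadd_vadd, vadd_vadd, vadd_vadd] at h2
    rwa [show -j + l + j = l by ring] at h2
  have invC : ∀ v w, (∃ j : ℤ, C v (j +ᵥ w)) → POnContractible C β v →
      POnContractible C β w := by
    rintro v w ⟨j, h⟩ ⟨h1, h2⟩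
    refine ⟨fun b hb => h1 (j +ᵥ b) ?_, fun l hl hw => ?_⟩
    · rw [eβ]
      exact hCe.trans h (eC j _ _ hb)
    · obtain ⟨l', hl', h3⟩ : POnNoncontractible C v := by
        refine invN w v ⟨-j, ?_⟩ ⟨l, hl, hw⟩
        have := hCe.symm (eC (-j) _ _ h)
        rwa [neg_vadd_vadd] at this
      exact h2 l' hl' h3
  have cov : ∀ v, (∃ t, v = i0 (midPt x0 y z0 t)) ∨ (∃ r, v = i (midPt m1 z n1 r)) ∨
      ∃ b, v = β b := by
    intro v
    rcases N.a8 v with ⟨t, rfl⟩ | ⟨w, rfl⟩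
    · exact Or.inl ⟨t, rfl⟩
    · rcases gluePt_cases w with ⟨s, rfl⟩ | ⟨r, rfl⟩
      · exact Or.inr (Or.inr ⟨s, (hβ s).symm⟩)
      · exact Or.inr (Or.inl ⟨r, rfl⟩)
  have h2 : ∀ r r', (∃ j : ℤ, C (i (midPt m1 z n1 r)) (j +ᵥ i (midPt m1 z n1 r'))) ↔
      SameStrand E1 D1 r r' := by
    intro r r'
    refine exists_congr fun j => ?_
    rw [← ei, F1, vadd_midPt]
  have h4 : ∀ t t', (∀ b, ¬ Conn E0 D0 (midPt x0 y z0 t) (bdPt x0 y z0 b)) →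
      ((∃ j : ℤ, C (i0 (midPt x0 y z0 t)) (j +ᵥ i0 (midPt x0 y z0 t'))) ↔
      SameStrand E0 D0 t t') := by
    intro t t' ht
    refine exists_congr fun j => ?_
    rw [← ei0, vadd_midPt]
    exact ⟨F3' ht, F2⟩
  have h5 : ∀ t r, (∀ b, ¬ Conn E0 D0 (midPt x0 y z0 t) (bdPt x0 y z0 b)) →
      ¬ ∃ j : ℤ, C (i0 (midPt x0 y z0 t)) (j +ᵥ i (midPt m1 z n1 r)) := by
    rintro t r ht ⟨j, h⟩
    rw [← ei] at h
    exact F5 ht _ h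
  have N3 : ∀ t, POnNoncontractible C (i0 (midPt x0 y z0 t)) →
      (∀ b, ¬ Conn E0 D0 (midPt x0 y z0 t) (bdPt x0 y z0 b)) → OnNoncontractible E0 D0 t := by
    rintro t ⟨j, hj, h⟩ ht
    rw [← ei0, vadd_midPt] at h
    exact ⟨j, hj, F3' ht h⟩
  have N3' : ∀ t, OnNoncontractible E0 D0 t → POnNoncontractible C (i0 (midPt x0 y z0 t)) := by
    rintro t ⟨j, hj, h⟩
    refine ⟨j, hj, ?_⟩
    rw [← ei0, vadd_midPt]
    exact F2 h
  constructor
  · refine card_quot_add (f := fun t => i0 (midPt x0 y z0 t)) (g := fun r => i (midPt m1 z n1 r))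
      (shiftRel_equivalence hCe eC) (finite_quot hCe hV _) invC ?_ ?_ h2 ?_ ?_ ?_ ?_
    · intro v hv
      rcases cov v with h | h | ⟨b, rfl⟩
      · exact Or.inl h
      · exact Or.inr h
      · exact (hv.1 b (hCe.refl _)).elim
    · intro r
      refine and_congr (forall_congr' fun b => ?_) (forall_congr' fun j => ?_)
      · rw [hβ, F1]
      · rw [← ei, F1, vadd_midPt]
    · intro t ht
      refine ⟨fun b h => ?_, fun j hj h => ?_⟩
      · rw [hβ] at h
        exact F5 ht.1 _ h
      · obtain ⟨j', hj', h'⟩ := N3 t ⟨j, hj, h⟩ ht.1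
        exact ht.2 j' hj' h'
    · exact fun t t' ht => h4 t t' ht.1
    · exact fun t r ht => h5 t r ht.1
    · intro t ht
      rcases F6 t with h | ⟨r, h⟩ | ⟨b, h⟩
      · refine Or.inl ⟨h, fun j hj h' => ?_⟩
        obtain ⟨l, hl, h3⟩ := N3' t ⟨j, hj, h'⟩
        exact ht.2 l hl h3
      · exact Or.inr ⟨r, 0, by rw [zero_vadd]; exact h⟩
      · exact (ht.1 b h).elim
  · refine card_quot_add (f := fun t => i0 (midPt x0 y z0 t)) (g := fun r => i (midPt m1 z n1 r))
      (shiftRel_equivalence hCe eC) (finite_quot hCe hV _) invN ?_ ?_ h2 ?_ ?_ ?_ ?_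
    · intro v hv
      rcases cov v with h | h | ⟨b, rfl⟩
      · exact Or.inl h
      · exact Or.inr h
      · exact (F7 b hv).elim
    · intro r
      refine exists_congr fun j => and_congr_right fun _ => ?_
      rw [← ei, F1, vadd_midPt]
    · exact N3'
    · exact fun t t' ht => h4 t t' ht.closed
    · exact fun t r ht => h5 t r ht.closed
    · intro t ht
      rcases F6 t with h | ⟨r, h⟩ | ⟨b, h⟩
      · exact Or.inl (N3 t ht h)
      · exact Or.inr ⟨r, 0, by rw [zero_vadd]; exact h⟩
      · exact (F7 b (invN _ _ ⟨0, by rw [zero_vadd]; exact h⟩ ht)).elim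

end Count

section Assoc

variable {a b c d : ℕ}

/-- The points of three glued strips. -/
abbrev Glue3Pt (a b c d : ℕ) : Type :=
  MarkedPt a ⊕ (MarkedPt b ⊕ (MarkedPt c ⊕ MarkedPt d))

/-- Follow the arc of the innermost of three diagrams. -/
def stepOne (c d : ℕ) (D : AffineDiagram a b) : Glue3Pt a b c d → Glue3Pt a b c d
  | Sum.inl x => Sum.map id Sum.inl (D.mate (Sum.inl x))
  | Sum.inr (Sum.inl y) => Sum.map id Sum.inl (D.mate (Sum.inr y))
  | Sum.inr (Sum.inr z) => Sum.inr (Sum.inr z)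

/-- Follow the arc of the middle one of three diagrams. -/
def stepTwo (a d : ℕ) (E : AffineDiagram b c) : Glue3Pt a b c d → Glue3Pt a b c d :=
  Sum.map id (innerStep d E)

/-- Follow the arc of the outermost of three diagrams. -/
def stepThree (a b : ℕ) (F : AffineDiagram c d) : Glue3Pt a b c d → Glue3Pt a b c d :=
  Sum.map id (outerStep b F)

variable (F : AffineDiagram c d) (E : AffineDiagram b c) (D : AffineDiagram a b)

theorem stepOne_map (u : MarkedPt a ⊕ MarkedPt b) :
    stepOne c d D (Sum.map id Sum.inl u) = Sum.map id Sum.inl (D.mate u) := by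
  rcases u with x | y <;> rfl

theorem stepOne_involutive : Function.Involutive (stepOne c d D) := by
  rintro (x | y | z)
  · change stepOne c d D (Sum.map id Sum.inl (D.mate (Sum.inl x))) = _
    rw [stepOne_map, D.mate_mate]; rfl
  · change stepOne c d D (Sum.map id Sum.inl (D.mate (Sum.inr y))) = _
    rw [stepOne_map, D.mate_mate]; rfl
  · rfl

theorem stepTwo_involutive : Function.Involutive (stepTwo a d E) := by
  rintro (x | u)
  · rfl
  · exact congrArg Sum.inr (innerStep_involutive E u)

theorem stepThree_involutive : Function.Involutive (stepThree a b F) := by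
  rintro (x | u)
  · rfl
  · exact congrArg Sum.inr (outerStep_involutive F u)

theorem stepOne_vadd (j : ℤ) (x : Glue3Pt a b c d) :
    stepOne c d D (j +ᵥ x) = j +ᵥ stepOne c d D x := by
  have key : ∀ u : MarkedPt a ⊕ MarkedPt b,
      (Sum.map id Sum.inl (j +ᵥ u) : Glue3Pt a b c d) = j +ᵥ Sum.map id Sum.inl u := by
    rintro (u | u) <;> rfl
  rcases x with x | y | z
  · change Sum.map id Sum.inl (D.mate (j +ᵥ Sum.inl x)) = j +ᵥ Sum.map id Sum.inl _
    rw [D.mate_vadd, key]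
  · change Sum.map id Sum.inl (D.mate (j +ᵥ Sum.inr y)) = j +ᵥ Sum.map id Sum.inl _
    rw [D.mate_vadd, key]
  · rfl

theorem stepTwo_vadd (j : ℤ) (x : Glue3Pt a b c d) :
    stepTwo a d E (j +ᵥ x) = j +ᵥ stepTwo a d E x := by
  rcases x with x | u
  · rfl
  · exact congrArg Sum.inr (innerStep_vadd E j u)

theorem stepThree_vadd (j : ℤ) (x : Glue3Pt a b c d) :
    stepThree a b F (j +ᵥ x) = j +ᵥ stepThree a b F x := by
  rcases x with x | u
  · rfl
  · exact congrArg Sum.inr (outerStep_vadd F j u)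

theorem nested_inner : Nested E D (stepOne c d D) (stepTwo a d E) (stepThree a b F)
    (innerStep d (E.comp D)) (outerStep a F)
    (Sum.map id (Sum.map id Sum.inl) : GluePt a b c → Glue3Pt a b c d)
    (Sum.map id Sum.inr : GluePt a c d → Glue3Pt a b c d) (Sum.map id Sum.inl) where
  inv1 := stepOne_involutive D
  inv2 := stepTwo_involutive E
  inv3 := stepThree_involutive F
  a1 := by
    have key : ∀ u : MarkedPt a ⊕ MarkedPt b, (Sum.map id Sum.inl u : Glue3Pt a b c d) =
        Sum.map id (Sum.map id Sum.inl) (Sum.map id Sum.inl u : GluePt a b c) := by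
      rintro (u | u) <;> rfl
    rintro (x | y | z)
    · exact key _
    · exact key _
    · rfl
  a2 := by
    rintro (x | u)
    · rfl
    · refine congrArg Sum.inr ?_
      rcases u with u | u <;> rfl
  a3 := by
    rintro (x | u) <;> rfl
  a4 := by
    rintro (x | x | x)
    · exact Or.inl ⟨Sum.inl x, rfl⟩
    · exact Or.inl ⟨Sum.inr x, rfl⟩
    · exact Or.inr ⟨rfl, rfl, rfl⟩
  a5 _ := rfl
  a6 := innerStep_map (E.comp D)
  a7 := by
    rintro (x | x) <;> rfl
  a8 := by
    rintro (x | x | x)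
    · exact Or.inr ⟨Sum.inl x, rfl⟩
    · exact Or.inl ⟨x, rfl⟩
    · exact Or.inr ⟨Sum.inr x, rfl⟩
  a9 := by
    rintro (x | x | x) (w | w | w) h
    · cases h; exact ⟨Sum.inl _, rfl, rfl⟩
    · cases h
    · cases h
    · cases h
    · cases h
    · cases h
    · cases h
    · cases h; exact ⟨Sum.inr _, rfl, rfl⟩
    · cases h
  inj0 := Sum.map_injective.2 ⟨Function.injective_id,
    Sum.map_injective.2 ⟨Function.injective_id, Sum.inl_injective⟩⟩
  inj := Sum.map_injective.2 ⟨Function.injective_id, Sum.inr_injective⟩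

theorem nested_outer : Nested F E (stepTwo a d E) (stepThree a b F) (stepOne c d D)
    (outerStep a (F.comp E)) (innerStep d D)
    (Sum.inr : GluePt b c d → Glue3Pt a b c d)
    (Sum.map id (Sum.map id Sum.inr) : GluePt a b d → Glue3Pt a b c d) Sum.inr where
  inv1 := stepTwo_involutive E
  inv2 := stepThree_involutive F
  inv3 := stepOne_involutive D
  a1 _ := rfl
  a2 _ := rfl
  a3 := by
    have key : ∀ u : MarkedPt a ⊕ MarkedPt b, (Sum.map id Sum.inl u : Glue3Pt a b c d) =
        Sum.map id (Sum.map id Sum.inr) (Sum.map id Sum.inl u : GluePt a b d) := by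
      rintro (u | u) <;> rfl
    rintro (x | y | z)
    · exact key _
    · exact key _
    · rfl
  a4 := by
    rintro (x | x)
    · exact Or.inr ⟨rfl, rfl, rfl⟩
    · exact Or.inl ⟨x, rfl⟩
  a5 _ := rfl
  a6 _ := rfl
  a7 _ := rfl
  a8 := by
    rintro (x | x | x | x)
    · exact Or.inr ⟨Sum.inl x, rfl⟩
    · exact Or.inr ⟨Sum.inr (Sum.inl x), rfl⟩
    · exact Or.inl ⟨x, rfl⟩
    · exact Or.inr ⟨Sum.inr (Sum.inr x), rfl⟩
  a9 := by
    rintro (x | x | x) (w | w | w) h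
    · cases h
    · cases h; exact ⟨Sum.inl _, rfl, rfl⟩
    · cases h
    · cases h
    · cases h
    · cases h
    · cases h
    · cases h
    · cases h; exact ⟨Sum.inr _, rfl, rfl⟩
  inj0 := Sum.inr_injective
  inj := Sum.map_injective.2 ⟨Function.injective_id,
    Sum.map_injective.2 ⟨Function.injective_id, Sum.inr_injective⟩⟩

theorem finOrbits_glue3 : FinOrbits (Glue3Pt a b c d) :=
  finOrbits_sum (finOrbits_markedPt a) (finOrbits_sum (finOrbits_markedPt b)
    (finOrbits_sum (finOrbits_markedPt c) (finOrbits_markedPt d)))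

theorem linked3_rotate_iff (v w : Glue3Pt a b c d) :
    Linked3 (stepOne c d D) (stepTwo a d E) (stepThree a b F) v w ↔
      Linked3 (stepTwo a d E) (stepThree a b F) (stepOne c d D) v w :=
  ⟨Linked3.rotate, fun h => h.rotate.rotate⟩

theorem loops_assoc :
    contractibleLoops F (E.comp D) + contractibleLoops E D =
      contractibleLoops (F.comp E) D + contractibleLoops F E ∧
    newLoops F (E.comp D) + newLoops E D = newLoops (F.comp E) D + newLoops F E := by
  have ev : ∀ (j : ℤ) x y, Linked3 (stepOne c d D) (stepTwo a d E) (stepThree a b F) x y →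
      Linked3 (stepOne c d D) (stepTwo a d E) (stepThree a b F) (j +ᵥ x) (j +ᵥ y) :=
    fun j _ _ h => h.vadd (stepOne_vadd D) (stepTwo_vadd E) (stepThree_vadd F) j
  obtain ⟨h1, h2⟩ := (nested_inner F E D).counts (E1 := F) (D1 := E.comp D)
    (C := Linked3 (stepOne c d D) (stepTwo a d E) (stepThree a b F))
    (β := Sum.map id (Sum.inr ∘ Sum.inr)) finOrbits_glue3 (fun _ _ => Iff.rfl)
    (by rintro j (q | q | q) <;> rfl) (by rintro j (q | q | q) <;> rfl) (fun _ _ => Iff.rfl) ev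
    (by rintro (q | q) <;> rfl)
  obtain ⟨h3, h4⟩ := (nested_outer F E D).counts (E1 := F.comp E) (D1 := D)
    (C := Linked3 (stepOne c d D) (stepTwo a d E) (stepThree a b F))
    (β := Sum.map id (Sum.inr ∘ Sum.inr)) finOrbits_glue3
    (fun _ _ => ⟨Linked.swap, Linked.swap⟩)
    (by rintro j (q | q | q) <;> rfl) (by rintro j (q | q | q) <;> rfl)
    (linked3_rotate_iff F E D) ev
    (by rintro (q | q) <;> rfl)
  exact ⟨h1.symm.trans h3, h2.symm.trans h4⟩

theorem AffineDiagram.comp_assoc : F.comp (E.comp D) = (F.comp E).comp D := by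
  refine AffineDiagram.ext' (fun x => ?_) ?_
  · refine compMate_unique (F.comp E) D (compMate_ne F (E.comp D) x) ?_
    have h := compMate_conn F (E.comp D) x
    have h1 := (linked3_rotate_iff F E D _ _).1 ((nested_inner F E D).of_linked h)
    have key : ∀ q : MarkedPt a ⊕ MarkedPt d,
        (Sum.map id Sum.inr (bdPt a c d q) : Glue3Pt a b c d) =
          Sum.map id (Sum.map id Sum.inr) (bdPt a b d q) := by
      rintro (q | q) <;> rfl
    rw [key, key] at h1
    exact Linked.swap ((nested_outer F E D).linked_iff.1 h1)
  · have := (loops_assoc F E D).2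
    change (D.loops + E.loops + newLoops E D) + F.loops + newLoops F (E.comp D) =
      D.loops + (E.loops + F.loops + newLoops F E) + newLoops (F.comp E) D
    omega

end Assoc

/-- The diagram with arcs from the inner point `x` to the outer point `x + r`. -/
def rotDiagram (n : ℕ) (r : ℤ) : AffineDiagram n n where
  mate
    | Sum.inl x => Sum.inr ⟨x.pos + r, x.ne⟩
    | Sum.inr x => Sum.inl ⟨x.pos - r, x.ne⟩
  mate_mate := by
    rintro (x | x)
    · exact congrArg Sum.inl (MarkedPt.ext (add_sub_cancel_right x.pos r))
    · exact congrArg Sum.inr (MarkedPt.ext (sub_add_cancel x.pos r))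
  mate_ne := by
    rintro (x | x) <;> simp
  mate_vadd := by
    rintro j (x | x)
    · refine congrArg Sum.inr (MarkedPt.ext ?_)
      change x.pos + n * j + r = x.pos + r + n * j
      ring
    · refine congrArg Sum.inl (MarkedPt.ext ?_)
      change x.pos + n * j - r = x.pos - r + n * j
      ring
  noncrossing := by
    rintro (x | x) (y | y) h1 h2 <;> simp only [Before] at h1 h2 ⊢
    · constructor <;> omega
    · constructor <;> omega
  loops := 0
  loops_disjoint h := (h rfl).elim

/-- The identity diagram: straight lines. -/
def idDiagram (n : ℕ) : AffineDiagram n n := rotDiagram n 0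

section Unit

variable {m n : ℕ} (D : AffineDiagram m n)

theorem loops_eq_zero_of_conn {k m n : ℕ} {E : AffineDiagram m n} {D : AffineDiagram k m}
    (h : ∀ y, ∃ b, Conn E D (midPt k m n y) (bdPt k m n b)) :
    contractibleLoops E D = 0 ∧ newLoops E D = 0 := by
  constructor
  · have : IsEmpty (Quot fun y z : {y // OnContractible E D y} => SameStrand E D y.1 z.1) := by
      refine ⟨fun q => q.inductionOn fun y => ?_⟩
      obtain ⟨b, hb⟩ := h y.1
      exact y.2.1 b hb
    exact Nat.card_of_isEmpty
  · have : IsEmpty (Quot fun y z : {y // OnNoncontractible E D y} => SameStrand E D y.1 z.1) := by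
      refine ⟨fun q => q.inductionOn fun y => ?_⟩
      obtain ⟨b, hb⟩ := h y.1
      exact OnNoncontractible.closed E D y.2 b hb
    exact Nat.card_of_isEmpty

theorem idDiagram_inl (x : MarkedPt n) : (idDiagram n).mate (Sum.inl x) = Sum.inr x :=
  congrArg Sum.inr (MarkedPt.ext (add_zero x.pos))

theorem idDiagram_inr (x : MarkedPt n) : (idDiagram n).mate (Sum.inr x) = Sum.inl x :=
  congrArg Sum.inl (MarkedPt.ext (sub_zero x.pos))

theorem conn_comp_id (u : MarkedPt m ⊕ MarkedPt n) :
    Conn D (idDiagram m) (bdPt m m n u) (Sum.inr u) := by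
  rcases u with x | x
  · have h : innerStep n (idDiagram m) (Sum.inl x) = Sum.inr (Sum.inl x) := by
      simp [innerStep, idDiagram_inl]
    exact h ▸ Linked.left _
  · exact Linked.refl _

theorem comp_id_loops : contractibleLoops D (idDiagram m) = 0 ∧ newLoops D (idDiagram m) = 0 :=
  loops_eq_zero_of_conn fun y => ⟨Sum.inl y, (conn_comp_id D (Sum.inl y)).symm⟩

theorem AffineDiagram.comp_id : D.comp (idDiagram m) = D := by
  refine AffineDiagram.ext' (fun u => ?_) ?_
  · refine (compMate_unique D (idDiagram m) (D.mate_ne u) ?_).symm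
    have h : Conn D (idDiagram m) (Sum.inr u) (Sum.inr (D.mate u)) := Linked.right _
    exact ((conn_comp_id D u).trans h).trans (conn_comp_id D _).symm
  · change 0 + D.loops + newLoops D (idDiagram m) = _
    rw [(comp_id_loops D).2]
    omega

theorem conn_id_comp (u : MarkedPt m ⊕ MarkedPt n) :
    Conn (idDiagram n) D (bdPt m n n u) (Sum.map id Sum.inl u) := by
  rcases u with x | x
  · exact Linked.refl _
  · have h : outerStep m (idDiagram n) (Sum.inr (Sum.inr x)) = Sum.inr (Sum.inl x) := by
      simp [outerStep, idDiagram_inr]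
    have h2 := Linked.right (σ := innerStep n D) (τ := outerStep m (idDiagram n))
      (Sum.inr (Sum.inr x))
    rw [h] at h2
    exact h2

theorem id_comp_loops : contractibleLoops (idDiagram n) D = 0 ∧ newLoops (idDiagram n) D = 0 :=
  loops_eq_zero_of_conn fun y => ⟨Sum.inr y, (conn_id_comp D (Sum.inr y)).symm⟩

theorem AffineDiagram.id_comp : (idDiagram n).comp D = D := by
  refine AffineDiagram.ext' (fun u => ?_) ?_
  · refine (compMate_unique (idDiagram n) D (D.mate_ne u) ?_).symm
    have h : Conn (idDiagram n) D (Sum.map id Sum.inl u) (Sum.map id Sum.inl (D.mate u)) := by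
      rw [← innerStep_map]
      exact Linked.left _
    exact ((conn_id_comp D u).trans h).trans (conn_id_comp D _).symm
  · change D.loops + 0 + newLoops (idDiagram n) D = _
    rw [(id_comp_loops D).2]
    omega

end Unit

/-! ### The affine Temperley–Lieb category -/

/-- The weight `- t^(1/2) - t^(-1/2)` of a contractible loop, where `s = t^(1/2)`. -/
noncomputable def loopWeight (s : ℂ) : ℂ := -s - s⁻¹

/-- The bilinear composition `f ∘ g` of linear combinations of affine diagrams: on diagrams,
`E ∘ D` is `D` placed inside `E`, each contractible loop being replaced by the loop weight. -/
noncomputable def linComp (s : ℂ) {k m n : ℕ} (f : AffineDiagram m n →₀ ℂ)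
    (g : AffineDiagram k m →₀ ℂ) : AffineDiagram k n →₀ ℂ :=
  f.sum fun E x => g.sum fun D y =>
    Finsupp.single (E.comp D) (x * y * loopWeight s ^ contractibleLoops E D)

section LinComp

variable (s : ℂ) {k l m n : ℕ}

theorem linComp_add_left (f f' : AffineDiagram m n →₀ ℂ) (g : AffineDiagram k m →₀ ℂ) :
    linComp s (f + f') g = linComp s f g + linComp s f' g := by
  classical
  refine Finsupp.sum_add_index' (fun E => ?_) (fun E x y => ?_)
  · simp
  · simp [Finsupp.sum, add_mul, Finset.sum_add_distrib]

theorem linComp_add_right (f : AffineDiagram m n →₀ ℂ) (g g' : AffineDiagram k m →₀ ℂ) :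
    linComp s f (g + g') = linComp s f g + linComp s f g' := by
  classical
  rw [linComp, linComp, linComp, ← Finsupp.sum_add]
  refine Finsupp.sum_congr fun E _ => ?_
  exact Finsupp.sum_add_index' (fun D => by simp) (fun D x y => by simp [mul_add, add_mul])

theorem linComp_smul_left (c : ℂ) (f : AffineDiagram m n →₀ ℂ) (g : AffineDiagram k m →₀ ℂ) :
    linComp s (c • f) g = c • linComp s f g := by
  rw [linComp, linComp, Finsupp.sum_smul_index' (fun E => by simp), Finsupp.smul_sum]
  refine Finsupp.sum_congr fun E _ => ?_
  rw [Finsupp.smul_sum]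
  refine Finsupp.sum_congr fun D _ => ?_
  rw [Finsupp.smul_single, smul_eq_mul, smul_eq_mul, mul_assoc, mul_assoc, mul_assoc]

theorem linComp_smul_right (c : ℂ) (f : AffineDiagram m n →₀ ℂ) (g : AffineDiagram k m →₀ ℂ) :
    linComp s f (c • g) = c • linComp s f g := by
  rw [linComp, linComp, Finsupp.smul_sum]
  refine Finsupp.sum_congr fun E _ => ?_
  rw [Finsupp.sum_smul_index' (fun D => by simp), Finsupp.smul_sum]
  refine Finsupp.sum_congr fun D _ => ?_
  rw [Finsupp.smul_single, smul_eq_mul, smul_eq_mul]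
  congr 1
  ring

theorem linComp_single (E : AffineDiagram m n) (D : AffineDiagram k m) (x y : ℂ) :
    linComp s (Finsupp.single E x) (Finsupp.single D y) =
      Finsupp.single (E.comp D) (x * y * loopWeight s ^ contractibleLoops E D) := by
  rw [linComp, Finsupp.sum_single_index (by simp), Finsupp.sum_single_index (by simp)]

theorem linComp_zero_left (g : AffineDiagram k m →₀ ℂ) :
    linComp s (0 : AffineDiagram m n →₀ ℂ) g = 0 := Finsupp.sum_zero_index

theorem linComp_zero_right (f : AffineDiagram m n →₀ ℂ) :
    linComp s f (0 : AffineDiagram k m →₀ ℂ) = 0 := by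
  simp [linComp]

theorem linComp_assoc (f : AffineDiagram m n →₀ ℂ) (g : AffineDiagram l m →₀ ℂ)
    (h : AffineDiagram k l →₀ ℂ) :
    linComp s f (linComp s g h) = linComp s (linComp s f g) h := by
  induction f using Finsupp.induction_linear with
  | zero => simp only [linComp_zero_left]
  | add f f' hf hf' => simp only [linComp_add_left, hf, hf']
  | single F x =>
    induction g using Finsupp.induction_linear with
    | zero => simp only [linComp_zero_left, linComp_zero_right]
    | add f f' hf hf' => simp only [linComp_add_left, linComp_add_right, hf, hf']
    | single E y =>
      induction h using Finsupp.induction_linear with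
      | zero => simp only [linComp_zero_right]
      | add f f' hf hf' => simp only [linComp_add_right, hf, hf']
      | single D z =>
        rw [linComp_single, linComp_single, linComp_single, linComp_single,
          AffineDiagram.comp_assoc]
        congr 1
        have h1 := (loops_assoc F E D).1
        calc x * (y * z * loopWeight s ^ contractibleLoops E D) *
              loopWeight s ^ contractibleLoops F (E.comp D)
            = x * y * z * loopWeight s ^ (contractibleLoops F (E.comp D) +
                contractibleLoops E D) := by rw [pow_add]; ring
          _ = _ := by rw [h1, pow_add]; ring

theorem linComp_id (f : AffineDiagram m n →₀ ℂ) :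
    linComp s f (Finsupp.single (idDiagram m) 1) = f := by
  induction f using Finsupp.induction_linear with
  | zero => rw [linComp_zero_left]
  | add f f' hf hf' => rw [linComp_add_left, hf, hf']
  | single F x =>
    rw [linComp_single, AffineDiagram.comp_id, (comp_id_loops F).1, pow_zero, mul_one, mul_one]

theorem id_linComp (f : AffineDiagram m n →₀ ℂ) :
    linComp s (Finsupp.single (idDiagram n) 1) f = f := by
  induction f using Finsupp.induction_linear with
  | zero => rw [linComp_zero_right]
  | add f f' hf hf' => rw [linComp_add_right, hf, hf']
  | single F x =>
    rw [linComp_single, AffineDiagram.id_comp, (id_comp_loops F).1, pow_zero, mul_one, one_mul]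

end LinComp

/-- The objects of the affine Temperley–Lieb category with parameter `s = t^(1/2)`: the natural
numbers. -/
structure AffineTL (s : ℂ) where
  points : ℕ

/-- The linear category whose morphisms `m ⟶ n` are the linear combinations of affine
`(m, n)`-diagrams. -/
noncomputable instance instCategoryAffineTL (s : ℂ) : CategoryTheory.Category.{0, 0} (AffineTL s) where
  Hom X Y := AffineDiagram X.points Y.points →₀ ℂ
  id X := Finsupp.single (idDiagram X.points) 1
  comp g f := linComp s f g
  id_comp f := linComp_id s f
  comp_id f := id_linComp s f
  assoc h g f := linComp_assoc s f g h

noncomputable instance instPreadditiveAffineTL (s : ℂ) :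
    CategoryTheory.Preadditive (AffineTL s) where
  homGroup X Y := inferInstanceAs (AddCommGroup (AffineDiagram X.points Y.points →₀ ℂ))
  add_comp _ _ _ g g' f := linComp_add_right s f g g'
  comp_add _ _ _ g f f' := linComp_add_left s f f' g

noncomputable instance instLinearAffineTL (s : ℂ) : CategoryTheory.Linear ℂ (AffineTL s) where
  homModule X Y := inferInstanceAs (Module ℂ (AffineDiagram X.points Y.points →₀ ℂ))
  smul_comp _ _ _ c g f := linComp_smul_right s c f g
  comp_smul _ _ _ g c f := linComp_smul_left s c f g

/-- The algebra of endomorphisms of `n` in the affine Temperley–Lieb category. In the product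
`x * y`, the diagram `y` is placed inside `x`. -/
abbrev EndTL (s : ℂ) (n : ℕ) : Type := CategoryTheory.End (AffineTL.mk n : AffineTL s)

/-- An affine `(n, n)`-diagram as an element of the endomorphism algebra. -/
noncomputable def diag (s : ℂ) {n : ℕ} (D : AffineDiagram n n) : EndTL s n :=
  (Finsupp.single D 1 : AffineDiagram n n →₀ ℂ)

/-! ### The diagrams that correspond to the generators -/

/-- The `(0, 0)`-diagram that consists of one noncontractible loop. -/
def loopDiagram : AffineDiagram 0 0 where
  mate := id
  mate_mate _ := rfl
  mate_ne := by
    rintro (x | x) <;> exact (x.ne rfl).elim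
  mate_vadd _ _ := rfl
  noncrossing := by
    rintro (x | x) <;> exact (x.ne rfl).elim
  loops := 1
  loops_disjoint _ x := (x.ne rfl).elim

/-- The diagram of `ρ`: the arcs connect the inner point `x` to the outer point `x + 1`. -/
def rhoDiagram (n : ℕ) : AffineDiagram n n := rotDiagram n 1

/-- The involution of `ℤ` that swaps `x` and `x + 1` for all `x` congruent to `i` modulo `n`. -/
def swapAt (n : ℕ) (i : ZMod n) (x : ℤ) : ℤ :=
  if (x : ZMod n) = i then x + 1 else if (x : ZMod n) = i + 1 then x - 1 else x

theorem swapAt_cases {n : ℕ} (hn : 2 ≤ n) (i : ZMod n) (x : ℤ) :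
    ((x : ZMod n) = i ∧ swapAt n i x = x + 1 ∧ swapAt n i (x + 1) = x) ∨
    ((x : ZMod n) = i + 1 ∧ swapAt n i x = x - 1 ∧ swapAt n i (x - 1) = x) ∨
    ((x : ZMod n) ≠ i ∧ (x : ZMod n) ≠ i + 1 ∧ swapAt n i x = x) := by
  have : Fact (1 < n) := ⟨hn⟩
  have h1 : i + 1 ≠ i := fun h => one_ne_zero (α := ZMod n) (add_eq_left.1 h)
  by_cases h2 : (x : ZMod n) = i
  · refine Or.inl ⟨h2, by simp [swapAt, h2], ?_⟩
    simp [swapAt, h2]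
  · by_cases h3 : (x : ZMod n) = i + 1
    · refine Or.inr (Or.inl ⟨h3, by simp [swapAt, h3], ?_⟩)
      simp [swapAt, h3]
    · exact Or.inr (Or.inr ⟨h2, h3, by simp [swapAt, h2, h3]⟩)

theorem swapAt_swapAt {n : ℕ} (hn : 2 ≤ n) (i : ZMod n) (x : ℤ) :
    swapAt n i (swapAt n i x) = x := by
  rcases swapAt_cases hn i x with ⟨-, h, h'⟩ | ⟨-, h, h'⟩ | ⟨-, -, h⟩
  · rw [h, h']
  · rw [h, h']
  · rw [h, h]

theorem swapAt_add {n : ℕ} (i : ZMod n) (x j : ℤ) :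
    swapAt n i (x + n * j) = swapAt n i x + n * j := by
  have h : ((x + n * j : ℤ) : ZMod n) = x := by simp
  simp only [swapAt, h]
  split_ifs <;> ring

theorem swapAt_near {n : ℕ} (i : ZMod n) (x : ℤ) :
    swapAt n i x = x ∨ swapAt n i x = x + 1 ∨ swapAt n i x = x - 1 := by
  simp only [swapAt]
  split_ifs <;> simp

/-- The diagram of `e i` for `n ≥ 2`: on both boundary lines, the points `x` and `x + 1` are
connected for all `x` congruent to `i` modulo `n`; straight lines at the other points. -/
def eDiagram (n : ℕ) (hn : 2 ≤ n) (i : ZMod n) : AffineDiagram n n where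
  mate
    | Sum.inl x => if swapAt n i x.pos = x.pos then Sum.inr x else Sum.inl ⟨swapAt n i x.pos, x.ne⟩
    | Sum.inr x => if swapAt n i x.pos = x.pos then Sum.inl x else Sum.inr ⟨swapAt n i x.pos, x.ne⟩
  mate_mate := by
    have h1 := swapAt_swapAt hn i
    rintro (x | x) <;> by_cases h : swapAt n i x.pos = x.pos <;>
      first
      | (simp [h, h1]; done)
      | simp [h, h1, Ne.symm h]
  mate_ne := by
    rintro (x | x) <;> by_cases h : swapAt n i x.pos = x.pos <;> simp [h, MarkedPt.ext_iff]
  mate_vadd := by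
    rintro j (x | x) <;> by_cases h : swapAt n i x.pos = x.pos <;>
      simp [h, MarkedPt.vadd_pos, swapAt_add, MarkedPt.ext_iff]
  noncrossing := by
    have h0 : ∀ x y, swapAt n i x = swapAt n i y → x = y := fun x y h => by
      rw [← swapAt_swapAt hn i x, h, swapAt_swapAt hn]
    rintro (x | x) (y | y) <;> by_cases h : swapAt n i x.pos = x.pos <;>
      by_cases h' : swapAt n i y.pos = y.pos <;>
      simp only [h, h', if_true, if_false, Before, true_and, and_true, false_implies, implies_true,
        forall_const] <;> have h1 := swapAt_near i x.pos <;> have h2 := swapAt_near i y.pos <;>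
      have h3 := h0 x.pos y.pos <;> omega
  loops := 0
  loops_disjoint h := (h rfl).elim

/-! ### The extended affine Temperley–Lieb algebras -/

/-- The generators `e 1, …, e n` (with indices modulo `n`), `ρ` and `ρ⁻¹`. -/
inductive TLGen (n : ℕ) : Type
  | e (i : ZMod n)
  | rho
  | rhoInv

/-- The generators in the free algebra. -/
noncomputable def gen {n : ℕ} (g : TLGen n) : FreeAlgebra ℂ (TLGen n) := FreeAlgebra.ι ℂ g

open TLGen in
/-- The defining relations for `n = 2`. -/
inductive TLTwoRel (s : ℂ) : FreeAlgebra ℂ (TLGen 2) → FreeAlgebra ℂ (TLGen 2) → Prop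
  | e_sq (i : ZMod 2) : TLTwoRel s (gen (e i) ^ 2) (loopWeight s • gen (e i))
  | rho_e (i : ZMod 2) : TLTwoRel s (gen rho * gen (e i)) (gen (e (i + 1)) * gen rho)
  | rho_rhoInv : TLTwoRel s (gen rho * gen rhoInv) 1
  | rhoInv_rho : TLTwoRel s (gen rhoInv * gen rho) 1
  | rho_sq_e : TLTwoRel s (gen rho ^ 2 * gen (e 1)) (gen (e 1))

open TLGen in
/-- The defining relations for `n ≥ 3`. -/
inductive TLRel (s : ℂ) (n : ℕ) : FreeAlgebra ℂ (TLGen n) → FreeAlgebra ℂ (TLGen n) → Prop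
  | e_sq (i : ZMod n) : TLRel s n (gen (e i) ^ 2) (loopWeight s • gen (e i))
  | e_comm (i j : ZMod n) (h1 : i - j ≠ 1) (h2 : i - j ≠ -1) :
      TLRel s n (gen (e i) * gen (e j)) (gen (e j) * gen (e i))
  | e_succ (i : ZMod n) : TLRel s n (gen (e i) * gen (e (i + 1)) * gen (e i)) (gen (e i))
  | e_pred (i : ZMod n) : TLRel s n (gen (e i) * gen (e (i - 1)) * gen (e i)) (gen (e i))
  | rho_e (i : ZMod n) : TLRel s n (gen rho * gen (e i)) (gen (e (i + 1)) * gen rho)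
  | rho_rhoInv : TLRel s n (gen rho * gen rhoInv) 1
  | rhoInv_rho : TLRel s n (gen rhoInv * gen rho) 1
  | rho_e_pow : TLRel s n ((gen rho * gen (e 1)) ^ (n - 1)) (gen rho ^ n * (gen rho * gen (e 1)))

/-- The extended affine Temperley–Lieb algebra for `n = 2`. -/
abbrev TLTwo (s : ℂ) : Type := RingQuot (TLTwoRel s)

/-- The extended affine Temperley–Lieb algebra for `n ≥ 3`. -/
abbrev TL (s : ℂ) (n : ℕ) : Type := RingQuot (TLRel s n)

/-- The image of a generator in `TLTwo s`. -/
noncomputable def TLTwo.gen (s : ℂ) (g : TLGen 2) : TLTwo s :=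
  RingQuot.mkAlgHom ℂ (TLTwoRel s) (ATL.gen g)

/-- The image of a generator in `TL s n`. -/
noncomputable def TL.gen (s : ℂ) (n : ℕ) (g : TLGen n) : TL s n :=
  RingQuot.mkAlgHom ℂ (TLRel s n) (ATL.gen g)

end ATL

namespace ATL

/-! ### Turning diagrams inside out -/

/-! The relations hold for diagrams by direct computation, and the real content is that the
resulting map `Φ` is bijective. Injectivity is obtained without normal forms of words: a linear left
inverse of `Φ` is built from the geometry of diagrams.

The abstract setting is a `TLSystem`: elements of an algebra `A` with the relations among `e 0, …, e
(n - 2)` and the rotation. Inside `A` one models all diagrams with fewer points of the same parity.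
A diagram with `k` outer points is completed by `n - k` further outer points joined in neighbouring
pairs, so that it lives in the right ideal of `dead k = e k * e (k + 2) * ⋯ * e (n - 2)`. On these
ideals a cup is the inclusion of the ideal of `k` into that of `k + 2`, a cap is left multiplication
by `e k`, and a rotation is left multiplication by `u k = dead k * rho`. For `k ≠ 0` this is
invertible on the ideal (`u_v`); for `k = 0` it is a noncontractible loop instead.

Every diagram is a product of rotations, cups, caps and loops (`AffineDiagram.decompose`): an
innermost arc joins neighbours and can be split off, and a diagram without such arcs is a
translation or a set of loops. Multiplying the corresponding elements of `A` gives a representative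
(`TLSystem.Rep`). The heart of the proof is that it does not depend on the factorization
(`TLSystem.uniq`). By induction on the number of points only the last factors have to be compared:
two outer arcs coincide up to full rotations, or they are disjoint and both can be split off; an
outer and an inner arc can always both be split off. The algebraic identities that match this are
`rot_full` and `rot_rot_mul`. The relation `(ρ e₁)^(n-1) = ρ^n (ρ e₁)` enters as `TLSystem.twist`;
it is what lets a full rotation pass through a cup (`u_sq`, `rot_full`).

The linear extension `Psi` of the choice of representatives turns composition with rotations, cups
and caps into the corresponding operations on the ideals; for caps (`Psi_cap`) this uses in addition
the loop weight, the straightening of zigzags and `e_rot_far`. Hence `Psi (Φ a * b) = a * Psi b`,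
and since `Psi` maps the identity diagram to `dead n = 1`, it is a left inverse of `Φ`. Surjectivity
is `genAlg_eq_top`: factors of a diagram are carried through cups until only rotations of `n`
strands and one cup-cap remain. Arguments about caps are often obtained from those about cups by
reflecting the annulus, which corresponds to the opposite algebra. For `n = 0` and `n = 1` the bases
are matched directly, as every diagram is a power of a single one. -/

theorem Before.swap_iff {m n : ℕ} (x y : MarkedPt m ⊕ MarkedPt n) :
    Before x.swap y.swap ↔ Before y x := by
  rcases x with x | x <;> rcases y with y | y <;> simp [Before]

/-- The diagram turned inside out. -/
def AffineDiagram.flip {m n : ℕ} (D : AffineDiagram m n) : AffineDiagram n m where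
  mate u := (D.mate u.swap).swap
  mate_mate u := by simp [D.mate_mate]
  mate_ne u h := D.mate_ne u.swap (by
    have := congrArg Sum.swap h
    simpa using this)
  mate_vadd j u := by
    have h1 : ∀ {a b : ℕ} (u : MarkedPt a ⊕ MarkedPt b), (j +ᵥ u).swap = j +ᵥ u.swap := by
      rintro a b (u | u) <;> rfl
    rw [h1, D.mate_vadd, h1]
  noncrossing x y h1 h2 := by
    obtain ⟨x, rfl⟩ := Sum.swap_rightInverse.surjective x
    obtain ⟨y, rfl⟩ := Sum.swap_rightInverse.surjective y
    rw [Before.swap_iff] at h1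
    rw [Sum.swap_swap, Before.swap_iff] at h2
    rw [Sum.swap_swap, Sum.swap_swap, Before.swap_iff, Before.swap_iff]
    -- Exchanging the two boundary lines reverses `Before`, so the arc of `x` has to be read from
    -- its other end.
    have h3 := D.noncrossing (D.mate x) y h2 (by rwa [D.mate_mate])
    rw [D.mate_mate] at h3
    exact ⟨h3.2, h3.1⟩
  loops := D.loops
  loops_disjoint h x := by
    -- Read from its inner end, an arc from `x` to the inner line would contradict
    -- `D.loops_disjoint`.
    rcases h1 : D.mate (Sum.inr x) with y | y
    · obtain ⟨z, hz⟩ := D.loops_disjoint h y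
      rw [← h1, D.mate_mate] at hz
      cases hz
    · exact ⟨y, by simp [h1]⟩

theorem AffineDiagram.flip_mate {m n : ℕ} (D : AffineDiagram m n) (u : MarkedPt n ⊕ MarkedPt m) :
    D.flip.mate u = (D.mate u.swap).swap := rfl

theorem AffineDiagram.flip_flip {m n : ℕ} (D : AffineDiagram m n) : D.flip.flip = D :=
  AffineDiagram.ext' (fun u => by simp [flip_mate]) rfl

/-- Turning the glued strip inside out. -/
def glueSwap {k m n : ℕ} : GluePt k m n → GluePt n m k
  | Sum.inl x => Sum.inr (Sum.inr x)
  | Sum.inr (Sum.inl y) => Sum.inr (Sum.inl y)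
  | Sum.inr (Sum.inr z) => Sum.inl z

section Flip

variable {k m n : ℕ} (E : AffineDiagram m n) (D : AffineDiagram k m)

theorem innerStep_glueSwap (q : GluePt k m n) :
    innerStep k E.flip (glueSwap q) = glueSwap (outerStep k E q) := by
  rcases q with x | y | z
  · rfl
  · change Sum.map id Sum.inl (E.mate (Sum.inl y)).swap = glueSwap (Sum.inr (E.mate (Sum.inl y)))
    rcases E.mate (Sum.inl y) with a | a <;> rfl
  · change Sum.map id Sum.inl (E.mate (Sum.inr z)).swap = glueSwap (Sum.inr (E.mate (Sum.inr z)))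
    rcases E.mate (Sum.inr z) with a | a <;> rfl

theorem outerStep_glueSwap (q : GluePt k m n) :
    outerStep n D.flip (glueSwap q) = glueSwap (innerStep n D q) := by
  rcases q with x | y | z
  · change Sum.inr (D.mate (Sum.inl x)).swap = glueSwap (Sum.map id Sum.inl (D.mate (Sum.inl x)))
    rcases D.mate (Sum.inl x) with a | a <;> rfl
  · change Sum.inr (D.mate (Sum.inr y)).swap = glueSwap (Sum.map id Sum.inl (D.mate (Sum.inr y)))
    rcases D.mate (Sum.inr y) with a | a <;> rfl
  · rfl

variable {E D}

theorem Conn.glueSwap {p q : GluePt k m n} (h : Conn E D p q) :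
    Conn D.flip E.flip (glueSwap p) (glueSwap q) := by
  induction h with
  | rel x y h =>
    rcases h with rfl | rfl
    · rw [← outerStep_glueSwap]; exact Linked.right _
    · rw [← innerStep_glueSwap]; exact Linked.left _
  | refl x => exact Linked.refl _
  | symm x y _ ih => exact ih.symm
  | trans x y z _ _ ih1 ih2 => exact ih1.trans ih2

theorem glueSwap_glueSwap (q : GluePt k m n) : ATL.glueSwap (ATL.glueSwap q) = q := by
  rcases q with x | y | z <;> rfl

variable (E D)

theorem conn_glueSwap_iff {p q : GluePt k m n} :
    Conn D.flip E.flip (glueSwap p) (glueSwap q) ↔ Conn E D p q := by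
  refine ⟨fun h => ?_, Conn.glueSwap⟩
  have := h.glueSwap
  simpa only [AffineDiagram.flip_flip, glueSwap_glueSwap] using this

theorem glueSwap_bdPt (u : MarkedPt k ⊕ MarkedPt n) :
    glueSwap (bdPt k m n u) = bdPt n m k u.swap := by
  rcases u with x | x <;> rfl

theorem conn_flip_mid {y z : MarkedPt m} :
    Conn D.flip E.flip (midPt n m k y) (midPt n m k z) ↔
      Conn E D (midPt k m n y) (midPt k m n z) :=
  conn_glueSwap_iff E D (p := midPt k m n y) (q := midPt k m n z)

theorem sameStrand_flip {y z : MarkedPt m} :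
    SameStrand D.flip E.flip y z ↔ SameStrand E D y z :=
  exists_congr fun _ => conn_flip_mid E D

theorem newLoops_flip : newLoops D.flip E.flip = newLoops E D := by
  have h : OnNoncontractible D.flip E.flip = OnNoncontractible E D := funext fun y =>
    propext (exists_congr fun j => and_congr_right fun _ => conn_flip_mid E D)
  have h2 : SameStrand D.flip E.flip = SameStrand E D := funext fun y => funext fun z =>
    propext (sameStrand_flip E D)
  rw [newLoops, h, h2]
  rfl

theorem contractibleLoops_flip : contractibleLoops D.flip E.flip = contractibleLoops E D := by
  have h : OnContractible D.flip E.flip = OnContractible E D := by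
    funext y
    refine propext (and_congr ?_ (forall_congr' fun j => forall_congr' fun _ =>
      not_congr (conn_flip_mid E D)))
    constructor
    · intro h b hb
      refine h b.swap ?_
      rw [← glueSwap_bdPt]
      exact (conn_glueSwap_iff E D (p := midPt k m n y)).2 hb
    · intro h b hb
      refine h b.swap ?_
      rw [← conn_glueSwap_iff, glueSwap_bdPt, Sum.swap_swap]
      exact hb
  have h2 : SameStrand D.flip E.flip = SameStrand E D := funext fun y => funext fun z =>
    propext (sameStrand_flip E D)
  rw [contractibleLoops, h, h2]
  rfl

theorem AffineDiagram.comp_mate (u : MarkedPt k ⊕ MarkedPt n) :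
    (E.comp D).mate u = compMate E D u := rfl

theorem AffineDiagram.comp_loops : (E.comp D).loops = D.loops + E.loops + newLoops E D := rfl

theorem AffineDiagram.flip_comp : (E.comp D).flip = D.flip.comp E.flip := by
  refine AffineDiagram.ext' (fun u => ?_) ?_
  · refine compMate_unique _ _ ((E.comp D).flip.mate_ne u) ?_
    rw [flip_mate, comp_mate]
    have := (compMate_conn E D u.swap).glueSwap
    rwa [glueSwap_bdPt, glueSwap_bdPt, Sum.swap_swap] at this
  · change D.loops + E.loops + newLoops E D = E.loops + D.loops + newLoops D.flip E.flip
    rw [newLoops_flip]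
    omega

/-! ### Composition with diagrams without arcs on the gluing line -/

variable {E D}

theorem conn_inner (u : MarkedPt k ⊕ MarkedPt m) :
    Conn E D (Sum.map id Sum.inl u) (Sum.map id Sum.inl (D.mate u)) := by
  rw [← innerStep_map]
  exact Linked.left _

theorem conn_outer (u : MarkedPt m ⊕ MarkedPt n) : Conn E D (Sum.inr u) (Sum.inr (E.mate u)) :=
  Linked.right _

/-- A diagram all whose inner points are connected to outer points. -/
def Straight (E : AffineDiagram m n) (f : MarkedPt m → MarkedPt n) : Prop :=
  ∀ y, E.mate (Sum.inl y) = Sum.inr (f y)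

variable {f : MarkedPt m → MarkedPt n}

theorem Straight.conn (hf : Straight E f) (u : MarkedPt k ⊕ MarkedPt m) :
    Conn E D (Sum.map id Sum.inl u) (bdPt k m n (Sum.map id f u)) := by
  rcases u with x | y
  · exact Linked.refl _
  · have := conn_outer (E := E) (D := D) (Sum.inl y)
    rw [hf] at this
    exact this

theorem Straight.injective (hf : Straight E f) : Function.Injective f := by
  intro x y h
  have : E.mate (Sum.inl x) = E.mate (Sum.inl y) := by rw [hf, hf, h]
  have h2 := congrArg E.mate this
  rw [E.mate_mate, E.mate_mate] at h2
  exact Sum.inl_injective h2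

/-- The diagram `E` only prolongs points of the gluing line to the outer boundary, so a strand that
meets `D` is a single arc of `D` with prolonged ends. -/
theorem Straight.comp_mate (hf : Straight E f) (D : AffineDiagram k m) (u : MarkedPt k ⊕ MarkedPt m) :
    (E.comp D).mate (Sum.map id f u) = Sum.map id f (D.mate u) := by
  refine (compMate_unique E D (fun h => ?_) ?_).symm
  · exact D.mate_ne u (Sum.map_injective.2 ⟨Function.injective_id, hf.injective⟩ h)
  · exact ((hf.conn u).symm.trans (conn_inner u)).trans (hf.conn _)

theorem comp_mate_of_outer {x y : MarkedPt n} (h : E.mate (Sum.inr x) = Sum.inr y)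
    (D : AffineDiagram k m) : (E.comp D).mate (Sum.inr x) = Sum.inr y := by
  refine (compMate_unique E D (fun h' => E.mate_ne (Sum.inr x) (h.trans (by rw [Sum.inr_injective h']))) ?_).symm
  have := conn_outer (E := E) (D := D) (Sum.inr x)
  rwa [h] at this

/-- Every point of the gluing line is one step away from the boundary, so no strand is closed. -/
theorem Straight.loops (hf : Straight E f) (D : AffineDiagram k m) :
    contractibleLoops E D = 0 ∧ newLoops E D = 0 :=
  loops_eq_zero_of_conn fun y => ⟨_, hf.conn (Sum.inr y)⟩

end Flip


/-! ### Rotations, cups and caps -/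

/-- The position in a strip with `k + 2` marked points of a point in a strip with `k` marked points,
where two points are added at the end of each fundamental domain. -/
def embPos (k : ℕ) (p : ℤ) : ℤ := p + 2 * (p / k)

/-- The inverse of `embPos` on its image. -/
def unembPos (k : ℕ) (q : ℤ) : ℤ := q - 2 * (q / (k + 2 : ℕ))

/-- Positions are computed in coordinates: `q` numbers the fundamental domain and `r` is the place
inside it. Both are preserved; only the length of a domain changes from `k` to `k + 2`. -/
theorem embPos_of_eq {k : ℕ} {p q r : ℤ} (h : p = k * q + r) (h0 : 0 ≤ r) (h1 : r < k) :
    embPos k p = (k + 2 : ℕ) * q + r := by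
  have h2 : p / k = q := by
    rw [h, Int.mul_add_ediv_left _ _ (by omega), Int.ediv_eq_zero_of_lt h0 h1, add_zero]
  rw [embPos, h2, h]
  push_cast
  ring

theorem unembPos_of_eq {k : ℕ} {p q r : ℤ} (h : p = (k + 2 : ℕ) * q + r) (h0 : 0 ≤ r)
    (h1 : r < k + 2) : unembPos k p = k * q + r := by
  have h2 : p / (k + 2 : ℕ) = q := by
    rw [h, Int.mul_add_ediv_left _ _ (by omega), Int.ediv_eq_zero_of_lt h0 (by push_cast; exact h1),
      add_zero]
  rw [unembPos, h2, h]
  push_cast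
  ring

theorem exists_div {k : ℕ} (hk : k ≠ 0) (p : ℤ) : ∃ q r : ℤ, p = k * q + r ∧ 0 ≤ r ∧ r < k :=
  ⟨p / k, p % k, (Int.mul_ediv_add_emod p k).symm, Int.emod_nonneg _ (by omega),
    Int.emod_lt_of_pos _ (by omega)⟩

theorem emod_of_eq {k : ℕ} {p q r : ℤ} (h : p = k * q + r) (h0 : 0 ≤ r) (h1 : r < k) :
    p % k = r := by
  rw [h, Int.mul_add_emod_self_left, Int.emod_eq_of_lt h0 h1]

/-- The involution of the points of a strip with `k + 2` points that swaps the last two points of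
each fundamental domain. -/
def deadPos (k : ℕ) (q : ℤ) : ℤ := if q % (k + 2 : ℕ) = k then q + 1 else q - 1

/-- The inclusion of marked points that is given by `embPos`. -/
def emb (k : ℕ) (x : MarkedPt k) : MarkedPt (k + 2) := ⟨embPos k x.pos, by omega⟩

theorem emb_mod {k : ℕ} (hk : k ≠ 0) (p : ℤ) : embPos k p % (k + 2 : ℕ) < k ∧
    unembPos k (embPos k p) = p := by
  obtain ⟨q, r, h, h0, h1⟩ := exists_div hk p
  have h2 := embPos_of_eq h h0 h1
  have h3 := emod_of_eq h2 h0 (by push_cast; omega)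
  have h4 := unembPos_of_eq h2 h0 (by omega)
  rw [h3, h4]
  exact ⟨h1, h.symm⟩

theorem embPos_unembPos {k : ℕ} {q : ℤ} (h : q % (k + 2 : ℕ) < k) :
    embPos k (unembPos k q) = q := by
  obtain ⟨a, r, h', h0, h1⟩ := exists_div (k := k + 2) (by omega) q
  rw [emod_of_eq h' h0 h1] at h
  rw [unembPos_of_eq h' h0 (by omega), embPos_of_eq rfl h0 h, h']

/-- The residues `k` and `k + 1` are the ones missed by `embPos`; they are exchanged inside one
domain. Points at such residues are called dead, the others live. -/
theorem deadPos_cases {k : ℕ} {q : ℤ} (h : ¬ q % (k + 2 : ℕ) < k) :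
    (q % (k + 2 : ℕ) = k ∧ deadPos k q = q + 1 ∧ (q + 1) % (k + 2 : ℕ) = k + 1 ∧
      deadPos k (q + 1) = q) ∨
    (q % (k + 2 : ℕ) = k + 1 ∧ deadPos k q = q - 1 ∧ (q - 1) % (k + 2 : ℕ) = k ∧
      deadPos k (q - 1) = q) := by
  obtain ⟨a, r, h', h0, h1⟩ := exists_div (k := k + 2) (by omega) q
  have h2 := emod_of_eq h' h0 h1
  rw [h2] at h
  push_cast at h1
  by_cases h3 : r = k
  · have h4 : (q + 1) % (k + 2 : ℕ) = k + 1 :=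
      emod_of_eq (q := a) (by rw [h', h3]; ring) (by omega) (by push_cast; omega)
    refine Or.inl ⟨by rw [h2, h3], by simp only [deadPos, h2, h3, if_true], h4, ?_⟩
    rw [deadPos, h4, if_neg (by omega)]
    ring
  · have h5 : r = k + 1 := by omega
    have h4 : (q - 1) % (k + 2 : ℕ) = k :=
      emod_of_eq (q := a) (by rw [h', h5]; ring) (by omega) (by push_cast; omega)
    refine Or.inr ⟨by rw [h2, h5], by rw [deadPos, h2, if_neg h3], h4, ?_⟩
    rw [deadPos, h4, if_pos rfl]
    ring

theorem embPos_lt {k : ℕ} (hk : k ≠ 0) {x y : ℤ} (h : x < y) : embPos k x < embPos k y := by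
  have : x / k ≤ y / k := Int.ediv_le_ediv (by omega) h.le
  simp only [embPos]
  omega

theorem embPos_lt_iff {k : ℕ} (hk : k ≠ 0) {x y : ℤ} : embPos k x < embPos k y ↔ x < y := by
  refine ⟨fun h => ?_, embPos_lt hk⟩
  rcases lt_trichotomy x y with h1 | rfl | h1
  · exact h1
  · exact (lt_irrefl _ h).elim
  · exact (lt_asymm h (embPos_lt hk h1)).elim

theorem embPos_add {k : ℕ} (hk : k ≠ 0) (p j : ℤ) :
    embPos k (p + k * j) = embPos k p + (k + 2 : ℕ) * j := by
  rw [embPos, embPos, Int.add_mul_ediv_left _ _ (by omega)]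
  push_cast
  ring

/-- The `(k, k + 2)`-diagram in which the two last outer points are connected. -/
def cupDiagram (k : ℕ) : AffineDiagram k (k + 2) where
  mate
    | Sum.inl x => Sum.inr (emb k x)
    | Sum.inr y => if h : y.pos % (k + 2 : ℕ) < k then
        Sum.inl ⟨unembPos k y.pos, by
          -- For `k = 0` no residue is smaller than `k`, so this branch is entered only if there are
          -- inner points.
          rintro rfl
          have := Int.emod_nonneg y.pos (b := (0 + 2 : ℕ)) (by omega)
          omega⟩
      else Sum.inr ⟨deadPos k y.pos, y.ne⟩
  mate_mate := by
    rintro (x | y)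
    · have h := emb_mod x.ne x.pos
      change (if h : embPos k x.pos % (k + 2 : ℕ) < k then _ else _) = _
      rw [dif_pos h.1]
      exact congrArg Sum.inl (MarkedPt.ext h.2)
    · by_cases h : y.pos % (k + 2 : ℕ) < k
      · simp only [h, dite_true]
        exact congrArg Sum.inr (MarkedPt.ext (embPos_unembPos h))
      · simp only [h, dite_false]
        rcases deadPos_cases h with ⟨-, h1, h2, h3⟩ | ⟨-, h1, h2, h3⟩
        · rw [dif_neg (by rw [h1, h2]; omega)]
          exact congrArg Sum.inr (MarkedPt.ext (by rw [h1]; exact h3))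
        · rw [dif_neg (by rw [h1, h2]; omega)]
          exact congrArg Sum.inr (MarkedPt.ext (by rw [h1]; exact h3))
  mate_ne := by
    rintro (x | y)
    · simp
    · by_cases h : y.pos % (k + 2 : ℕ) < k
      · simp only [dif_pos h]
        exact Sum.inl_ne_inr
      · simp only [h, dite_false, ne_eq, Sum.inr.injEq, MarkedPt.ext_iff]
        rcases deadPos_cases h with ⟨-, h1, h2, h3⟩ | ⟨-, h1, h2, h3⟩ <;> omega
  mate_vadd := by
    rintro j (x | y)
    · exact congrArg Sum.inr (MarkedPt.ext (embPos_add x.ne _ _))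
    · have h0 : (y.pos + (k + 2 : ℕ) * j) % (k + 2 : ℕ) = y.pos % (k + 2 : ℕ) :=
        Int.add_mul_emod_self_left _ _ _
      change (if h : (y.pos + (k + 2 : ℕ) * j) % (k + 2 : ℕ) < k then _ else _) = _
      by_cases h : y.pos % (k + 2 : ℕ) < k
      · rw [dif_pos (by rw [h0]; exact h)]
        simp only [h, dite_true]
        refine congrArg Sum.inl (MarkedPt.ext ?_)
        change unembPos k (y.pos + (k + 2 : ℕ) * j) = unembPos k y.pos + k * j
        rw [unembPos, unembPos, Int.add_mul_ediv_left _ _ (by omega)]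
        push_cast
        ring
      · rw [dif_neg (by rw [h0]; exact h)]
        simp only [h, dite_false]
        refine congrArg Sum.inr (MarkedPt.ext ?_)
        change deadPos k (y.pos + (k + 2 : ℕ) * j) = deadPos k y.pos + (k + 2 : ℕ) * j
        rw [deadPos, deadPos, h0]
        split_ifs <;> ring
  noncrossing := by
    -- The two partners at a dead residue are neighbours and `embPos` hits neither of them, so a
    -- live position lies on the same side of both.
    have key : ∀ (x : MarkedPt k) (y : ℤ), ¬ y % (k + 2 : ℕ) < k → embPos k x.pos < y →
        embPos k x.pos < deadPos k y := by
      intro x y h h1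
      rcases deadPos_cases h with ⟨-, h2, h3, h4⟩ | ⟨-, h2, h3, h4⟩
      · omega
      · have h5 : embPos k x.pos ≠ y - 1 := fun h5 => by
          have := (emb_mod x.ne x.pos).1
          rw [h5, h3] at this
          omega
        omega
    rintro (x | x) (y | y) h1 h2
    · exact ⟨trivial, embPos_lt x.ne h1⟩
    · have h3 : embPos k x.pos < y.pos := h2
      by_cases h : y.pos % (k + 2 : ℕ) < k
      · simp only [h, dite_true]
        refine ⟨?_, trivial⟩
        change x.pos < unembPos k y.pos
        rw [← embPos_lt_iff x.ne, embPos_unembPos h]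
        exact h3
      · simp only [h, dite_false]
        exact ⟨trivial, key x _ h h3⟩
    · exact h1.elim
    · by_cases h : x.pos % (k + 2 : ℕ) < k
      · simp only [h, dite_true] at h2
        exact h2.elim
      · simp only [h, dite_false] at h2
        have h3 : deadPos k x.pos < y.pos := h2
        have h4 : y.pos < x.pos := h1
        rcases deadPos_cases h with ⟨-, h2, -, -⟩ | ⟨-, h2, -, -⟩ <;> omega
  loops := 0
  loops_disjoint h := (h rfl).elim

/-- The `(k + 2, k)`-diagram in which the two last inner points are connected. -/
def capDiagram (k : ℕ) : AffineDiagram (k + 2) k := (cupDiagram k).flip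

theorem cup_straight (k : ℕ) : Straight (cupDiagram k) (emb k) := fun _ => rfl

theorem cup_dead {k : ℕ} {x : MarkedPt (k + 2)} (h : ¬ x.pos % (k + 2 : ℕ) < k) :
    (cupDiagram k).mate (Sum.inr x) = Sum.inr ⟨deadPos k x.pos, x.ne⟩ := dif_neg h

theorem cap_dead {k : ℕ} {x : MarkedPt (k + 2)} (h : ¬ x.pos % (k + 2 : ℕ) < k) :
    (capDiagram k).mate (Sum.inl x) = Sum.inl ⟨deadPos k x.pos, x.ne⟩ := by
  rw [capDiagram, AffineDiagram.flip_mate, Sum.swap_inl, cup_dead h]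
  rfl

theorem cap_inr {k : ℕ} (x : MarkedPt k) :
    (capDiagram k).mate (Sum.inr x) = Sum.inl (emb k x) := rfl

theorem exists_emb {k : ℕ} {x : MarkedPt (k + 2)} (h : x.pos % (k + 2 : ℕ) < k) :
    ∃ y, x = emb k y := by
  refine ⟨⟨unembPos k x.pos, ?_⟩, MarkedPt.ext (embPos_unembPos h).symm⟩
  rintro rfl
  have := Int.emod_nonneg x.pos (b := (0 + 2 : ℕ)) (by omega)
  omega

theorem exists_emb_or (k : ℕ) (x : MarkedPt (k + 2)) :
    (∃ y, x = emb k y) ∨ ¬ x.pos % (k + 2 : ℕ) < k :=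
  (em _).imp_left exists_emb

theorem emb_alive {k : ℕ} (x : MarkedPt k) : (emb k x).pos % (k + 2 : ℕ) < k :=
  (emb_mod x.ne x.pos).1

/-- Adding an integer to the position of a point. -/
def movePt {k : ℕ} (r : ℤ) (x : MarkedPt k) : MarkedPt k := ⟨x.pos + r, x.ne⟩

theorem rot_straight (k : ℕ) (r : ℤ) : Straight (rotDiagram k r) (movePt r) := fun _ => rfl

/-- As `movePt r` is bijective, `Straight.comp_mate` determines the composite at all points, the
outer ones being moved back first. -/
theorem rot_comp_mate {l k : ℕ} (r : ℤ) (D : AffineDiagram l k) (u : MarkedPt l ⊕ MarkedPt k) :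
    ((rotDiagram k r).comp D).mate u =
      Sum.map id (movePt r) (D.mate (Sum.map id (movePt (-r)) u)) := by
  rw [← (rot_straight k r).comp_mate]
  congr 1
  rcases u with x | x
  · rfl
  · exact congrArg Sum.inr (MarkedPt.ext (by simp [movePt]))

theorem rot_comp_loops {l k : ℕ} (r : ℤ) (D : AffineDiagram l k) :
    ((rotDiagram k r).comp D).loops = D.loops := by
  rw [AffineDiagram.comp_loops, ((rot_straight k r).loops D).2]
  rfl

theorem cup_comp_loops {l k : ℕ} (D : AffineDiagram l k) :
    ((cupDiagram k).comp D).loops = D.loops := by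
  rw [AffineDiagram.comp_loops, ((cup_straight k).loops D).2]
  rfl

theorem rot_comp_rot (k : ℕ) (a b : ℤ) :
    (rotDiagram k a).comp (rotDiagram k b) = rotDiagram k (a + b) := by
  refine AffineDiagram.ext' (fun u => ?_) (rot_comp_loops _ _)
  rw [rot_comp_mate]
  rcases u with x | x
  · exact congrArg Sum.inr (MarkedPt.ext (show x.pos + b + a = x.pos + (a + b) by ring))
  · refine congrArg Sum.inl (MarkedPt.ext ?_)
    change x.pos + -a - b = x.pos - (a + b)
    ring

theorem rot_zero_comp {l k : ℕ} (D : AffineDiagram l k) : (rotDiagram k 0).comp D = D :=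
  AffineDiagram.id_comp D

theorem rot_rot_comp {l k : ℕ} (a b : ℤ) (D : AffineDiagram l k) :
    (rotDiagram k a).comp ((rotDiagram k b).comp D) = (rotDiagram k (a + b)).comp D := by
  rw [AffineDiagram.comp_assoc, rot_comp_rot]

theorem rot_flip (k : ℕ) (r : ℤ) : (rotDiagram k r).flip = rotDiagram k (-r) := by
  refine AffineDiagram.ext' (fun u => ?_) rfl
  rcases u with x | x
  · exact congrArg Sum.inr (MarkedPt.ext (sub_eq_add_neg x.pos r))
  · exact congrArg Sum.inl (MarkedPt.ext (sub_neg_eq_add x.pos r).symm)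

/-! ### Composition with caps -/

section Cap

variable {l k : ℕ} {D : AffineDiagram l (k + 2)}

theorem conn_cap (u : MarkedPt l ⊕ MarkedPt k) :
    Conn (capDiagram k) D (bdPt l (k + 2) k u) (Sum.map id Sum.inl (Sum.map id (emb k) u)) := by
  rcases u with x | x
  · exact Linked.refl _
  · exact conn_outer (E := capDiagram k) (D := D) (Sum.inr x)

/-- A cap prolongs the live points straight to the outer boundary, so an arc of `D` whose ends are
inner or live is already a whole strand. -/
theorem cap_comp_mate {u w : MarkedPt l ⊕ MarkedPt k}
    (h : D.mate (Sum.map id (emb k) u) = Sum.map id (emb k) w) :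
    ((capDiagram k).comp D).mate u = w := by
  refine (compMate_unique _ _ (fun h' => ?_) ?_).symm
  · rw [h'] at h
    exact D.mate_ne _ h
  · refine (conn_cap u).trans (Linked.trans ?_ (conn_cap w).symm)
    rw [← h]
    exact conn_inner _

theorem deadPos_ne {k : ℕ} (p : ℤ) : deadPos k p ≠ p := by
  rw [deadPos]
  split_ifs <;> omega

theorem conn_dead {p : MarkedPt (k + 2)} (hp : ¬ p.pos % (k + 2 : ℕ) < k) :
    Conn (capDiagram k) D (midPt l (k + 2) k p) (midPt l (k + 2) k ⟨deadPos k p.pos, p.ne⟩) := by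
  have := conn_outer (E := capDiagram k) (D := D) (Sum.inl p)
  rwa [cap_dead hp] at this

/-- A strand that arrives at a dead point crosses the cap to the partner of this point and continues
along the arc of `D` that starts there. This is how zigzags are pulled straight. -/
theorem cap_comp_mate_of_dead {u w : MarkedPt l ⊕ MarkedPt k} {p : MarkedPt (k + 2)}
    (hp : ¬ p.pos % (k + 2 : ℕ) < k) (h : D.mate (Sum.map id (emb k) u) = Sum.inr p)
    (h' : D.mate (Sum.inr ⟨deadPos k p.pos, p.ne⟩) = Sum.map id (emb k) w) :
    ((capDiagram k).comp D).mate u = w := by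
  refine (compMate_unique _ _ (fun hw => ?_) ?_).symm
  · rw [hw] at h'
    have h2 := congrArg D.mate h
    rw [D.mate_mate, ← h'] at h2
    have h3 := congrArg D.mate h2
    rw [D.mate_mate, D.mate_mate] at h3
    exact deadPos_ne p.pos (congrArg MarkedPt.pos (Sum.inr_injective h3))
  · refine (conn_cap u).trans (Linked.trans ?_ (conn_cap w).symm)
    rw [← h']
    refine Linked.trans ?_ (conn_inner _)
    have h1 := conn_inner (E := capDiagram k) (D := D) (Sum.map id (emb k) u)
    rw [h] at h1
    exact h1.trans (conn_dead hp)

/-- Live points reach the boundary at once, so a closed strand could only visit dead points. It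
suffices that the strand through a dead point leaves them in one of its two directions. -/
theorem cap_comp_no_loops (h : ∀ p : MarkedPt (k + 2), ¬ p.pos % (k + 2 : ℕ) < k →
    ∃ u : MarkedPt l ⊕ MarkedPt k, D.mate (Sum.inr p) = Sum.map id (emb k) u ∨
      D.mate (Sum.inr ⟨deadPos k p.pos, p.ne⟩) = Sum.map id (emb k) u) :
    contractibleLoops (capDiagram k) D = 0 ∧ newLoops (capDiagram k) D = 0 := by
  refine loops_eq_zero_of_conn fun y => ?_
  rcases exists_emb_or k y with ⟨z, rfl⟩ | hy
  · exact ⟨Sum.inr z, (conn_cap (Sum.inr z)).symm⟩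
  · obtain ⟨u, hu | hu⟩ := h y hy
    · refine ⟨u, Linked.trans ?_ (conn_cap u).symm⟩
      rw [← hu]
      exact conn_inner (Sum.inr y)
    · refine ⟨u, Linked.trans ?_ (conn_cap u).symm⟩
      rw [← hu]
      exact (conn_dead hy).trans (conn_inner (Sum.inr _))

end Cap


/-! ### Relations between rotations, cups and caps -/

section Arcs

variable {l k : ℕ}

/-- The outer points at the positions `p` and `p + 1` are connected. -/
def HasArc (D : AffineDiagram l k) (p : ℤ) : Prop :=
  ∃ h : k ≠ 0, D.mate (Sum.inr ⟨p, h⟩) = Sum.inr ⟨p + 1, h⟩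

theorem HasArc.shift {D : AffineDiagram l k} {p : ℤ} (h : HasArc D p) (j : ℤ) :
    HasArc D (p + k * j) := by
  obtain ⟨hk, h⟩ := h
  refine ⟨hk, ?_⟩
  have := D.mate_vadd j (Sum.inr ⟨p, hk⟩)
  rw [h] at this
  refine this.trans (congrArg Sum.inr (MarkedPt.ext ?_))
  change p + 1 + k * j = p + k * j + 1
  ring

theorem HasArc.rot {D : AffineDiagram l k} {p : ℤ} (h : HasArc D p) (r : ℤ) :
    HasArc ((rotDiagram k r).comp D) (p + r) := by
  obtain ⟨hk, h⟩ := h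
  refine ⟨hk, ?_⟩
  rw [rot_comp_mate]
  have : (Sum.map id (movePt (-r)) (Sum.inr ⟨p + r, hk⟩) : MarkedPt l ⊕ MarkedPt k) =
      Sum.inr ⟨p, hk⟩ := congrArg Sum.inr (MarkedPt.ext (by simp [movePt]))
  rw [this, h]
  refine congrArg Sum.inr (MarkedPt.ext ?_)
  change p + 1 + r = p + r + 1
  ring

theorem hasArc_cup (D : AffineDiagram l k) : HasArc ((cupDiagram k).comp D) k := by
  refine ⟨by omega, comp_mate_of_outer ?_ D⟩
  have h : (k : ℤ) % (k + 2 : ℕ) = k := Int.emod_eq_of_lt (by omega) (by push_cast; omega)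
  rw [cup_dead (by simp only [h]; omega)]
  exact congrArg Sum.inr (MarkedPt.ext (if_pos h))

/-- The new points are inserted at the end of each domain; the bound `r + 1 < k` says that the arc
does not straddle two domains, hence stays an arc between neighbours. -/
theorem HasArc.cup {D : AffineDiagram l k} {q r : ℤ} (h : HasArc D (k * q + r))
    (h0 : 0 ≤ r) (h1 : r + 1 < k) : HasArc ((cupDiagram k).comp D) ((k + 2 : ℕ) * q + r) := by
  obtain ⟨hk, h⟩ := h
  refine ⟨by omega, ?_⟩
  have e1 : emb k ⟨k * q + r, hk⟩ = ⟨(k + 2 : ℕ) * q + r, by omega⟩ :=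
    MarkedPt.ext (embPos_of_eq rfl h0 (by omega))
  have e2 : emb k ⟨k * q + r + 1, hk⟩ = ⟨(k + 2 : ℕ) * q + r + 1, by omega⟩ := by
    refine MarkedPt.ext ((embPos_of_eq (q := q) (r := r + 1) ?_ (by omega) h1).trans ?_)
    · change (k : ℤ) * q + r + 1 = _
      ring
    · ring
  have := (cup_straight k).comp_mate D (Sum.inr ⟨k * q + r, hk⟩)
  rw [h] at this
  simp only [Sum.map_inr, e1, e2] at this
  exact this

/-- The two arcs would share the end point `p + 1`. -/
theorem HasArc.not_succ {D : AffineDiagram l k} {p : ℤ} (h : HasArc D p) : ¬ HasArc D (p + 1) := by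
  rintro ⟨hk, h'⟩
  obtain ⟨_, h⟩ := h
  have := D.mate_mate (Sum.inr ⟨p, hk⟩)
  rw [h, h'] at this
  have := congrArg MarkedPt.pos (Sum.inr_injective this)
  simp only at this
  omega

/-- Outer ends of arcs from the inner side are recovered from the inner ends, since `mate` is an
involution. Thus comparing composites only requires the inner points and a list of the short arcs
that cover the remaining outer points. -/
theorem eq_of_agree {D E : AffineDiagram l k} (h1 : ∀ x, D.mate (Sum.inl x) = E.mate (Sum.inl x))
    (h2 : ∀ y : MarkedPt k, (∃ x, D.mate (Sum.inl x) = Sum.inr y) ∨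
      ∃ p, HasArc D p ∧ HasArc E p ∧ (y.pos = p ∨ y.pos = p + 1))
    (h3 : D.loops = E.loops) : D = E := by
  refine AffineDiagram.ext' ?_ h3
  rintro (x | y)
  · exact h1 x
  · rcases h2 y with ⟨x, hx⟩ | ⟨p, ⟨_, hD⟩, ⟨_, hE⟩, hy⟩
    · rw [← hx, D.mate_mate, h1, E.mate_mate]
    · rcases hy with hy | hy
      · have hy' : y = ⟨p, y.ne⟩ := MarkedPt.ext hy
        rw [hy', hD, hE]
      · have hy' : y = ⟨p + 1, y.ne⟩ := MarkedPt.ext hy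
        rw [hy', ← hD, D.mate_mate, hD, ← hE, E.mate_mate]

theorem Straight.comp {m n : ℕ} {E : AffineDiagram m n} {D : AffineDiagram k m}
    {f : MarkedPt m → MarkedPt n} {g : MarkedPt k → MarkedPt m} (hf : Straight E f)
    (hg : Straight D g) : Straight (E.comp D) (f ∘ g) := fun x => by
  have := hf.comp_mate D (Sum.inl x)
  rwa [hg] at this

theorem emb_of_eq {q r : ℤ} {x : MarkedPt k} (h : x.pos = k * q + r) (h0 : 0 ≤ r) (h1 : r < k) :
    (emb k x).pos = (k + 2 : ℕ) * q + r := embPos_of_eq h h0 h1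

/-- A full rotation can be moved through a cup. -/
theorem rot_cup (k : ℕ) (j : ℤ) :
    (rotDiagram (k + 2) ((k + 2 : ℕ) * j)).comp (cupDiagram k) =
      (cupDiagram k).comp (rotDiagram k (k * j)) := by
  refine eq_of_agree (fun x => ?_) (fun y => ?_) 
    ((rot_comp_loops _ _).trans (cup_comp_loops (rotDiagram k (k * j))).symm)
  · rw [((rot_straight _ _).comp (cup_straight k)) x, ((cup_straight k).comp (rot_straight _ _)) x]
    exact congrArg Sum.inr (MarkedPt.ext (embPos_add x.ne _ _).symm)
  · obtain ⟨q, r, h, h0, h1⟩ := exists_div (k := k + 2) (by omega) y.pos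
    by_cases h2 : r < k
    -- The rotation by `(k + 2) * j` moves `j` whole domains, so a live point of domain `q` comes
    -- from domain `q - j`.
    · refine Or.inl ⟨⟨k * (q - j) + r, by omega⟩, ?_⟩
      rw [((rot_straight _ _).comp (cup_straight k)) _]
      refine congrArg Sum.inr (MarkedPt.ext ?_)
      change (emb k _).pos + _ = _
      rw [emb_of_eq rfl h0 h2, h]
      ring
    · refine Or.inr ⟨k + (k + 2 : ℕ) * q, ?_, (hasArc_cup _).shift _, ?_⟩
      · have h3 := ((hasArc_cup (idDiagram k)).rot ((k + 2 : ℕ) * j)).shift (q - j)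
        rw [AffineDiagram.comp_id] at h3
        convert h3 using 1
        ring
      · push_cast at h h1 ⊢
        rcases lt_or_eq_of_le (not_lt.1 h2) with h4 | h4
        · exact Or.inr (by rw [h, show r = k + 1 by omega]; ring)
        · exact Or.inl (by rw [h, ← h4]; ring)

/-- Two cups that are not nested commute. -/
theorem cup_rot_cup (k : ℕ) {m : ℤ} (h2 : 2 ≤ m) (hm : m ≤ k + 2) :
    (cupDiagram (k + 2)).comp ((rotDiagram (k + 2) m).comp
        ((cupDiagram k).comp (rotDiagram k (2 - m)))) =
      (rotDiagram (k + 2 + 2) m).comp ((cupDiagram (k + 2)).comp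
        ((rotDiagram (k + 2) (2 - m)).comp (cupDiagram k))) := by
  have hL := (cup_straight (k + 2)).comp ((rot_straight (k + 2) m).comp
        ((cup_straight k).comp (rot_straight k (2 - m))))
  have hR := (rot_straight (k + 2 + 2) m).comp ((cup_straight (k + 2)).comp
        ((rot_straight (k + 2) (2 - m)).comp (cup_straight k)))
  -- On both sides the cups end up at the residues `m - 2, m - 1` and `k + 2, k + 3` of a domain of
  -- length `k + 4`. An inner residue is kept if it is below `m - 2` and raised by two otherwise.
  have key : ∀ (x : MarkedPt k) (q r : ℤ), x.pos = k * q + r → 0 ≤ r → r < k →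
      (r + 2 - m < 0 →
        (emb (k + 2) (movePt m (emb k (movePt (2 - m) x)))).pos = (k + 2 + 2 : ℕ) * q + r ∧
        (movePt m (emb (k + 2) (movePt (2 - m) (emb k x)))).pos = (k + 2 + 2 : ℕ) * q + r) ∧
      (0 ≤ r + 2 - m →
        (emb (k + 2) (movePt m (emb k (movePt (2 - m) x)))).pos = (k + 2 + 2 : ℕ) * q + (r + 2) ∧
        (movePt m (emb (k + 2) (movePt (2 - m) (emb k x)))).pos = (k + 2 + 2 : ℕ) * q + (r + 2)) := by
    intro x q r h h0 h1
    have e1 : (emb k x).pos = (k + 2 : ℕ) * q + r := emb_of_eq h h0 h1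
    constructor
    · intro h3
      -- Turning by `2 - m` leaves the domain on the left: the point passes to domain `q - 1` and
      -- its residue grows by `k`.
      have e2 : (emb k (movePt (2 - m) x)).pos = (k + 2 : ℕ) * (q - 1) + (r + 2 - m + k) :=
        emb_of_eq (show x.pos + (2 - m) = _ by rw [h]; ring) (by omega) (by omega)
      have e3 : (emb (k + 2) (movePt (2 - m) (emb k x))).pos =
          (k + 2 + 2 : ℕ) * (q - 1) + (r + 2 - m + (k + 2)) :=
        emb_of_eq (show (emb k x).pos + (2 - m) = _ by rw [e1]; push_cast; ring) (by omega)
          (by push_cast; omega)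
      refine ⟨emb_of_eq (show (emb k _).pos + m = _ by rw [e2]; push_cast; ring) h0
        (by push_cast; omega), ?_⟩
      change (emb (k + 2) _).pos + m = _
      rw [e3]
      push_cast
      ring
    · intro h3
      have e2 : (emb k (movePt (2 - m) x)).pos = (k + 2 : ℕ) * q + (r + 2 - m) :=
        emb_of_eq (show x.pos + (2 - m) = _ by rw [h]; ring) (by omega) (by omega)
      have e3 : (emb (k + 2) (movePt (2 - m) (emb k x))).pos =
          (k + 2 + 2 : ℕ) * q + (r + 2 - m) :=
        emb_of_eq (show (emb k x).pos + (2 - m) = _ by rw [e1]; push_cast; ring) (by omega)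
          (by push_cast; omega)
      refine ⟨emb_of_eq (show (emb k _).pos + m = _ by rw [e2]; push_cast; ring) (by omega)
        (by push_cast; omega), ?_⟩
      change (emb (k + 2) _).pos + m = _
      rw [e3]
      push_cast
      ring
  refine eq_of_agree (fun x => ?_) (fun y => ?_) ?_
  · rw [hL x, hR x]
    refine congrArg Sum.inr (MarkedPt.ext ?_)
    obtain ⟨q, r, h, h0, h1⟩ := exists_div x.ne x.pos
    obtain ⟨k1, k2⟩ := key x q r h h0 h1
    rcases lt_or_ge (r + 2 - m) 0 with h3 | h3
    · exact (k1 h3).1.trans (k1 h3).2.symm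
    · exact (k2 h3).1.trans (k2 h3).2.symm
  · obtain ⟨q, r, h, h0, h1⟩ := exists_div (k := k + 2 + 2) (by omega) y.pos
    push_cast at h1
    by_cases c1 : r < m - 2
    · have hk : r < k := by omega
      refine Or.inl ⟨⟨k * q + r, by omega⟩, ?_⟩
      rw [hL]
      refine congrArg Sum.inr (MarkedPt.ext ?_)
      rw [h]
      exact ((key _ q r rfl h0 hk).1 (by omega)).1
    by_cases c2 : r < m
    · refine Or.inr ⟨(k + 2 + 2 : ℕ) * q + (m - 2), ?_, ?_, by omega⟩
      · refine HasArc.cup ?_ (by omega) (by push_cast; omega)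
        convert ((hasArc_cup (rotDiagram k (2 - m))).rot m).shift (q - 1) using 1
        push_cast
        ring
      · convert ((hasArc_cup ((rotDiagram (k + 2) (2 - m)).comp (cupDiagram k))).rot m).shift
          (q - 1) using 1
        push_cast
        ring
    by_cases c3 : r < k + 2
    · refine Or.inl ⟨⟨k * q + (r - 2), by omega⟩, ?_⟩
      rw [hL]
      refine congrArg Sum.inr (MarkedPt.ext ?_)
      rw [h]
      exact (((key ⟨k * q + (r - 2), by omega⟩ q (r - 2) rfl (by omega) (by omega)).2
        (by omega)).1).trans (by ring)
    · refine Or.inr ⟨(k + 2 + 2 : ℕ) * q + (k + 2), ?_, ?_, by omega⟩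
      · convert (hasArc_cup ((rotDiagram (k + 2) m).comp
          ((cupDiagram k).comp (rotDiagram k (2 - m))))).shift q using 1
        push_cast
        ring
      · have h3 := ((hasArc_cup (idDiagram k)).rot (2 - m)).shift q
        rw [AffineDiagram.comp_id] at h3
        have h4 : HasArc ((cupDiagram (k + 2)).comp ((rotDiagram (k + 2) (2 - m)).comp
            (cupDiagram k))) ((k + 2 + 2 : ℕ) * q + (k + 2 - m)) := by
          refine HasArc.cup ?_ (by omega) (by push_cast; omega)
          convert h3 using 1
          ring
        convert h4.rot m using 1
        ring
  · rw [cup_comp_loops, rot_comp_loops, cup_comp_loops, rot_comp_loops, cup_comp_loops,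
      rot_comp_loops]
    rfl

end Arcs


/-! ### Relations between a cap and a rotated cup -/

section CapRelations

variable {l k : ℕ}

theorem emb_eq {q r : ℤ} {x : MarkedPt k} {y : MarkedPt (k + 2)} (h : x.pos = k * q + r)
    (h0 : 0 ≤ r) (h1 : r < k) (h2 : y.pos = (k + 2 : ℕ) * q + r) : y = emb k x :=
  MarkedPt.ext (h2.trans (emb_of_eq h h0 h1).symm)

/-- The two last points of a fundamental domain. -/
theorem dead_cases {p : MarkedPt (k + 2)} (hp : ¬ p.pos % (k + 2 : ℕ) < k) :
    ∃ q : ℤ, (p.pos = (k + 2 : ℕ) * q + k ∧ deadPos k p.pos = (k + 2 : ℕ) * q + k + 1) ∨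
      (p.pos = (k + 2 : ℕ) * q + k + 1 ∧ deadPos k p.pos = (k + 2 : ℕ) * q + k) := by
  refine ⟨p.pos / (k + 2 : ℕ), ?_⟩
  have h := Int.mul_ediv_add_emod p.pos (k + 2 : ℕ)
  rcases deadPos_cases hp with ⟨h1, h2, -, -⟩ | ⟨h1, h2, -, -⟩
  · exact Or.inl ⟨by omega, by omega⟩
  · exact Or.inr ⟨by omega, by omega⟩

theorem dead_of_eq {p q : ℤ} (h : p = (k + 2 : ℕ) * q + k) :
    ¬ p % (k + 2 : ℕ) < k ∧ deadPos k p = p + 1 := by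
  have h1 : p % (k + 2 : ℕ) = k := emod_of_eq h (by omega) (by push_cast; omega)
  exact ⟨by omega, if_pos h1⟩

theorem HasArc.mate {D : AffineDiagram l k} {p : ℤ} (h : HasArc D p) {x : MarkedPt k}
    (hx : x.pos = p) : D.mate (Sum.inr x) = Sum.inr ⟨p + 1, x.ne⟩ := by
  obtain ⟨_, h⟩ := h
  rw [show x = ⟨p, x.ne⟩ from MarkedPt.ext hx, h]

theorem HasArc.mate' {D : AffineDiagram l k} {p : ℤ} (h : HasArc D p) {x : MarkedPt k}
    (hx : x.pos = p + 1) : D.mate (Sum.inr x) = Sum.inr ⟨p, x.ne⟩ := by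
  obtain ⟨_, h⟩ := h
  rw [show x = ⟨p + 1, x.ne⟩ from MarkedPt.ext hx, ← h, D.mate_mate]

theorem HasArc.of_mate {D : AffineDiagram l k} {x y : MarkedPt k}
    (h : D.mate (Sum.inr x) = Sum.inr y) (hxy : y.pos = x.pos + 1) : HasArc D x.pos :=
  ⟨x.ne, by rw [show (⟨x.pos, x.ne⟩ : MarkedPt k) = x from rfl, h]; exact congrArg Sum.inr (MarkedPt.ext hxy)⟩

/-! #### An arc between the two last outer points -/

variable {D : AffineDiagram l (k + 2)}

theorem HasArc.mate_dead (h : HasArc D k) {p : MarkedPt (k + 2)}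
    (hp : ¬ p.pos % (k + 2 : ℕ) < k) : D.mate (Sum.inr p) = Sum.inr ⟨deadPos k p.pos, p.ne⟩ := by
  obtain ⟨q, ⟨h1, h2⟩ | ⟨h1, h2⟩⟩ := dead_cases hp
  · rw [(h.shift q).mate (h1.trans (by ring))]
    exact congrArg Sum.inr (MarkedPt.ext (by simp only [h2]; ring))
  · rw [(h.shift q).mate' (h1.trans (by ring))]
    exact congrArg Sum.inr (MarkedPt.ext (by simp only [h2]; ring))

/-- The arc of `D` and the arc of the cap join the same two dead points, so together they close up
and the component is just this pair. -/
theorem HasArc.conn_dead (h : HasArc D k) {p : MarkedPt (k + 2)}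
    (hp : ¬ p.pos % (k + 2 : ℕ) < k) {w : GluePt l (k + 2) k}
    (hw : Conn (capDiagram k) D (midPt l (k + 2) k p) w) :
    w = midPt l (k + 2) k p ∨ w = midPt l (k + 2) k ⟨deadPos k p.pos, p.ne⟩ := by
  have hp' : ¬ (⟨deadPos k p.pos, p.ne⟩ : MarkedPt (k + 2)).pos % (k + 2 : ℕ) < k ∧
      deadPos k (deadPos k p.pos) = p.pos := by
    rcases deadPos_cases hp with ⟨-, h1, h2, h3⟩ | ⟨-, h1, h2, h3⟩
    · simp only [h1, h2, h3]
      exact ⟨by omega, trivial⟩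
    · simp only [h1, h2, h3]
      exact ⟨by omega, trivial⟩
  refine Linked.induct (innerStep_involutive D) (outerStep_involutive (capDiagram k))
    (P := fun w => w = midPt l (k + 2) k p ∨ w = midPt l (k + 2) k ⟨deadPos k p.pos, p.ne⟩) ?_ ?_
    hw (Or.inl rfl)
  · rintro _ (rfl | rfl)
    · right
      change Sum.map id Sum.inl (D.mate (Sum.inr p)) = _
      rw [h.mate_dead hp]
      rfl
    · left
      change Sum.map id Sum.inl (D.mate (Sum.inr _)) = _
      rw [h.mate_dead hp'.1]
      exact congrArg (fun x => Sum.inr (Sum.inl x)) (MarkedPt.ext hp'.2)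
  · rintro _ (rfl | rfl)
    · right
      change Sum.inr ((capDiagram k).mate (Sum.inl p)) = _
      rw [cap_dead hp]
      rfl
    · left
      change Sum.inr ((capDiagram k).mate (Sum.inl _)) = _
      rw [cap_dead hp'.1]
      exact congrArg (fun x => Sum.inr (Sum.inl x)) (MarkedPt.ext hp'.2)

/-- The closed strands are the pairs of dead points. The two points of a pair have different
residues, so neither is a nontrivial shift of the other and the loop is contractible. -/
theorem HasArc.onContractible (h : HasArc D k) (p : MarkedPt (k + 2)) :
    OnContractible (capDiagram k) D p ↔ ¬ p.pos % (k + 2 : ℕ) < k := by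
  constructor
  · rintro h1 h2
    obtain ⟨y, rfl⟩ := exists_emb h2
    exact h1.1 (Sum.inr y) (conn_cap (Sum.inr y)).symm
  · intro hp
    refine ⟨fun b hb => ?_, fun j hj hb => ?_⟩
    · rcases h.conn_dead hp hb with h1 | h1 <;> rcases b with b | b <;> cases h1
    · rcases h.conn_dead hp hb with h1 | h1
      · exact hj (freeShift_markedPt _ _ _ (Sum.inl_injective (Sum.inr_injective h1)))
      · have h2 : p.pos + (k + 2 : ℕ) * j = deadPos k p.pos :=
          congrArg MarkedPt.pos (Sum.inl_injective (Sum.inr_injective h1))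
        have h3 : (p.pos + (k + 2 : ℕ) * j) % (k + 2 : ℕ) = p.pos % (k + 2 : ℕ) :=
          Int.add_mul_emod_self_left _ _ _
        rw [h2] at h3
        rcases deadPos_cases hp with ⟨h4, h5, h6, -⟩ | ⟨h4, h5, h6, -⟩
        · rw [h5, h6, h4] at h3
          omega
        · rw [h5, h6, h4] at h3
          omega

theorem HasArc.newLoops_cap (h : HasArc D k) : newLoops (capDiagram k) D = 0 := by
  by_contra h0
  obtain ⟨p, hp⟩ := exists_newLoop _ _ h0
  have hp1 := hp.closed
  obtain ⟨j, hj, hp⟩ := hp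
  by_cases h2 : p.pos % (k + 2 : ℕ) < k
  · obtain ⟨y, rfl⟩ := exists_emb h2
    exact hp1 (Sum.inr y) (conn_cap (Sum.inr y)).symm
  · exact ((h.onContractible p).2 h2).2 j hj hp

/-- All pairs of dead points are shifts of one another, so on the annulus they form a single loop.
-/
theorem HasArc.contractibleLoops_cap (h : HasArc D k) : contractibleLoops (capDiagram k) D = 1 := by
  rw [contractibleLoops, Nat.card_eq_one_iff_unique]
  constructor
  · have key : ∀ y z : {y // OnContractible (capDiagram k) D y},
        SameStrand (capDiagram k) D y.1 z.1 := by
      rintro ⟨y, hy⟩ ⟨z, hz⟩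
      rw [h.onContractible] at hy hz
      obtain ⟨a, ha⟩ := dead_cases hy
      obtain ⟨b, hb⟩ := dead_cases hz
      refine ⟨a - b, ?_⟩
      have hy2 := ATL.conn_dead (D := D) hy
      have hk : ((k + 2 : ℕ) : ℤ) * (a - b) = (k + 2 : ℕ) * a - (k + 2 : ℕ) * b := by ring
      have cases2 : (a - b) +ᵥ z = y ∨ (a - b) +ᵥ z = ⟨deadPos k y.pos, y.ne⟩ := by
        rcases ha with ha | ha <;> rcases hb with hb | hb
        · exact Or.inl (MarkedPt.ext (by rw [MarkedPt.vadd_pos, hk]; omega))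
        · refine Or.inr (MarkedPt.ext ?_)
          rw [MarkedPt.vadd_pos, hk]
          simp only
          omega
        · refine Or.inr (MarkedPt.ext ?_)
          rw [MarkedPt.vadd_pos, hk]
          simp only
          omega
        · exact Or.inl (MarkedPt.ext (by rw [MarkedPt.vadd_pos, hk]; omega))
      rcases cases2 with h1 | h1
      · simp only [h1]
        exact Linked.refl _
      · simp only [h1]
        exact hy2
    exact ⟨fun a b => Quot.induction_on₂ a b fun y z => Quot.sound (key y z)⟩
  · exact ⟨Quot.mk _ ⟨⟨k, by omega⟩, (h.onContractible _).2 (dead_of_eq (q := 0) (by simp)).1⟩⟩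

/-- Dead points are paired among themselves, which leaves no dead partner for a live point. -/
theorem HasArc.alive_of_mate (h : HasArc D k) {u v : MarkedPt l ⊕ MarkedPt (k + 2)}
    (hv : D.mate u = v) (hu : ∃ w, u = Sum.map id (emb k) w) : ∃ w, v = Sum.map id (emb k) w := by
  rcases v with x | y
  · exact ⟨Sum.inl x, rfl⟩
  · rcases exists_emb_or k y with ⟨z, rfl⟩ | hy
    · exact ⟨Sum.inr z, rfl⟩
    · exfalso
      have h1 := congrArg D.mate hv
      rw [D.mate_mate, h.mate_dead hy] at h1
      obtain ⟨w, rfl⟩ := hu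
      rcases w with w | w
      · cases h1
      · have h2 := emb_alive w
        rw [Sum.inr_injective h1] at h2
        rcases deadPos_cases hy with ⟨-, h3, h4, -⟩ | ⟨-, h3, h4, -⟩
        · simp only [h3, h4] at h2
          omega
        · simp only [h3, h4] at h2
          omega

/-- A diagram with an arc between the two last outer points factors through a cup. -/
theorem HasArc.cup_cap (h : HasArc D k) : (cupDiagram k).comp ((capDiagram k).comp D) = D := by
  have key : ∀ u : MarkedPt l ⊕ MarkedPt k, ((cupDiagram k).comp ((capDiagram k).comp D)).mate
      (Sum.map id (emb k) u) = D.mate (Sum.map id (emb k) u) := by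
    intro u
    obtain ⟨w, hw⟩ := h.alive_of_mate rfl ⟨u, rfl⟩
    rw [(cup_straight k).comp_mate, cap_comp_mate hw, hw]
  refine AffineDiagram.ext' ?_ ?_
  · rintro (x | y)
    · exact key (Sum.inl x)
    · rcases exists_emb_or k y with ⟨z, rfl⟩ | hy
      · exact key (Sum.inr z)
      · rw [(hasArc_cup _).mate_dead hy, h.mate_dead hy]
  · rw [cup_comp_loops, AffineDiagram.comp_loops, h.newLoops_cap]
    rfl

/-- Here `comp` drops the contractible loop that arises; its weight is accounted for separately by
`contractibleLoops_cap`. On the level of diagrams a cup therefore has a left inverse. -/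
theorem cap_cup_comp (D : AffineDiagram l k) :
    (capDiagram k).comp ((cupDiagram k).comp D) = D := by
  refine AffineDiagram.ext' (fun u => ?_) ?_
  · exact cap_comp_mate ((cup_straight k).comp_mate D u)
  · rw [AffineDiagram.comp_loops, (hasArc_cup D).newLoops_cap, cup_comp_loops]
    rfl

theorem cap_cup (k : ℕ) : (capDiagram k).comp (cupDiagram k) = idDiagram k := by
  have := cap_cup_comp (idDiagram k)
  rwa [AffineDiagram.comp_id] at this

theorem cup_injective {D E : AffineDiagram l k}
    (h : (cupDiagram k).comp D = (cupDiagram k).comp E) : D = E := by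
  rw [← cap_cup_comp D, h, cap_cup_comp]

/-! #### Caps and cups in neighbouring positions -/

theorem rot_cup_arc (k : ℕ) (m q : ℤ) :
    HasArc ((rotDiagram (k + 2) m).comp (cupDiagram k)) (k + m + (k + 2 : ℕ) * q) := by
  have h := ((hasArc_cup (idDiagram k)).rot m).shift q
  rwa [AffineDiagram.comp_id] at h

/-- After the turn by one the arc of the cup joins the last point of a domain to the first point of
the next domain. The latter is live because `k ≠ 0`, so every strand escapes through it. -/
theorem cap_rot_cup_one_loops (hk : k ≠ 0) :
    contractibleLoops (capDiagram k) ((rotDiagram (k + 2) 1).comp (cupDiagram k)) = 0 ∧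
      newLoops (capDiagram k) ((rotDiagram (k + 2) 1).comp (cupDiagram k)) = 0 := by
  refine cap_comp_no_loops fun p hp => ?_
  obtain ⟨q, h⟩ := dead_cases hp
  have h0 : ∀ x : MarkedPt (k + 2), x.pos = (k + 2 : ℕ) * q + k + 1 →
      ((rotDiagram (k + 2) 1).comp (cupDiagram k)).mate (Sum.inr x) =
        Sum.map id (emb k) (Sum.inr ⟨k * (q + 1) + 0, hk⟩) := by
    intro x hx
    rw [(rot_cup_arc k 1 q).mate (by rw [hx]; ring)]
    refine congrArg Sum.inr (emb_eq rfl le_rfl (by omega) ?_)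
    simp only
    push_cast
    ring
  refine ⟨Sum.inr ⟨k * (q + 1) + 0, hk⟩, ?_⟩
  rcases h with h | h
  · exact Or.inr (h0 _ h.2)
  · exact Or.inl (h0 _ h.1)

/-- Cap and cup overlap in one point and form a zigzag; pulling it straight leaves all `k` strands
turned by one place. -/
theorem cap_rot_cup_one (hk : k ≠ 0) :
    (capDiagram k).comp ((rotDiagram (k + 2) 1).comp (cupDiagram k)) = rotDiagram k 1 := by
  have hS := (rot_straight (k + 2) 1).comp (cup_straight k)
  refine eq_of_agree (D := rotDiagram k 1) (fun x => ?_) (fun y => ?_) ?_ |>.symm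
  · symm
    obtain ⟨q, r, h, h0, h1⟩ := exists_div x.ne x.pos
    have e1 := emb_of_eq h h0 h1
    by_cases h2 : r + 1 < k
    · refine cap_comp_mate ?_
      refine (hS x).trans (congrArg Sum.inr (emb_eq (q := q) (r := r + 1) ?_ (by omega) h2 ?_))
      · change x.pos + 1 = _
        rw [h]
        ring
      · change (emb k x).pos + 1 = _
        rw [e1]
        ring
    -- Now `r = k - 1`: the strand is turned onto the dead residue `k`, crosses the cap to `k + 1`
    -- and follows the arc of the cup to residue `0` of the next domain.
    · have h3 : (emb k x).pos + 1 = (k + 2 : ℕ) * q + k := by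
        rw [e1, show r = k - 1 by omega]
        ring
      obtain ⟨h4, h5⟩ := dead_of_eq h3
      refine cap_comp_mate_of_dead (u := Sum.inl x) (w := Sum.inr (movePt 1 x))
        (p := movePt 1 (emb k x)) h4 (hS x) ?_
      have h6 : deadPos k (movePt 1 (emb k x)).pos = k + 1 + (k + 2 : ℕ) * q := by
        change deadPos k ((emb k x).pos + 1) = _
        rw [h5, h3]
        ring
      rw [(rot_cup_arc k 1 q).mate h6]
      refine congrArg Sum.inr (emb_eq (q := q + 1) (r := 0) ?_ le_rfl (by omega) ?_)
      · change x.pos + 1 = _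
        rw [h, show r = k - 1 by omega]
        ring
      · change (k : ℤ) + 1 + (k + 2 : ℕ) * q + 1 = _
        push_cast
        ring
  · exact Or.inl ⟨movePt (-1) y, congrArg Sum.inr (MarkedPt.ext (show y.pos + -1 + 1 = _ by ring))⟩
  · rw [AffineDiagram.comp_loops, (cap_rot_cup_one_loops hk).2, rot_comp_loops]
    rfl

theorem cap_flip (k : ℕ) : (capDiagram k).flip = cupDiagram k := AffineDiagram.flip_flip _

theorem cap_rot_cup_neg_one (hk : k ≠ 0) :
    (capDiagram k).comp ((rotDiagram (k + 2) (-1)).comp (cupDiagram k)) = rotDiagram k (-1) := by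
  have h := congrArg AffineDiagram.flip (cap_rot_cup_one hk)
  rw [AffineDiagram.flip_comp, AffineDiagram.flip_comp, rot_flip, rot_flip, cap_flip] at h
  rw [AffineDiagram.comp_assoc]
  exact h

theorem cap_rot_cup_neg_one_loops (hk : k ≠ 0) :
    contractibleLoops (capDiagram k) ((rotDiagram (k + 2) (-1)).comp (cupDiagram k)) = 0 := by
  refine (cap_comp_no_loops fun p hp => ?_).1
  obtain ⟨q, h⟩ := dead_cases hp
  have h0 : ∀ x : MarkedPt (k + 2), x.pos = (k + 2 : ℕ) * q + k →
      ((rotDiagram (k + 2) (-1)).comp (cupDiagram k)).mate (Sum.inr x) =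
        Sum.map id (emb k) (Sum.inr ⟨k * q + (k - 1), hk⟩) := by
    intro x hx
    rw [(rot_cup_arc k (-1) q).mate' (by rw [hx]; ring)]
    refine congrArg Sum.inr (emb_eq rfl (by omega) (by omega) ?_)
    simp only
    push_cast
    ring
  refine ⟨Sum.inr ⟨k * q + (k - 1), hk⟩, ?_⟩
  rcases h with h | h
  · exact Or.inl (h0 _ h.1)
  · exact Or.inr (h0 _ h.2)

/-- With two points in each domain, the cap joins `2 * q` to `2 * q + 1` and the turned cup joins `2
* q + 1` to `2 * q + 2`. The lifted strand runs through all integers: it is the noncontractible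
loop. -/
theorem conn_zero (p : MarkedPt 2) (n : ℕ) :
    Conn (capDiagram 0) ((rotDiagram 2 1).comp (cupDiagram 0)) (midPt 0 2 0 p)
      (midPt 0 2 0 (movePt n p)) := by
  induction n with
  | zero =>
    rw [show movePt ((0 : ℕ) : ℤ) p = p from MarkedPt.ext (by simp [movePt])]
    exact Linked.refl _
  | succ n ih =>
    refine ih.trans ?_
    set x := movePt (n : ℤ) p with hx
    have hx' : movePt ((n + 1 : ℕ) : ℤ) p = ⟨x.pos + 1, x.ne⟩ := by
      refine MarkedPt.ext ?_
      simp only [hx, movePt]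
      push_cast
      ring
    rw [hx']
    have hp : ¬ x.pos % (0 + 2 : ℕ) < (0 : ℕ) := by omega
    obtain ⟨q, h | h⟩ := dead_cases (k := 0) hp
    · have := conn_dead (k := 0) (D := (rotDiagram 2 1).comp (cupDiagram 0)) hp
      rwa [show (⟨deadPos 0 x.pos, x.ne⟩ : MarkedPt 2) = ⟨x.pos + 1, x.ne⟩ from
        MarkedPt.ext (h.2.trans (by rw [h.1]))] at this
    · have := conn_inner (E := capDiagram 0) (D := (rotDiagram 2 1).comp (cupDiagram 0))
        (Sum.inr x)
      have h2 : x.pos = ((0 : ℕ) : ℤ) + 1 + ((0 + 2 : ℕ) : ℤ) * q := by rw [h.1]; push_cast; ring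
      rw [(rot_cup_arc 0 1 q).mate h2, ← h2] at this
      exact this

theorem cap_rot_cup_zero_loops :
    contractibleLoops (capDiagram 0) ((rotDiagram 2 1).comp (cupDiagram 0)) = 0 ∧
      newLoops (capDiagram 0) ((rotDiagram 2 1).comp (cupDiagram 0)) = 1 := by
  have h1 : ∀ p : MarkedPt 2, (1 : ℤ) +ᵥ p = movePt ((2 : ℕ) : ℤ) p := fun p => MarkedPt.ext rfl
  constructor
  · have : IsEmpty (Quot fun y z : {y // OnContractible (capDiagram 0)
        ((rotDiagram 2 1).comp (cupDiagram 0)) y} => SameStrand (capDiagram 0)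
        ((rotDiagram 2 1).comp (cupDiagram 0)) y.1 z.1) := by
      refine ⟨fun q => q.inductionOn fun y => y.2.2 1 one_ne_zero ?_⟩
      rw [h1]
      exact conn_zero _ _
    exact Nat.card_of_isEmpty
  · rw [newLoops, Nat.card_eq_one_iff_unique]
    constructor
    · refine ⟨fun a b => Quot.induction_on₂ a b fun y z => Quot.sound ⟨0, ?_⟩⟩
      rw [zero_vadd]
      rcases le_total y.1.pos z.1.pos with h | h
      · obtain ⟨n, hn⟩ := Int.eq_ofNat_of_zero_le (sub_nonneg.2 h)
        have := conn_zero y.1 n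
        rwa [show movePt (n : ℤ) y.1 = z.1 from MarkedPt.ext (by simp only [movePt]; omega)] at this
      · obtain ⟨n, hn⟩ := Int.eq_ofNat_of_zero_le (sub_nonneg.2 h)
        have := conn_zero z.1 n
        rw [show movePt (n : ℤ) z.1 = y.1 from MarkedPt.ext (by simp only [movePt]; omega)] at this
        exact this.symm
    · refine ⟨Quot.mk _ ⟨⟨0, by omega⟩, 1, one_ne_zero, ?_⟩⟩
      rw [h1]
      exact conn_zero _ _

theorem cap_rot_cup_zero :
    (capDiagram 0).comp ((rotDiagram 2 1).comp (cupDiagram 0)) = loopDiagram := by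
  refine AffineDiagram.ext' ?_ ?_
  · rintro (x | x) <;> exact (x.ne rfl).elim
  · rw [AffineDiagram.comp_loops, cap_rot_cup_zero_loops.2, rot_comp_loops]
    rfl

end CapRelations


theorem Straight.mate_inr {k m : ℕ} {D : AffineDiagram k m} {f : MarkedPt k → MarkedPt m}
    (hf : Straight D f) (x : MarkedPt k) : D.mate (Sum.inr (f x)) = Sum.inl x := by
  rw [← hf, D.mate_mate]

theorem comp_rot_loops {k n : ℕ} (E : AffineDiagram k n) (r : ℤ) :
    contractibleLoops E (rotDiagram k r) = 0 ∧ newLoops E (rotDiagram k r) = 0 := by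
  rw [← contractibleLoops_flip, ← newLoops_flip, rot_flip]
  exact (rot_straight k (-r)).loops E.flip

theorem comp_cap_loops {k n : ℕ} (E : AffineDiagram k n) :
    contractibleLoops E (capDiagram k) = 0 ∧ newLoops E (capDiagram k) = 0 := by
  rw [← contractibleLoops_flip, ← newLoops_flip, cap_flip]
  exact (cup_straight k).loops E.flip

section

variable (k : ℕ) {m : ℤ} (h2 : 2 ≤ m) (hm : m ≤ k + 2)
include h2 hm

/-- Under these bounds the cap and the cup have no point in common, so every dead point of the cap
is joined to an inner point. -/
theorem cap_rot_cup_loops :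
    contractibleLoops (capDiagram (k + 2)) ((rotDiagram (k + 2 + 2) m).comp (cupDiagram (k + 2))) = 0 ∧
      newLoops (capDiagram (k + 2)) ((rotDiagram (k + 2 + 2) m).comp (cupDiagram (k + 2))) = 0 := by
  have hS := (rot_straight (k + 2 + 2) m).comp (cup_straight (k + 2))
  refine cap_comp_no_loops fun p hp => ?_
  obtain ⟨q, h⟩ := dead_cases hp
  -- Turned back by `m`, the dead residues `k + 2` and `k + 3` become `k + 2 - m` and `k + 3 - m`,
  -- which are live for the cup.
  have h0 : ∃ r, p.pos - m = (k + 2 + 2 : ℕ) * q + r ∧ 0 ≤ r ∧ r < (k + 2 : ℕ) := by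
    rcases h with h | h
    · exact ⟨k + 2 - m, by rw [h.1]; push_cast; ring, by omega, by push_cast; omega⟩
    · exact ⟨k + 3 - m, by rw [h.1]; push_cast; ring, by omega, by push_cast; omega⟩
  obtain ⟨r, h1, h3, h4⟩ := h0
  refine ⟨Sum.inl ⟨(k + 2 : ℕ) * q + r, by omega⟩, Or.inl ?_⟩
  rw [Sum.map_inl, ← hS.mate_inr]
  refine congrArg _ (congrArg Sum.inr (MarkedPt.ext ?_))
  change _ = (emb (k + 2) _).pos + m
  rw [emb_of_eq rfl h3 h4]
  omega

/-- A cap far away from a cup can be moved to the other side of the cup. -/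
theorem cap_rot_cup :
    (capDiagram (k + 2)).comp ((rotDiagram (k + 2 + 2) m).comp (cupDiagram (k + 2))) =
      (rotDiagram (k + 2) m).comp ((cupDiagram k).comp ((rotDiagram k (2 - m)).comp
        ((capDiagram k).comp (rotDiagram (k + 2) (m - 2))))) := by
  set L := (capDiagram (k + 2)).comp ((rotDiagram (k + 2 + 2) m).comp (cupDiagram (k + 2))) with hL
  set Z := (capDiagram k).comp (rotDiagram (k + 2) (m - 2)) with hZ
  set R := (rotDiagram (k + 2) m).comp ((cupDiagram k).comp ((rotDiagram k (2 - m)).comp Z)) with hR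
  have hS := (rot_straight (k + 2 + 2) m).comp (cup_straight (k + 2))
  have hT := (rot_straight (k + 2) m).comp ((cup_straight k).comp (rot_straight k (2 - m)))
  have hRZ : R = ((rotDiagram (k + 2) m).comp ((cupDiagram k).comp (rotDiagram k (2 - m)))).comp Z := by
    simp only [hR, ← AffineDiagram.comp_assoc]
  -- A strand from `x` to `w` followed along both sides: on the left, `(q, r)` are the coordinates
  -- of `x` and `(q', r')` those of `w`; on the right, `z` is the point reached through the cap,
  -- with coordinates `(a, b)`, and `(c, d)` are those after the turn by `2 - m`.
  have key : ∀ (x w : MarkedPt (k + 2)) (z : MarkedPt k) (q r : ℤ) (q' r' : ℤ),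
      x.pos = (k + 2 : ℕ) * q + r → 0 ≤ r → r < (k + 2 : ℕ) →
      (k + 2 + 2 : ℕ) * q + r + m = (k + 2 + 2 : ℕ) * q' + r' → 0 ≤ r' → r' < (k + 2 : ℕ) →
      w.pos = (k + 2 : ℕ) * q' + r' → ∀ (a b : ℤ), z.pos = k * a + b → 0 ≤ b → b < k →
      x.pos + (m - 2) = (k + 2 : ℕ) * a + b → ∀ (c d : ℤ), z.pos + (2 - m) = k * c + d → 0 ≤ d → d < k →
      w.pos = (k + 2 : ℕ) * c + d + m →
      L.mate (Sum.inl x) = Sum.inr w ∧ R.mate (Sum.inl x) = Sum.inr w := by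
    intro x w z q r q' r' h h0 h1 h' h0' h1' hw a b hz hb0 hb1 hx c d hz' hd0 hd1 hw'
    constructor
    · refine cap_comp_mate ((hS x).trans (congrArg Sum.inr (emb_eq hw h0' h1' ?_)))
      change (emb (k + 2) x).pos + m = _
      rw [emb_of_eq h h0 h1, h']
    · have h3 : Z.mate (Sum.inl x) = Sum.inr z :=
        cap_comp_mate (congrArg Sum.inr (emb_eq hz hb0 hb1 hx))
      rw [hRZ]
      have h4 := hT.comp_mate Z (Sum.inl x)
      rw [h3] at h4
      refine h4.trans (congrArg Sum.inr (MarkedPt.ext ?_))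
      change (emb k (movePt (2 - m) z)).pos + m = _
      rw [emb_of_eq hz' hd0 hd1, hw']
  -- The transported cap joins the inner residues `k + 2 - m` and `k + 3 - m` (`key3`). Strands
  -- starting before it advance by `m` (`key1`), those starting after it by `m - 2` (`key2`).
  have key1 : ∀ (x : MarkedPt (k + 2)) (q r : ℤ), x.pos = (k + 2 : ℕ) * q + r → 0 ≤ r →
      r < k + 2 - m → L.mate (Sum.inl x) = Sum.inr (movePt m x) ∧
        R.mate (Sum.inl x) = Sum.inr (movePt m x) := by
    intro x q r h h0 h1
    refine key x _ ⟨k * q + (r + m - 2), by omega⟩ q r q (r + m) h h0 (by push_cast; omega) (by ring)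
      (by omega) (by push_cast; omega) ?_ q (r + m - 2) rfl (by omega) (by omega) (by rw [h]; ring)
      q r ?_ h0 (by omega) ?_
    · change x.pos + m = _
      rw [h]
      ring
    · simp only
      ring
    · change x.pos + m = _
      rw [h]
  have key2 : ∀ (x : MarkedPt (k + 2)) (q r : ℤ), x.pos = (k + 2 : ℕ) * q + r → r < k + 2 →
      k + 4 - m ≤ r → L.mate (Sum.inl x) = Sum.inr (movePt (m - 2) x) ∧
        R.mate (Sum.inl x) = Sum.inr (movePt (m - 2) x) := by
    intro x q r h h0 h1
    refine key x _ ⟨k * (q + 1) + (r + m - 4 - k), by omega⟩ q r (q + 1) (r + m - k - 4) h (by omega)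
      (by push_cast; omega) (by push_cast; ring)
      (by omega) (by push_cast; omega) ?_ (q + 1) (r + m - 4 - k) rfl (by omega) (by omega)
      (by rw [h]; push_cast; ring) q (r - 2) ?_ (by omega) (by omega) ?_
    · change x.pos + (m - 2) = _
      rw [h]
      push_cast
      ring
    · simp only
      ring
    · change x.pos + (m - 2) = _
      rw [h]
      ring
  have key3 : ∀ (x y : MarkedPt (k + 2)) (q : ℤ), x.pos = (k + 2 : ℕ) * q + (k + 2 - m) →
      y.pos = x.pos + 1 → L.mate (Sum.inl x) = Sum.inl y ∧ R.mate (Sum.inl x) = Sum.inl y := by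
    intro x y q h hy
    have e1 : (emb (k + 2) x).pos = _ := emb_of_eq h (by omega) (by push_cast; omega)
    have e2 : (emb (k + 2) y).pos = _ := emb_of_eq (q := q) (r := k + 3 - m) (by rw [hy, h]; ring)
      (by omega) (by push_cast; omega)
    constructor
    · have h3 : (movePt m (emb (k + 2) x)).pos = (k + 2 + 2 : ℕ) * q + (k + 2 : ℕ) := by
        change (emb (k + 2) x).pos + m = _
        rw [e1]
        push_cast
        ring
      obtain ⟨h4, h5⟩ := dead_of_eq h3
      refine cap_comp_mate_of_dead (u := Sum.inl x) (w := Sum.inl y) h4 (hS x) ?_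
      rw [Sum.map_inl, id, ← hS.mate_inr]
      refine congrArg _ (congrArg Sum.inr (MarkedPt.ext ?_))
      refine h5.trans ?_
      rw [h3]
      change _ = (emb (k + 2) y).pos + m
      rw [e2]
      push_cast
      ring
    · have h3 : (movePt (m - 2) x).pos = (k + 2 : ℕ) * q + k := by
        change x.pos + (m - 2) = _
        rw [h]
        ring
      obtain ⟨h4, h5⟩ := dead_of_eq h3
      have h6 : Z.mate (Sum.inl x) = Sum.inl y := by
        refine cap_comp_mate_of_dead (u := Sum.inl x) (w := Sum.inl y) h4 rfl ?_
        rw [Sum.map_inl, id, ← (rot_straight (k + 2) (m - 2)).mate_inr]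
        refine congrArg _ (congrArg Sum.inr (MarkedPt.ext ?_))
        refine h5.trans ?_
        rw [h3]
        change _ = y.pos + (m - 2)
        rw [hy, h]
        ring
      rw [hRZ]
      have h7 := hT.comp_mate Z (Sum.inl x)
      rw [h6] at h7
      exact h7
  refine eq_of_agree (fun x => ?_) (fun y => ?_) ?_
  · obtain ⟨q, r, h, h0, h1⟩ := exists_div x.ne x.pos
    push_cast at h1
    by_cases c1 : r < k + 2 - m
    · obtain ⟨h3, h4⟩ := key1 x q r h h0 c1
      rw [h3, h4]
    by_cases c2 : k + 4 - m ≤ r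
    · obtain ⟨h3, h4⟩ := key2 x q r h h1 c2
      rw [h3, h4]
    by_cases c3 : r = k + 2 - m
    · obtain ⟨h3, h4⟩ := key3 x (movePt 1 x) q (by rw [h, c3]) rfl
      rw [h3, h4]
    · obtain ⟨h3, h4⟩ := key3 (movePt (-1) x) x q
        (show x.pos + -1 = _ by rw [h, show r = k + 3 - m by omega]; ring)
        (show x.pos = x.pos + -1 + 1 by ring)
      rw [← h3, L.mate_mate, h3, ← h4, R.mate_mate]
  · obtain ⟨q, r, h, h0, h1⟩ := exists_div y.ne y.pos
    push_cast at h1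
    by_cases c1 : r < m - 2
    · refine Or.inl ⟨movePt (2 - m) y, ?_⟩
      refine (key2 _ (q - 1) (r + k + 4 - m) ?_ (by omega) (by omega)).1.trans
        (congrArg Sum.inr (MarkedPt.ext ?_))
      · change y.pos + (2 - m) = _
        rw [h]
        push_cast
        ring
      · change y.pos + (2 - m) + (m - 2) = _
        ring
    by_cases c2 : m ≤ r
    · refine Or.inl ⟨movePt (-m) y, ?_⟩
      refine (key1 _ q (r - m) ?_ (by omega) (by omega)).1.trans
        (congrArg Sum.inr (MarkedPt.ext ?_))
      · change y.pos + (-m) = _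
        rw [h]
        ring
      · change y.pos + (-m) + m = _
        ring
    -- The remaining outer residues `m - 2` and `m - 1` are joined by the transported cup.
    · refine Or.inr ⟨(k + 2 : ℕ) * q + (m - 2), ?_, ?_, by omega⟩
      · refine HasArc.of_mate (x := ⟨(k + 2 : ℕ) * q + (m - 2), by omega⟩)
          (y := ⟨(k + 2 : ℕ) * q + (m - 2) + 1, by omega⟩) (cap_comp_mate ?_) rfl
        rw [Sum.map_inr, (rot_cup_arc (k + 2) m (q - 1)).mate]
        · refine congrArg Sum.inr (emb_eq (q := q) (r := m - 1) ?_ (by omega) (by push_cast; omega) ?_)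
          · simp only
            ring
          · simp only
            push_cast
            ring
        · rw [emb_of_eq (q := q) (r := m - 2) rfl (by omega) (by push_cast; omega)]
          push_cast
          ring
      · convert ((hasArc_cup ((rotDiagram k (2 - m)).comp Z)).rot m).shift (q - 1) using 1
        push_cast
        ring
  · rw [hL, AffineDiagram.comp_loops, (cap_rot_cup_loops k h2 hm).2, rot_comp_loops, hR,
      rot_comp_loops, cup_comp_loops, rot_comp_loops, hZ, AffineDiagram.comp_loops,
      (comp_rot_loops _ _).2]
    rfl

end


/-! ### Decomposition of diagrams -/

section Decompose

variable {l k : ℕ}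

/-- Innermost arcs: the arc that starts next to `x` cannot leave the region below the arc from `x`
to `y`, so it is shorter. The induction is on the bound `n` for the length. -/
theorem exists_hasArc_of_lt (D : AffineDiagram l k) (n : ℕ) : ∀ x y : MarkedPt k,
    D.mate (Sum.inr x) = Sum.inr y → x.pos < y.pos → y.pos - x.pos ≤ n → ∃ p, HasArc D p := by
  induction n with
  | zero =>
    intro x y _ h1 h2
    push_cast at h2
    omega
  | succ n ih =>
    intro x y h h1 h2
    by_cases h3 : y.pos = x.pos + 1
    · exact ⟨_, HasArc.of_mate h h3⟩
    · have h4 : D.mate (Sum.inr y) = Sum.inr x := by rw [← h, D.mate_mate]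
      -- Outer points are met from right to left, so the arc is read from `y` to `x`.
      obtain ⟨h5, h6⟩ := D.noncrossing (Sum.inr y) (Sum.inr ⟨x.pos + 1, x.ne⟩)
        (show x.pos + 1 < y.pos by omega) (by rw [h4]; exact lt_add_one x.pos)
      rcases h7 : D.mate (Sum.inr ⟨x.pos + 1, x.ne⟩) with w | w
      · rw [h7] at h5
        exact h5.elim
      · rw [h7] at h5 h6
        rw [h4] at h6
        have h8 : w.pos < y.pos := h5
        have h9 : x.pos < w.pos := h6
        have h10 : w.pos ≠ x.pos + 1 := fun h => D.mate_ne (Sum.inr ⟨x.pos + 1, x.ne⟩)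
          (h7.trans (congrArg Sum.inr (MarkedPt.ext h)))
        refine ih _ _ h7 (show x.pos + 1 < w.pos by omega) ?_
        push_cast at h2
        change w.pos - (x.pos + 1) ≤ n
        omega

theorem exists_hasArc {D : AffineDiagram l k} {x y : MarkedPt k}
    (h : D.mate (Sum.inr x) = Sum.inr y) : ∃ p, HasArc D p := by
  rcases lt_trichotomy x.pos y.pos with h1 | h1 | h1
  · exact exists_hasArc_of_lt D (y.pos - x.pos).toNat x y h h1 (by omega)
  · exact (D.mate_ne _ (h.trans (congrArg Sum.inr (MarkedPt.ext h1.symm)))).elim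
  · exact exists_hasArc_of_lt D (x.pos - y.pos).toNat y x (by rw [← h, D.mate_mate]) h1 (by omega)

/-- With one point in each domain the arc would join a point to its own shift, which an equivariant
involution does not allow (`shift_eq_zero`). -/
theorem HasArc.two_le {D : AffineDiagram l k} {p : ℤ} (h : HasArc D p) : 2 ≤ k := by
  obtain ⟨hk, h⟩ := h
  by_contra h2
  have h3 : k = 1 := by omega
  subst h3
  have h4 : D.mate (Sum.inr ⟨p, hk⟩) = (1 : ℤ) +ᵥ Sum.inr ⟨p, hk⟩ :=
    h.trans (congrArg Sum.inr (MarkedPt.ext rfl))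
  exact one_ne_zero (shift_eq_zero (freeShift_sum (freeShift_markedPt _) (freeShift_markedPt _))
    D.mate_mate D.mate_vadd h4)

/-- Turn the arc to the last position, split off the cup there by `HasArc.cup_cap`, and turn back.
-/
theorem HasArc.factor {D : AffineDiagram l (k + 2)} {p : ℤ} (h : HasArc D p) :
    ∃ D', D = (rotDiagram (k + 2) (p - k)).comp ((cupDiagram k).comp D') := by
  have h1 := h.rot (k - p)
  rw [add_sub_cancel] at h1
  refine ⟨(capDiagram k).comp ((rotDiagram (k + 2) (k - p)).comp D), ?_⟩
  rw [h1.cup_cap, rot_rot_comp, sub_add_sub_cancel, sub_self, rot_zero_comp]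

/-- A monotone bijection of `ℤ` has no room between `g x` and `g (x + 1)`, so it commutes with the
successor. -/
theorem translation_of_strictMono {g : ℤ → ℤ} (h1 : StrictMono g) (h2 : Function.Surjective g)
    (x : ℤ) : g x = x + g 0 := by
  have h3 : ∀ x, g (x + 1) = g x + 1 := by
    intro x
    obtain ⟨z, hz⟩ := h2 (g x + 1)
    have h4 : x < z := h1.lt_iff_lt.1 (by omega)
    have h5 := h1.monotone (show x + 1 ≤ z by omega)
    have h6 := h1 (show x < x + 1 by omega)
    omega
  induction x using Int.induction_on with
  | zero => simp
  | succ n ih => rw [h3, ih]; ring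
  | pred n ih =>
    have := h3 (-(n : ℤ) - 1)
    rw [sub_add_cancel, ih] at this
    linarith

/-- If all arcs cross the strip, disjointness makes the map from inner to outer points monotone,
hence a translation. Comparing the shifts on the two boundary lines then gives equal numbers of
points. -/
theorem eq_rot_of_through (D : AffineDiagram l k)
    (h1 : ∀ x, ∃ y, D.mate (Sum.inl x) = Sum.inr y) (h2 : ∀ y, ∃ x, D.mate (Sum.inr y) = Sum.inl x) :
    l = k ∧ ∃ r : ℤ, ∀ x y, D.mate (Sum.inl x) = Sum.inr y → y.pos = x.pos + r := by
  by_cases hl : l = 0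
  · subst hl
    refine ⟨?_, 0, fun x => (x.ne rfl).elim⟩
    by_contra hk
    obtain ⟨x, -⟩ := h2 ⟨0, Ne.symm hk⟩
    exact x.ne rfl
  · choose F hF using h1
    have hk : k ≠ 0 := (F ⟨0, hl⟩).ne
    have hmono : StrictMono fun x : ℤ => (F ⟨x, hl⟩).pos := by
      intro x y hxy
      have := (D.noncrossing (Sum.inl ⟨x, hl⟩) (Sum.inl ⟨y, hl⟩) hxy (by rw [hF]; trivial)).2
      rw [hF, hF] at this
      exact this
    have hsurj : Function.Surjective fun x : ℤ => (F ⟨x, hl⟩).pos := by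
      intro y
      obtain ⟨x, hx⟩ := h2 ⟨y, hk⟩
      refine ⟨x.pos, ?_⟩
      have h3 := congrArg D.mate hx
      rw [D.mate_mate, hF] at h3
      exact (congrArg MarkedPt.pos (Sum.inr_injective h3)).symm
    have hg := translation_of_strictMono hmono hsurj
    constructor
    · have h3 := D.mate_vadd 1 (Sum.inl ⟨0, hl⟩)
      have h4 : (1 : ℤ) +ᵥ (Sum.inl ⟨0, hl⟩ : MarkedPt l ⊕ MarkedPt k) = Sum.inl ⟨(l : ℤ), hl⟩ :=
        congrArg Sum.inl (MarkedPt.ext (by rw [MarkedPt.vadd_pos]; simp))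
      rw [h4, hF, hF] at h3
      have h5 := congrArg MarkedPt.pos (Sum.inr_injective h3)
      rw [MarkedPt.vadd_pos] at h5
      have h6 : (F ⟨l, hl⟩).pos = l + (F ⟨0, hl⟩).pos := hg l
      have h7 : (l : ℤ) = k := by linarith
      exact_mod_cast h7
    · refine ⟨(F ⟨0, hl⟩).pos, fun x y hxy => ?_⟩
      rw [hF] at hxy
      rw [← Sum.inr_injective hxy]
      exact hg x.pos

/-- The `(0, 0)`-diagram that consists of `r` noncontractible loops. -/
def loopsDiagram (r : ℕ) : AffineDiagram 0 0 := { loopDiagram with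
  loops := r
  loops_disjoint := fun _ x => (x.ne rfl).elim }

theorem eq_loopsDiagram (D : AffineDiagram 0 0) : D = loopsDiagram D.loops := by
  refine AffineDiagram.ext' ?_ rfl
  rintro (x | x) <;> exact (x.ne rfl).elim

theorem loop_comp (D : AffineDiagram l 0) : ((loopDiagram).comp D).loops = D.loops + 1 ∧
    contractibleLoops loopDiagram D = 0 := by
  have := loops_eq_zero_of_conn (E := loopDiagram) (D := D) fun y => (y.ne rfl).elim
  rw [AffineDiagram.comp_loops, this.1, this.2]
  exact ⟨rfl, rfl⟩

theorem loop_comp_loops (r : ℕ) : loopDiagram.comp (loopsDiagram r) = loopsDiagram (r + 1) := by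
  rw [eq_loopsDiagram (loopDiagram.comp (loopsDiagram r)), (loop_comp _).1]
  rfl

/-- A diagram has an arc between two neighbouring outer points, or an arc between two neighbouring
inner points, or it is a rotation or consists of loops. -/
theorem AffineDiagram.decompose (D : AffineDiagram l k) : (∃ p, HasArc D p) ∨
    (∃ p, HasArc D.flip p) ∨ (l = k ∧ D.loops = 0 ∧
      ∃ r : ℤ, ∀ x y, D.mate (Sum.inl x) = Sum.inr y → y.pos = x.pos + r) ∨ (l = 0 ∧ k = 0) := by
  by_cases h1 : ∃ x y, D.mate (Sum.inr x) = Sum.inr y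
  · obtain ⟨x, y, h⟩ := h1
    exact Or.inl (exists_hasArc h)
  by_cases h2 : ∃ x y, D.mate (Sum.inl x) = Sum.inl y
  · obtain ⟨x, y, h⟩ := h2
    refine Or.inr (Or.inl (exists_hasArc (D := D.flip) (x := x) (y := y) ?_))
    rw [flip_mate, Sum.swap_inr, h]
    rfl
  push Not at h1 h2
  have h3 : ∀ x, ∃ y, D.mate (Sum.inl x) = Sum.inr y := fun x => by
    rcases h : D.mate (Sum.inl x) with y | y
    · exact (h2 _ _ h).elim
    · exact ⟨y, rfl⟩
  have h4 : ∀ y, ∃ x, D.mate (Sum.inr y) = Sum.inl x := fun x => by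
    rcases h : D.mate (Sum.inr x) with y | y
    · exact ⟨y, rfl⟩
    · exact (h1 _ _ h).elim
  obtain ⟨h5, h6⟩ := eq_rot_of_through D h3 h4
  by_cases hl : l = 0
  · exact Or.inr (Or.inr (Or.inr ⟨hl, h5.symm.trans hl⟩))
  · refine Or.inr (Or.inr (Or.inl ⟨h5, ?_, h6⟩))
    by_contra h7
    obtain ⟨y, hy⟩ := D.loops_disjoint h7 ⟨0, hl⟩
    exact h2 _ _ hy

theorem eq_rot {D : AffineDiagram k k} {r : ℤ} (h : D.loops = 0) (hn : ¬ ∃ p, HasArc D.flip p)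
    (hr : ∀ x y, D.mate (Sum.inl x) = Sum.inr y → y.pos = x.pos + r) : D = rotDiagram k r := by
  have h1 : ∀ x, D.mate (Sum.inl x) = Sum.inr (movePt r x) := by
    intro x
    rcases h2 : D.mate (Sum.inl x) with y | y
    · refine (hn (exists_hasArc (x := x) (y := y) ?_)).elim
      rw [AffineDiagram.flip_mate, Sum.swap_inr, h2]
      rfl
    · exact congrArg Sum.inr (MarkedPt.ext (hr _ _ h2))
  refine AffineDiagram.ext' ?_ h
  rintro (x | y)
  · exact h1 x
  · have h3 := h1 (movePt (-r) y)
    have h4 : movePt r (movePt (-r) y) = y := MarkedPt.ext (by simp [movePt])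
    rw [h4] at h3
    have h5 := (rot_straight k r).mate_inr (movePt (-r) y)
    rw [h4] at h5
    rw [h5, ← h3, D.mate_mate]

end Decompose


/-! ### Algebras with Temperley–Lieb generators -/

/-- The product `e a * e (a + 1) * ⋯` of `c` factors. -/
def chain {A : Type} [Monoid A] (e : ℕ → A) (a : ℕ) : ℕ → A
  | 0 => 1
  | c + 1 => chain e a c * e (a + c)

theorem chain_succ' {A : Type} [Monoid A] (e : ℕ → A) (a c : ℕ) :
    chain e a (c + 1) = e a * chain e (a + 1) c := by
  induction c with
  | zero => simp [chain]
  | succ c ih =>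
    rw [chain, ih, chain, mul_assoc, show a + (c + 1) = a + 1 + c by ring]

/-- The integral powers of an element `u`, where `v` plays the role of the inverse. -/
def intPow {A : Type} [Monoid A] (u v : A) : ℤ → A
  | Int.ofNat a => u ^ a
  | Int.negSucc a => v ^ (a + 1)

section IntPow

variable {A : Type} [Monoid A] {u v : A}

theorem intPow_natCast (a : ℕ) : intPow u v a = u ^ a := rfl

theorem intPow_zero : intPow u v 0 = 1 := pow_zero u

theorem intPow_one : intPow u v 1 = u := pow_one u

theorem intPow_neg_one : intPow u v (-1) = v := pow_one v

theorem intPow_neg (m : ℤ) : intPow u v (-m) = intPow v u m := by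
  rcases m with (_ | a) | a
  · simp [intPow]
  · rfl
  · rfl

theorem intPow_op (m : ℤ) :
    intPow (MulOpposite.op u) (MulOpposite.op v) m = MulOpposite.op (intPow u v m) := by
  rcases m with a | a <;> simp [intPow]

/-- Shifting the brackets, `(d * w) ^ a * d = d * (w * d) ^ a`. With `d = dead k` this exchanges
rotations acting from the left and from the right (`rot_dead`). -/
theorem mul_intPow_comm {d w w' : A} (m : ℤ) :
    intPow (d * w) (d * w') m * d = d * intPow (w * d) (w' * d) m := by
  have h : ∀ (w : A) (a : ℕ), (d * w) ^ a * d = d * (w * d) ^ a := by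
    intro w a
    induction a with
    | zero => simp
    | succ a ih => rw [pow_succ', mul_assoc, ih, pow_succ', mul_assoc, mul_assoc]
  rcases m with a | a
  · exact h w a
  · exact h w' (a + 1)

variable {T : A → Prop} (hu : ∀ x, T x → T (u * x)) (hv : ∀ x, T x → T (v * x))
  (huv : ∀ x, T x → u * (v * x) = x) (hvu : ∀ x, T x → v * (u * x) = x)
include hu hv

theorem intPow_mem (m : ℤ) {x : A} (hx : T x) : T (intPow u v m * x) := by
  have h : ∀ (w : A) (_ : ∀ x, T x → T (w * x)) (a : ℕ), T (w ^ a * x) := by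
    intro w hw a
    induction a with
    | zero => simpa using hx
    | succ a ih => rw [pow_succ', mul_assoc]; exact hw _ ih
  rcases m with a | a
  · exact h u hu a
  · exact h v hv (a + 1)

include huv in
theorem intPow_succ (m : ℤ) {x : A} (hx : T x) :
    intPow u v (m + 1) * x = u * (intPow u v m * x) := by
  rcases m with a | a
  · change u ^ (a + 1) * x = u * (u ^ a * x)
    rw [pow_succ', mul_assoc]
  · rcases a with _ | a
    · change u ^ 0 * x = u * (v ^ 1 * x)
      rw [pow_zero, pow_one, huv x hx, one_mul]
    · change v ^ (a + 1) * x = u * (v ^ (a + 2) * x)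
      rw [pow_succ' v (a + 1), mul_assoc, huv]
      exact intPow_mem hu hv (Int.negSucc a) hx

include huv hvu

/-- The elements `u` and `v` need not be inverse to each other in `A`, only on the invariant subset
`T`. This is why the law of exponents is stated for the action on members of `T`. -/
theorem intPow_add (a b : ℤ) {x : A} (hx : T x) :
    intPow u v (a + b) * x = intPow u v a * (intPow u v b * x) := by
  have hb := intPow_mem hu hv b hx
  induction a using Int.induction_on with
  | zero => rw [zero_add, intPow_zero, one_mul]
  | succ n ih =>
    rw [intPow_succ hu hv huv _ hb, ← ih, ← intPow_succ hu hv huv _ hx]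
    congr 2
    ring
  | pred n ih =>
    have h1 := intPow_succ hu hv huv (-(n : ℤ) - 1) hb
    rw [sub_add_cancel, ← ih] at h1
    have h2 := intPow_succ hu hv huv (-(n : ℤ) - 1 + b) hx
    rw [show -(n : ℤ) - 1 + b + 1 = -(n : ℤ) + b by ring, h1] at h2
    have h3 := congrArg (fun y => v * y) h2
    rw [hvu _ (intPow_mem hu hv _ hb), hvu _ (intPow_mem hu hv _ hx)] at h3
    exact h3.symm

end IntPow

/-- Elements of an algebra that satisfy those relations of the generators of the extended affine
Temperley–Lieb algebra that do not mention the last of the generators `e 0, …, e (n - 1)`. -/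
structure TLSystem (n : ℕ) (A : Type) [Ring A] [Algebra ℂ A] where
  e : ℕ → A
  rho : A
  rhoInv : A
  weight : ℂ
  two_le : 2 ≤ n
  e_sq : ∀ i, i + 2 ≤ n → e i * e i = weight • e i
  e_comm : ∀ i j, i + 2 ≤ j → j + 2 ≤ n → e i * e j = e j * e i
  e_succ : ∀ i, i + 3 ≤ n → e i * (e (i + 1) * e i) = e i
  e_pred : ∀ i, i + 3 ≤ n → e (i + 1) * (e i * e (i + 1)) = e (i + 1)
  rho_inv : rho * rhoInv = 1
  inv_rho : rhoInv * rho = 1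
  rho_e : ∀ i, i + 3 ≤ n → rho * e i = e (i + 1) * rho
  rho_sq_e : rho * rho * e (n - 2) = e 0 * (rho * rho)
  twist : rho * rho * e (n - 2) = chain e 0 (n - 2) * e (n - 2)

/-! ### Strands, rotations, cups and caps inside the algebra -/

namespace TLSystem

variable {n : ℕ} {A : Type} [Ring A] [Algebra ℂ A] (L : TLSystem n A)

/-- The product `e k * e (k + 2) * ⋯ * e (n - 2)`. -/
def dead (k : ℕ) : A := if k + 2 ≤ n then L.e k * dead (k + 2) else 1
termination_by n - k

theorem dead_step {k : ℕ} (h : k + 2 ≤ n) : L.dead k = L.e k * L.dead (k + 2) := by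
  rw [dead, if_pos h]

theorem dead_top : L.dead n = 1 := by
  rw [dead, if_neg (by omega)]

theorem e_dead {i k : ℕ} (h : i + 2 ≤ k) : L.e i * L.dead k = L.dead k * L.e i := by
  induction hd : n - k using Nat.strong_induction_on generalizing k with
  | _ d ih =>
    by_cases hk : k + 2 ≤ n
    · rw [L.dead_step hk, ← mul_assoc, L.e_comm i k h hk, mul_assoc,
        ih (n - (k + 2)) (by omega) (by omega) rfl, mul_assoc]
    · rw [dead, if_neg hk, mul_one, one_mul]

/-- The right ideal generated by `dead k`. -/
def Ideal (k : ℕ) (x : A) : Prop := ∃ y, x = L.dead k * y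

/-- The rotation of `k` strands. -/
def u (k : ℕ) : A := L.dead k * L.rho

/-- The inverse rotation of `k` strands. -/
def v (k : ℕ) : A := L.dead k * L.rhoInv

/-- The powers of the rotation of `k` strands. -/
def rot (k : ℕ) : ℤ → A := intPow (L.u k) (L.v k)

variable {L}

theorem u_mem {k : ℕ} (x : A) : L.Ideal k (L.u k * x) := ⟨L.rho * x, mul_assoc _ _ _⟩

theorem v_mem {k : ℕ} (x : A) : L.Ideal k (L.v k * x) := ⟨L.rhoInv * x, mul_assoc _ _ _⟩

/-- This inclusion plays the role of a cup: two strands that are dead for `k` are regarded as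
strands of `k + 2` that happen to be joined. -/
theorem Ideal.up {k : ℕ} (hk : k + 2 ≤ n) {x : A} (h : L.Ideal k x) : L.Ideal (k + 2) x := by
  obtain ⟨y, rfl⟩ := h
  exact ⟨L.e k * y, by rw [L.dead_step hk, L.e_dead le_rfl, mul_assoc]⟩

theorem Ideal.exists_e {k : ℕ} (hk : k + 2 ≤ n) {x : A} (h : L.Ideal k x) :
    ∃ y, L.Ideal (k + 2) y ∧ x = L.e k * y := by
  obtain ⟨y, rfl⟩ := h
  exact ⟨_, ⟨y, rfl⟩, by rw [L.dead_step hk, mul_assoc]⟩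

/-- Left multiplication by `e k` plays the role of a cap. -/
theorem Ideal.down {k : ℕ} (hk : k + 2 ≤ n) {x : A} (h : L.Ideal (k + 2) x) :
    L.Ideal k (L.e k * x) := by
  obtain ⟨y, rfl⟩ := h
  exact ⟨y, by rw [L.dead_step hk, mul_assoc]⟩

theorem Ideal.e_mul {i k : ℕ} (hk : i + 2 ≤ k) {x : A} (h : L.Ideal k x) :
    L.Ideal k (L.e i * x) := by
  obtain ⟨y, rfl⟩ := h
  exact ⟨L.e i * y, by rw [← mul_assoc, L.e_dead hk, mul_assoc]⟩

theorem Ideal.e_mul_self {k : ℕ} (hk : k + 2 ≤ n) {x : A} (h : L.Ideal k x) :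
    L.e k * x = L.weight • x := by
  obtain ⟨y, -, rfl⟩ := h.exists_e hk
  rw [← mul_assoc, L.e_sq k hk, smul_mul_assoc]

theorem Ideal.e_e {k : ℕ} (hk : k + 3 ≤ n) {x : A} (h : L.Ideal k x) :
    L.e k * (L.e (k + 1) * x) = x := by
  obtain ⟨y, -, rfl⟩ := h.exists_e (by omega)
  rw [← mul_assoc, ← mul_assoc, mul_assoc (L.e k), L.e_succ k hk]

theorem u_step {k : ℕ} (hk : k + 2 ≤ n) : L.u k = L.e k * L.u (k + 2) := by
  rw [u, L.dead_step hk, mul_assoc, u]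

theorem v_step {k : ℕ} (hk : k + 2 ≤ n) : L.v k = L.e k * L.v (k + 2) := by
  rw [v, L.dead_step hk, mul_assoc, v]

/-- The generator `e (i + 1)` is still two places away from the dead ones, so it commutes with `dead
k` and the relation for `rho` survives. -/
theorem u_e {i k : ℕ} (hi : i + 3 ≤ k) (hk : k ≤ n) : L.u k * L.e i = L.e (i + 1) * L.u k := by
  rw [u, mul_assoc, L.rho_e i (by omega), ← mul_assoc, ← L.e_dead (by omega), mul_assoc]

theorem v_e {i k : ℕ} (hi : i + 3 ≤ k) (hk : k ≤ n) : L.v k * L.e (i + 1) = L.e i * L.v k := by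
  have h : L.rhoInv * L.e (i + 1) = L.e i * L.rhoInv := by
    calc L.rhoInv * L.e (i + 1) = L.rhoInv * (L.e (i + 1) * L.rho) * L.rhoInv := by
          rw [mul_assoc, mul_assoc, L.rho_inv, mul_one]
      _ = L.e i * L.rhoInv := by
          rw [← L.rho_e i (by omega), ← mul_assoc, L.inv_rho, one_mul]
  rw [v, mul_assoc, h, ← mul_assoc, ← L.e_dead (by omega), mul_assoc]

/-- Induction on the number `d` of dead pairs. Going from `k + 2` to `k` puts an extra `e k` into
`u` and `v`; moving one of them past `v (k + 2)` lowers its index to `k - 1`, and the relations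
between `e k` and `e (k - 1)` absorb it. There is a generator `e (k - 1)` only for `k ≠ 0`. -/
theorem u_v {k d : ℕ} (hd : k + 2 * d = n) (hk : k ≠ 0) {x : A} (hx : L.Ideal k x) :
    L.u k * (L.v k * x) = x ∧ L.v k * (L.u k * x) = x := by
  induction d generalizing k x with
  | zero =>
    obtain rfl : k = n := by omega
    rw [u, v, L.dead_top, one_mul, one_mul, ← mul_assoc, L.rho_inv, ← mul_assoc, L.inv_rho, one_mul]
    exact ⟨rfl, rfl⟩
  | succ d ih =>
    have hk2 : k + 2 ≤ n := by omega
    obtain ⟨i, rfl⟩ : ∃ i, k = i + 1 := ⟨k - 1, by omega⟩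
    obtain ⟨y, hy, hxy⟩ := hx.exists_e hk2
    have hu := L.u_e (i := i) (k := i + 1 + 2) (by omega) hk2
    have hv := L.v_e (i := i) (k := i + 1 + 2) (by omega) hk2
    obtain ⟨h1, h2⟩ := ih (k := i + 1 + 2) (by omega) (by omega) (hx.up hk2)
    rw [u_step hk2, v_step hk2]
    constructor
    · calc L.e (i + 1) * L.u (i + 1 + 2) * (L.e (i + 1) * L.v (i + 1 + 2) * x)
          = L.u (i + 1 + 2) * (L.e i * (L.e (i + 1) * (L.v (i + 1 + 2) * L.e (i + 1) * y))) := by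
            rw [← hu, hxy]; simp only [mul_assoc]
        _ = L.u (i + 1 + 2) * (L.e i * (L.e (i + 1) * L.e i) * (L.v (i + 1 + 2) * y)) := by
            rw [hv]; simp only [mul_assoc]
        _ = L.u (i + 1 + 2) * (L.v (i + 1 + 2) * L.e (i + 1) * y) := by
            rw [L.e_succ i (by omega), hv, mul_assoc]
        _ = x := by rw [mul_assoc, ← hxy, h1]
    · calc L.e (i + 1) * L.v (i + 1 + 2) * (L.e (i + 1) * L.u (i + 1 + 2) * x)
          = L.e (i + 1) * (L.v (i + 1 + 2) * L.e (i + 1) * (L.u (i + 1 + 2) * x)) := by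
            simp only [mul_assoc]
        _ = L.e (i + 1) * (L.e i * x) := by
            rw [hv, mul_assoc, h2]
        _ = x := by
            rw [hxy, ← mul_assoc, ← mul_assoc, mul_assoc (L.e (i + 1)), L.e_pred i (by omega)]

theorem rot_mem {k : ℕ} (m : ℤ) {x : A} (hx : L.Ideal k x) : L.Ideal k (L.rot k m * x) :=
  intPow_mem (fun _ _ => u_mem _) (fun _ _ => v_mem _) m hx

theorem rot_add {k d : ℕ} (hd : k + 2 * d = n) (hk : k ≠ 0) (a b : ℤ) {x : A} (hx : L.Ideal k x) :
    L.rot k (a + b) * x = L.rot k a * (L.rot k b * x) :=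
  intPow_add (fun _ _ => u_mem _) (fun _ _ => v_mem _) (fun _ h => (u_v hd hk h).1)
    (fun _ h => (u_v hd hk h).2) a b hx

theorem rot_zero (k : ℕ) : L.rot k 0 = 1 := intPow_zero

theorem rot_nat (k a : ℕ) : L.rot k a = L.u k ^ a := rfl

theorem rot_neg_cancel {k d : ℕ} (hd : k + 2 * d = n) (hk : k ≠ 0) (a : ℤ) {x : A}
    (hx : L.Ideal k x) : L.rot k (-a) * (L.rot k a * x) = x := by
  rw [← rot_add hd hk _ _ hx, neg_add_cancel, rot_zero, one_mul]

theorem rot_cancel_neg {k d : ℕ} (hd : k + 2 * d = n) (hk : k ≠ 0) (a : ℤ) {x : A}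
    (hx : L.Ideal k x) : L.rot k a * (L.rot k (-a) * x) = x := by
  rw [← rot_add hd hk _ _ hx, add_neg_cancel, rot_zero, one_mul]

theorem rot_injective {k d : ℕ} (hd : k + 2 * d = n) (hk : k ≠ 0) (a : ℤ) {x y : A}
    (hx : L.Ideal k x) (hy : L.Ideal k y) (h : L.rot k a * x = L.rot k a * y) : x = y := by
  rw [← rot_neg_cancel hd hk a hx, h, rot_neg_cancel hd hk a hy]

theorem e_u_pow {k i c : ℕ} (hi : i + c + 2 ≤ k) (hk : k ≤ n) :
    L.e (i + c) * L.u k ^ c = L.u k ^ c * L.e i := by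
  induction c with
  | zero => simp
  | succ c ih =>
    rw [pow_succ', ← mul_assoc, ← add_assoc, ← u_e (by omega) hk, mul_assoc, ih (by omega), mul_assoc]

/-- Each factor of the power on the left is `e k * u (k + 2)`. Moving the factors `e k` to the right
past the powers of `u (k + 2)` lowers their indices and leaves a chain. -/
theorem u_pow {a c : ℕ} (hk : a + c + 2 ≤ n) :
    L.u (a + c) ^ c = L.u (a + c + 2) ^ c * chain L.e a c := by
  -- The chain is lengthened at its lower end while `k = a + b` stays fixed, so `a` has to vary in
  -- the induction.
  have key : ∀ b a : ℕ, a + b ≤ n → ∀ k, k = a + b → k + 2 ≤ n →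
      L.u k ^ b = L.u (k + 2) ^ b * chain L.e a b := by
    intro b
    induction b with
    | zero => intro a _ k _ _; simp [chain]
    | succ b ih =>
      intro a ha k hk hkn
      rw [pow_succ', ih (a + 1) (by omega) k (by omega) hkn, chain_succ', ← mul_assoc,
        u_step hkn, mul_assoc (L.e k), ← pow_succ', ← mul_assoc]
      congr 1
      have := e_u_pow (L := L) (k := k + 2) (i := a) (c := b + 1) (by omega) hkn
      rw [← this, hk]
  exact key c a (by omega) _ rfl hk

theorem chain_mem {a c k : ℕ} (h : a + c + 1 ≤ k) {x : A} (hx : L.Ideal k x) :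
    L.Ideal k (chain L.e a c * x) := by
  induction c generalizing x with
  | zero => simpa [chain] using hx
  | succ c ih =>
    rw [chain, mul_assoc]
    exact ih (by omega) (hx.e_mul (by omega))

/-- For `k + 2 = n` this is the relation `twist`. It descends to smaller `k` because `e k * e (k +
1)` acts trivially on the ideal of `k`; this is used once for the power of the rotation and once to
shorten the chain. -/
theorem u_sq {k d : ℕ} (hd : k + 2 + 2 * d = n) {x : A} (hx : L.Ideal k x) :
    L.u (k + 2) ^ 2 * x = chain L.e 0 k * x := by
  induction d generalizing k with
  | zero =>
    obtain rfl : k + 2 = n := by omega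
    obtain ⟨y, -, rfl⟩ := hx.exists_e le_rfl
    have h := L.twist
    rw [Nat.add_sub_cancel] at h
    rw [u, L.dead_top, one_mul, pow_two, ← mul_assoc, h, mul_assoc]
  | succ d ih =>
    have h := u_pow (L := L) (a := k) (c := 2) (by omega)
    have h1 : chain L.e k 2 * x = x := by
      simp only [chain, one_mul, add_zero]
      rw [mul_assoc]
      exact hx.e_e (by omega)
    rw [h, mul_assoc, h1, ih (k := k + 2) (by omega) (hx.up (by omega)), chain, chain]
    simp only [zero_add, mul_assoc]
    rw [hx.e_e (by omega)]

/-- A full rotation, with and without two dead points. -/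
theorem rot_full {k d : ℕ} (hd : k + 2 + 2 * d = n) (j : ℤ) {x : A} (hx : L.Ideal k x) :
    L.rot (k + 2) ((k + 2 : ℕ) * j) * x = L.rot k (k * j) * x := by
  have hd' : k + 2 * (d + 1) = n := by omega
  have hup : ∀ {x}, L.Ideal k x → L.Ideal (k + 2) x := fun h => h.up (by omega)
  -- By `u_pow`, `u k ^ k` is `u (k + 2) ^ k` times the chain from `0` of length `k`, and by `u_sq`
  -- this chain acts as two more turns.
  have h1 : ∀ x, L.Ideal k x → L.rot (k + 2) (k + 2 : ℕ) * x = L.rot k k * x := by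
    intro x hx
    have h := u_pow (L := L) (a := 0) (c := k) (by omega)
    simp only [zero_add] at h
    rw [rot_nat, rot_nat, h, pow_add, mul_assoc, mul_assoc, u_sq hd hx]
  have h2 : ∀ (a b : ℤ) (x : A), L.Ideal k x →
      L.rot k (k * (a + b)) * x = L.rot k (k * a) * (L.rot k (k * b) * x) := by
    intro a b x hx
    by_cases hk : k = 0
    -- Here `u 0` is a loop and has no inverse, but all exponents are `k * _ = 0`.
    · subst hk
      simp [rot_zero]
    · rw [mul_add, rot_add hd' hk _ _ hx]
  have h3 : ∀ (a b : ℤ) (x : A), L.Ideal (k + 2) x → L.rot (k + 2) ((k + 2 : ℕ) * (a + b)) * x =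
      L.rot (k + 2) ((k + 2 : ℕ) * a) * (L.rot (k + 2) ((k + 2 : ℕ) * b) * x) := by
    intro a b x hx
    rw [mul_add, rot_add hd (by omega) _ _ hx]
  have h4 : ∀ x, L.Ideal k x → L.rot (k + 2) ((k + 2 : ℕ) * 1) * x = L.rot k (k * 1) * x := by
    intro x hx
    rw [mul_one, mul_one]
    exact h1 x hx
  have h5 : ∀ x, L.Ideal k x → L.rot (k + 2) ((k + 2 : ℕ) * (-1)) * x = L.rot k (k * (-1)) * x := by
    intro x hx
    have hy : L.Ideal k (L.rot k (k * (-1)) * x) := rot_mem _ hx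
    refine rot_injective (L := L) hd (by omega) ((k + 2 : ℕ) * 1) (rot_mem _ (hup hx)) (hup hy) ?_
    rw [← h3 _ _ _ (hup hx), h4 _ hy, ← h2 _ _ _ hx]
    simp [rot_zero]
  induction j using Int.induction_on with
  | zero => rw [mul_zero, mul_zero, rot_zero, rot_zero]
  | succ j ih =>
    rw [add_comm (j : ℤ), h3 _ _ _ (hup hx), ih, h4 _ (rot_mem _ hx), ← h2 _ _ _ hx]
  | pred j ih =>
    rw [sub_eq_neg_add, h3 _ _ _ (hup hx), ih, h5 _ (rot_mem _ hx), ← h2 _ _ _ hx]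

theorem chain_two {a c : ℕ} (hk : a + c + 4 ≤ n) {w : A} (hw : L.Ideal (a + c) w) :
    chain L.e a (c + 2) * w = chain L.e a c * w := by
  rw [chain, chain, mul_assoc, mul_assoc]
  congr 1
  exact hw.e_e (by omega)

/-- If `k = 0`, then only the trivial power of the rotation is invertible. -/
theorem rot_cancel_neg' {a c d : ℕ} (hd : a + c + 2 * d = n) {x : A} (hx : L.Ideal (a + c) x) :
    L.u (a + c) ^ c * (L.rot (a + c) (-c) * x) = x := by
  rcases Nat.eq_zero_or_pos c with rfl | hc
  · simp [rot_zero]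
  · rw [← rot_nat]
    exact rot_cancel_neg hd (by omega) _ hx

/-- The algebraic form of `cup_rot_cup`. Write `m = c + 2` and `k = a + c`, and let `w` be `y`
turned by `-c` on `k` strands. By `u_pow`, turning `y` by `-c` on `k + 2` strands gives the chain
from `a` of length `c` applied to `w`; on `w` the chain may be lengthened by two, and then `u_pow`
one level higher applies. -/
theorem rot_rot_mul {k d : ℕ} (hd : k + 4 + 2 * d = n) {m : ℤ} (h2 : 2 ≤ m) (hm : m ≤ k + 2)
    {y : A} (hy : L.Ideal k y) :
    L.rot (k + 2) m * (L.rot k (2 - m) * y) = L.rot (k + 4) m * (L.rot (k + 2) (2 - m) * y) := by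
  obtain ⟨c, rfl⟩ : ∃ c : ℕ, m = (c + 2 : ℕ) := ⟨(m - 2).toNat, by push_cast; omega⟩
  obtain ⟨a, rfl⟩ : ∃ a, k = a + c := ⟨k - c, by push_cast at hm; omega⟩
  have e1 : (2 - ((c + 2 : ℕ) : ℤ)) = -(c : ℤ) := by push_cast; ring
  rw [e1]
  set w := L.rot (a + c) (-(c : ℤ)) * y with hw
  have hwI : L.Ideal (a + c) w := rot_mem _ hy
  have hyw : y = L.u (a + c + 2) ^ c * (chain L.e a c * w) := by
    rw [← mul_assoc, ← u_pow (by omega), hw, rot_cancel_neg' (d := d + 2) (by omega) hy]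
  have h1 : L.rot (a + c + 2) (-(c : ℤ)) * y = chain L.e a c * w := by
    rw [hyw, ← rot_nat]
    exact rot_neg_cancel (d := d + 1) (by omega) (by omega) _
      (chain_mem (by omega) (hwI.up (by omega)))
  have h5 : L.u (a + c + 2) ^ (c + 2) = L.u (a + c + 4) ^ (c + 2) * chain L.e a (c + 2) :=
    u_pow (a := a) (c := c + 2) (by omega)
  rw [h1, ← chain_two (by omega) hwI, rot_nat, rot_nat, h5, mul_assoc]

/-- The algebraic form of `cap_rot_cup`. On both sides the generator can be moved through the
rotations until it becomes `e a`, where `m = c + 2` and `k = a + c`. As in `rot_rot_mul`, the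
remaining rotations differ by a chain that `u_pow` absorbs. -/
theorem e_rot_far {k d : ℕ} (hd : k + 4 + 2 * d = n) {m : ℤ} (h2 : 2 ≤ m) (hm : m ≤ k + 2)
    {x : A} (hx : L.Ideal (k + 2) x) :
    L.e (k + 2) * (L.rot (k + 4) m * x) =
      L.rot (k + 2) m * (L.rot k (2 - m) * (L.e k * (L.rot (k + 2) (m - 2) * x))) := by
  obtain ⟨c, rfl⟩ : ∃ c : ℕ, m = (c + 2 : ℕ) := ⟨(m - 2).toNat, by push_cast; omega⟩
  obtain ⟨a, rfl⟩ : ∃ a, k = a + c := ⟨k - c, by push_cast at hm; omega⟩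
  have e1 : (2 - ((c + 2 : ℕ) : ℤ)) = -(c : ℤ) := by push_cast; ring
  have e2 : (((c + 2 : ℕ) : ℤ) - 2) = (c : ℤ) := by push_cast; ring
  rw [e1, e2, rot_nat, rot_nat, rot_nat]
  have h1 : L.e (a + c) * (L.u (a + c + 2) ^ c * x) = L.u (a + c + 2) ^ c * (L.e a * x) := by
    rw [← mul_assoc, e_u_pow (by omega) (by omega), mul_assoc]
  have h2 : L.e (a + c + 2) * (L.u (a + c + 4) ^ (c + 2) * x) =
      L.u (a + c + 4) ^ (c + 2) * (L.e a * x) := by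
    rw [← mul_assoc, add_assoc a c 2, e_u_pow (by omega) (by omega), mul_assoc]
  set z := L.e (a + c) * (L.u (a + c + 2) ^ c * x) with hz
  have hzI : L.Ideal (a + c) z := Ideal.down (by omega) (rot_mem (c : ℤ) hx)
  set w := L.rot (a + c) (-(c : ℤ)) * z with hw
  have hwI : L.Ideal (a + c) w := rot_mem _ hzI
  have h3 : L.u (a + c + 2) ^ c * (chain L.e a c * w) = L.u (a + c + 2) ^ c * (L.e a * x) := by
    rw [← h1, ← mul_assoc, ← u_pow (by omega), hw, rot_cancel_neg' (d := d + 2) (by omega) hzI]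
  have h4 : chain L.e a c * w = L.e a * x :=
    rot_injective (d := d + 1) (by omega) (by omega) (c : ℤ)
      (chain_mem (by omega) (hwI.up (by omega))) (hx.e_mul (by omega)) h3
  have h5 := u_pow (L := L) (a := a) (c := c + 2) (by omega)
  rw [h2, show a + c + 4 = a + (c + 2) + 2 by ring, show a + c + 2 = a + (c + 2) by ring, h5, mul_assoc, chain_two (by omega) hwI, h4]

/-! ### The opposite algebra -/

variable (L)

/-- The corresponding elements of the opposite algebra. -/
def op : TLSystem n Aᵐᵒᵖ where
  e i := MulOpposite.op (L.e i)
  rho := MulOpposite.op L.rhoInv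
  rhoInv := MulOpposite.op L.rho
  weight := L.weight
  two_le := L.two_le
  e_sq i h := by rw [← MulOpposite.op_mul, L.e_sq i h, MulOpposite.op_smul]
  e_comm i j h h' := by rw [← MulOpposite.op_mul, ← MulOpposite.op_mul, L.e_comm i j h h']
  e_succ i h := by
    rw [← MulOpposite.op_mul, ← MulOpposite.op_mul, mul_assoc, L.e_succ i h]
  e_pred i h := by
    rw [← MulOpposite.op_mul, ← MulOpposite.op_mul, mul_assoc, L.e_pred i h]
  rho_inv := by rw [← MulOpposite.op_mul, L.rho_inv]; rfl
  inv_rho := by rw [← MulOpposite.op_mul, L.inv_rho]; rfl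
  rho_e i h := by
    rw [← MulOpposite.op_mul, ← MulOpposite.op_mul]
    congr 1
    calc L.e i * L.rhoInv = L.rhoInv * (L.rho * L.e i) * L.rhoInv := by
          rw [← mul_assoc, L.inv_rho, one_mul]
      _ = L.rhoInv * L.e (i + 1) := by
          rw [L.rho_e i h, mul_assoc, mul_assoc, L.rho_inv, mul_one]
  rho_sq_e := by
    simp only [← MulOpposite.op_mul]
    congr 1
    have h : L.rho * L.rho * (L.rhoInv * L.rhoInv) = 1 := by
      rw [mul_assoc, ← mul_assoc L.rho L.rhoInv, L.rho_inv, one_mul, L.rho_inv]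
    have h' : L.rhoInv * L.rhoInv * (L.rho * L.rho) = 1 := by
      rw [mul_assoc, ← mul_assoc L.rhoInv L.rho, L.inv_rho, one_mul, L.inv_rho]
    calc L.e (n - 2) * (L.rhoInv * L.rhoInv)
        = L.rhoInv * L.rhoInv * (L.rho * L.rho * L.e (n - 2)) * (L.rhoInv * L.rhoInv) := by
          rw [← mul_assoc _ (L.rho * L.rho), h', one_mul]
      _ = L.rhoInv * L.rhoInv * L.e 0 := by
          rw [L.rho_sq_e, mul_assoc, mul_assoc (L.e 0), h, mul_one]
  twist := by
    have h : L.rho * L.rho * (L.rhoInv * L.rhoInv) = 1 := by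
      rw [mul_assoc, ← mul_assoc L.rho L.rhoInv, L.rho_inv, one_mul, L.rho_inv]
    -- Here `y` is the descending product `e c * ⋯ * e 0`. It collapses the ascending chain from `1`
    -- to `e c`, and the relation `twist`, started at `e 0`, turns a double rotation on its right
    -- into the full ascending chain. At `c = n - 2` this yields `e (n - 2) = y * rho ^ 2`.
    have key : ∀ c, c + 2 ≤ n → ∃ y, chain (fun i => MulOpposite.op (L.e i)) 0 (c + 1) =
        MulOpposite.op y ∧ y * chain L.e 1 c = L.e c ∧
        y * (L.rho * L.rho) = y * chain L.e 1 (n - 2) := by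
      intro c
      induction c with
      | zero =>
        refine fun _ => ⟨L.e 0, by simp [chain], by simp [chain], ?_⟩
        rw [← L.rho_sq_e, L.twist, ← chain_succ']
        simp [chain]
      | succ c ih =>
        intro hc
        obtain ⟨y, h1, h2, h3⟩ := ih (by omega)
        refine ⟨L.e (c + 1) * y, ?_, ?_, ?_⟩
        · rw [chain, h1, MulOpposite.op_mul, zero_add]
        · rw [chain, mul_assoc, ← mul_assoc y, h2, add_comm 1 c, L.e_pred c (by omega)]
        · rw [mul_assoc, h3, mul_assoc]
    have h2 := L.two_le
    obtain ⟨y, h3, h4, h5⟩ := key (n - 2) (by omega)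
    rw [chain, zero_add] at h3
    rw [h3, ← MulOpposite.op_mul, ← MulOpposite.op_mul]
    congr 1
    rw [← h4, ← h5, mul_assoc, h, mul_one]

theorem op_dead (k : ℕ) : L.op.dead k = MulOpposite.op (L.dead k) := by
  induction hd : n - k using Nat.strong_induction_on generalizing k with
  | _ d ih =>
    by_cases hk : k + 2 ≤ n
    · rw [L.dead_step hk, L.op.dead_step hk, ih (n - (k + 2)) (by omega) _ rfl, L.e_dead le_rfl]
      exact (MulOpposite.op_mul _ _).symm
    · rw [dead, if_neg hk, dead, if_neg hk]
      rfl

/-- The powers of the rotation of `k` strands, acting from the right. -/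
def rotRight (k : ℕ) : ℤ → A := intPow (L.rho * L.dead k) (L.rhoInv * L.dead k)

theorem op_rot (k : ℕ) (m : ℤ) : L.op.rot k m = MulOpposite.op (L.rotRight k (-m)) := by
  rw [rot, u, v, op_dead, rotRight, intPow_neg, ← intPow_op]
  rfl

theorem rot_dead (k : ℕ) (m : ℤ) : L.rot k m * L.dead k = L.dead k * L.rotRight k m :=
  mul_intPow_comm m

end TLSystem


/-! ### Representing diagrams by elements of the algebra -/

namespace TLSystem

theorem ideal_dead {n : ℕ} {A : Type} [Ring A] [Algebra ℂ A] (L : TLSystem n A) (k : ℕ) :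
    L.Ideal k (L.dead k) := ⟨1, (mul_one _).symm⟩

theorem Ideal.mul {n : ℕ} {A : Type} [Ring A] [Algebra ℂ A] {L : TLSystem n A} {k : ℕ} {x : A}
    (h : L.Ideal k x) (y : A) : L.Ideal k (x * y) := by
  obtain ⟨z, rfl⟩ := h
  exact ⟨z * y, mul_assoc _ _ _⟩

/-- Turning to the left or to the right closes up to the same loop: by `u_sq` the square of `u 2` is
trivial on the ideal of `0`, so `u 2` and its inverse agree there. This makes the representatives of
loops invariant under reflection. -/
theorem u_zero_mul {n d : ℕ} {A : Type} [Ring A] [Algebra ℂ A] {L : TLSystem n A}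
    (hd : 0 + 2 + 2 * d = n) {x : A} (hx : L.Ideal 0 x) : L.u 0 * x = L.v 0 * x := by
  have h1 := u_sq hd hx
  rw [chain, one_mul] at h1
  have h2 : L.u 2 * x = L.v 2 * x := by
    conv_rhs => rw [← h1, pow_two, mul_assoc]
    exact ((u_v hd (by omega) (u_mem x)).2).symm
  rw [u_step (by omega), v_step (by omega), mul_assoc, mul_assoc, zero_add, h2]

variable {n : ℕ} {A : Type} [Ring A] [Algebra ℂ A]

/-- The element `x` of the algebra is obtained from a factorization of the diagram `D` into
rotations, cups, caps and loops. -/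
inductive Rep (L : TLSystem n A) : (l k : ℕ) → AffineDiagram l k → A → Prop
  | rot (k : ℕ) (r : ℤ) (hk : k ≠ 0) : Rep L k k (rotDiagram k r) (L.rot k r * L.dead k)
  | loops (r d : ℕ) (hd : 0 + 2 + 2 * d = n) : Rep L 0 0 (loopsDiagram r) (L.u 0 ^ r * L.dead 0)
  | cup {l k : ℕ} {D : AffineDiagram l k} {x : A} (m : ℤ) (h : Rep L l k D x) :
      Rep L l (k + 2) ((rotDiagram (k + 2) m).comp ((cupDiagram k).comp D)) (L.rot (k + 2) m * x)
  | cap {l k : ℕ} {D : AffineDiagram l k} {x : A} (m : ℤ) (h : Rep L l k D x) :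
      Rep L (l + 2) k ((D.comp (capDiagram l)).comp (rotDiagram (l + 2) m))
        (x * L.rotRight (l + 2) m)

variable {L : TLSystem n A} {l k : ℕ}

theorem Rep.mem {D : AffineDiagram l k} {x : A} (h : L.Rep l k D x) (hk : k ≤ n) :
    L.Ideal k x := by
  induction h with
  | rot k r _ => exact rot_mem r (ideal_dead L k)
  | loops r => exact rot_mem (r : ℤ) (ideal_dead L 0)
  | cup m h ih => exact rot_mem m ((ih (by omega)).up hk)
  | cap m h ih => exact (ih hk).mul _

theorem op_rotRight (L : TLSystem n A) (k : ℕ) (m : ℤ) :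
    L.op.rotRight k m = MulOpposite.op (L.rot k (-m)) := by
  rw [rot, u, v, rotRight, op_dead, intPow_neg, ← intPow_op]
  rfl

/-- Reflection exchanges cups and caps and reverses products, so every statement about cups in
arbitrary systems also yields one about caps. -/
theorem Rep.flip {D : AffineDiagram l k} {x : A} (h : L.Rep l k D x) :
    L.op.Rep k l D.flip (MulOpposite.op x) := by
  induction h with
  | rot k r hk =>
    have := Rep.rot (L := L.op) k (-r) hk
    rwa [op_dead, op_rot, neg_neg, ← MulOpposite.op_mul, ← rot_dead, ← rot_flip] at this
  | loops r d hd =>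
    -- In the opposite algebra the rotation is replaced by its inverse, so a loop reappears as `v 0`
    -- and has to be compared with `u 0`.
    have h2 : ∀ r : ℕ, L.op.u 0 ^ r * L.op.dead 0 = L.op.v 0 ^ r * L.op.dead 0 := by
      intro r
      induction r with
      | zero => rw [pow_zero, pow_zero]
      | succ r ih =>
        rw [pow_succ', pow_succ', mul_assoc, ih, mul_assoc]
        exact u_zero_mul hd ((intPow_natCast (u := L.op.v 0) (v := L.op.u 0) r) ▸
          intPow_mem (T := L.op.Ideal 0) (fun _ _ => v_mem _) (fun _ _ => u_mem _) _
            (ideal_dead L.op 0))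
    have h1 := Rep.loops (L := L.op) r d hd
    have h3 : L.op.v 0 ^ r = L.op.rot 0 (-(r : ℤ)) := by
      rw [TLSystem.rot, intPow_neg, intPow_natCast]
    rw [h2, h3, op_rot, neg_neg, op_dead, ← MulOpposite.op_mul, ← rot_dead, rot_nat] at h1
    rwa [eq_loopsDiagram (loopsDiagram r).flip]
  | cup m h ih =>
    have := Rep.cap (-m) ih
    rwa [op_rotRight, neg_neg, ← MulOpposite.op_mul, ← rot_flip, capDiagram,
      ← AffineDiagram.flip_comp, ← AffineDiagram.flip_comp] at this
  | cap m h ih =>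
    have := Rep.cup (-m) ih
    rwa [op_rot, neg_neg, ← MulOpposite.op_mul, ← rot_flip, ← cap_flip,
      ← AffineDiagram.flip_comp, ← AffineDiagram.flip_comp] at this

/-- For `k = 0` every rotation is the identity diagram, whereas `u 0` represents a loop. Only `m =
0` can be admitted then. -/
theorem Rep.rot_mul {D : AffineDiagram l k} {x : A} (h : L.Rep l k D x) {d : ℕ}
    (hd : k + 2 * d = n) {m : ℤ} (hm : k = 0 → m = 0) :
    L.Rep l k ((rotDiagram k m).comp D) (L.rot k m * x) := by
  by_cases hk : k = 0
  · rw [hm hk, rot_zero_comp, rot_zero, one_mul]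
    exact h
  clear hm
  induction h with
  | rot k r _ =>
    rw [rot_comp_rot, ← rot_add hd hk _ _ (ideal_dead L k)]
    exact Rep.rot k _ hk
  | loops r => exact (hk rfl).elim
  | cup r h ih =>
    rw [rot_rot_comp, ← rot_add hd hk _ _ ((h.mem (by omega)).up (by omega))]
    exact Rep.cup _ h
  | cap r h ih =>
    rw [AffineDiagram.comp_assoc, AffineDiagram.comp_assoc, ← mul_assoc]
    exact Rep.cap r (ih hd hk)

/-- The number of outer points is kept as a variable, with a cast of `D`, so that induction on the
factorization applies. Caps on the right do not interfere with the added loop. -/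
theorem Rep.loop_mul {D : AffineDiagram l k} {x : A} (h : L.Rep l k D x) (hk : k = 0) :
    L.Rep l 0 (loopDiagram.comp (hk ▸ D)) (L.u 0 * x) := by
  induction h with
  | rot k r h => exact (h hk).elim
  | loops r d hd =>
    rw [loop_comp_loops, ← mul_assoc, ← pow_succ']
    exact Rep.loops _ d hd
  | cup r h ih => omega
  | cap r h ih =>
    subst hk
    rw [AffineDiagram.comp_assoc, AffineDiagram.comp_assoc, ← mul_assoc]
    exact Rep.cap r (ih rfl)

theorem Rep.cup_mul {D : AffineDiagram l k} {x : A} (h : L.Rep l k D x) :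
    L.Rep l (k + 2) ((cupDiagram k).comp D) x := by
  have := h.cup 0
  rwa [rot_zero_comp, rot_zero, one_mul] at this

/-- Every diagram is represented by an element of the algebra. -/
theorem exists_rep (L : TLSystem n A) {d d' : ℕ} (hl : l + 2 * d = n) (hk : k + 2 * d' = n)
    (D : AffineDiagram l k) : ∃ x, L.Rep l k D x := by
  induction hN : l + k using Nat.strong_induction_on generalizing l k d d' with
  | _ N ih =>
    -- The equality is heterogeneous since `k` is replaced by `k' + 2`.
    have key : ∀ {l k d d' : ℕ} (D : AffineDiagram l k) (p : ℤ), l + 2 * d = n → k + 2 * d' = n →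
        l + k = N → HasArc D p → ∃ (k' : ℕ) (m : ℤ) (_ : k = k' + 2) (D' : AffineDiagram l k'),
          HEq D ((rotDiagram (k' + 2) m).comp ((cupDiagram k').comp D')) := by
      intro l k d d' D p hl hk hN h
      obtain ⟨k', rfl⟩ : ∃ k', k = k' + 2 := ⟨k - 2, by have := h.two_le; omega⟩
      obtain ⟨D', hD⟩ := h.factor
      exact ⟨k', _, rfl, D', heq_of_eq hD⟩
    rcases D.decompose with ⟨p, hp⟩ | ⟨p, hp⟩ | ⟨rfl, h1, r, h2⟩ | ⟨rfl, rfl⟩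
    · obtain ⟨k', m, rfl, D', hD⟩ := key D p hl hk hN hp
      obtain ⟨x, hx⟩ := ih (l + k') (by omega) hl (d' := d' + 1) (by omega) D' rfl
      rw [eq_of_heq hD]
      exact ⟨_, hx.cup m⟩
    · obtain ⟨k', m, rfl, D', hD⟩ := key D.flip p hk hl (by omega) hp
      obtain ⟨x, hx⟩ := ih (k' + k) (by omega) (d := d + 1) (by omega) hk D'.flip rfl
      have h3 := congrArg AffineDiagram.flip (eq_of_heq hD)
      rw [AffineDiagram.flip_flip, AffineDiagram.flip_comp, AffineDiagram.flip_comp, rot_flip] at h3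
      rw [h3]
      exact ⟨_, hx.cap (-m)⟩
    -- The translation property speaks only of arcs from the inner to the outer side; inner arcs, if
    -- present, are split off first.
    · by_cases h3 : ∃ p, HasArc D.flip p
      · obtain ⟨p, hp⟩ := h3
        obtain ⟨k', m, rfl, D', hD⟩ := key D.flip p hk hl (by omega) hp
        obtain ⟨x, hx⟩ := ih (k' + (k' + 2)) (by omega) (d := d + 1) (by omega) hk D'.flip rfl
        have h3 := congrArg AffineDiagram.flip (eq_of_heq hD)
        rw [AffineDiagram.flip_flip, AffineDiagram.flip_comp, AffineDiagram.flip_comp, rot_flip] at h3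
        rw [h3]
        exact ⟨_, hx.cap (-m)⟩
      · by_cases hl0 : l = 0
        · subst hl0
          rw [eq_loopsDiagram D]
          -- Without points all `n ≥ 2` strands are dead, so there is at least one dead pair, and
          -- the constructor counts those beyond the first.
          exact ⟨_, Rep.loops _ (d - 1) (by have := L.two_le; omega)⟩
        · rw [eq_rot h1 h3 h2]
          exact ⟨_, Rep.rot l r hl0⟩
    · rw [eq_loopsDiagram D]
      exact ⟨_, Rep.loops _ (d - 1) (by have := L.two_le; omega)⟩

/-! ### Independence of the factorization -/

/-- Representatives of `(l, k)`-diagrams are unique. -/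
def Uniq (n l k : ℕ) : Prop := ∀ (A : Type) [Ring A] [Algebra ℂ A] (L : TLSystem n A)
  (D : AffineDiagram l k) (x y : A), L.Rep l k D x → L.Rep l k D y → x = y

/-- Up to full rotations, the position of one short arc relative to another: equal (`0`), sharing an
end point (`1` and `-1`), or disjoint (`2` to `k`). -/
theorem exists_residue (k : ℕ) (m : ℤ) : ∃ c j : ℤ, m = c + (k + 2 : ℕ) * j ∧
    (c = 0 ∨ c = 1 ∨ (c = -1 ∧ k ≠ 0) ∨ (2 ≤ c ∧ c ≤ k)) := by
  obtain ⟨q, r, h1, h2, h3⟩ := exists_div (k := k + 2) (by omega) m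
  -- The residue `k + 1` is written as `-1`, except for `k = 0`, where it is listed as `1`.
  by_cases h4 : r = k + 1 ∧ k ≠ 0
  · exact ⟨-1, q + 1, by rw [h1, h4.1]; push_cast; ring, by omega⟩
  · refine ⟨r, q, by rw [h1]; ring, ?_⟩
    push_cast at h3
    omega

/-- A full rotation of a represented diagram below a cup. -/
theorem Rep.cup_residue {D : AffineDiagram l k} {x : A} (h : L.Rep l k D x) {d : ℕ}
    (hd : k + 2 + 2 * d = n) (m : ℤ) : ∃ (c : ℤ) (D' : AffineDiagram l k) (x' : A),
    (c = 0 ∨ c = 1 ∨ (c = -1 ∧ k ≠ 0) ∨ (2 ≤ c ∧ c ≤ k)) ∧ L.Rep l k D' x' ∧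
    (rotDiagram (k + 2) m).comp ((cupDiagram k).comp D) =
      (rotDiagram (k + 2) c).comp ((cupDiagram k).comp D') ∧
    L.rot (k + 2) m * x = L.rot (k + 2) c * x' := by
  obtain ⟨c, j, hm, hc⟩ := exists_residue k m
  have hx := h.mem (by omega)
  refine ⟨c, _, _, hc, h.rot_mul (d := d + 1) (by omega) (m := k * j)
    (fun h => by rw [h, Nat.cast_zero, zero_mul]), ?_, ?_⟩
  · rw [hm, ← rot_rot_comp, AffineDiagram.comp_assoc _ (cupDiagram k), rot_cup,
      ← AffineDiagram.comp_assoc]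
  · rw [hm, rot_add hd (by omega) _ _ (hx.up (by omega)), rot_full hd _ hx]

/-- The two short arcs are compared modulo full rotations. If they coincide, the cup cancels; if
they are disjoint, both are split off, and the induction hypothesis rewrites both representatives in
terms of one of the remaining diagram `D₄`. Then `rot_rot_mul` compares the two orders of the cups.
-/
theorem uniq_cup_cup {N : ℕ} (ih : ∀ l k, l + k < N →
    (∃ d, l + 2 * d = n) → (∃ d, k + 2 * d = n) → Uniq n l k) (hN : l + (k + 2) = N) {d d' : ℕ}
    (hl : l + 2 * d' = n) (hd : k + 2 + 2 * d = n) {D₁ D₂ : AffineDiagram l k} {x₁ x₂ : A}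
    (h₁ : L.Rep l k D₁ x₁) (h₂ : L.Rep l k D₂ x₂) {m₁ m₂ : ℤ}
    (h : (rotDiagram (k + 2) m₁).comp ((cupDiagram k).comp D₁) =
      (rotDiagram (k + 2) m₂).comp ((cupDiagram k).comp D₂)) :
    L.rot (k + 2) m₁ * x₁ = L.rot (k + 2) m₂ * x₂ := by
  have hx₁ := (h₁.mem (by omega)).up (k := k) (by omega)
  have hx₂ := (h₂.mem (by omega)).up (k := k) (by omega)
  suffices hs : x₁ = L.rot (k + 2) (m₂ - m₁) * x₂ by
    rw [hs, ← rot_add hd (by omega) _ _ hx₂, add_sub_cancel]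
  have h3 : (cupDiagram k).comp D₁ = (rotDiagram (k + 2) (m₂ - m₁)).comp ((cupDiagram k).comp D₂) := by
    have := congrArg (rotDiagram (k + 2) (-m₁)).comp h
    rwa [rot_rot_comp, rot_rot_comp, neg_add_cancel, rot_zero_comp, neg_add_eq_sub] at this
  clear h
  obtain ⟨c, D, x, hc, h₂', h4, h5⟩ := h₂.cup_residue hd (m₂ - m₁)
  rw [h5]
  rw [h4] at h3
  have a1 := hasArc_cup D₁
  have a2 := (hasArc_cup D).rot c
  rw [← h3] at a2
  rcases hc with rfl | rfl | ⟨rfl, -⟩ | ⟨hc2, hck⟩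
  · rw [rot_zero_comp] at h3
    rw [rot_zero, one_mul]
    exact ih l k (by omega) ⟨d', hl⟩ ⟨d + 1, by omega⟩ A L D x₁ x (cup_injective h3 ▸ h₁) h₂'
  -- For `c = 1` and for `c = -1` two different arcs would share an end point.
  · exact (a1.not_succ a2).elim
  · exact (a2.not_succ (by rwa [neg_add_cancel_right])).elim
  · obtain ⟨k, rfl⟩ : ∃ j, k = j + 2 := ⟨k - 2, by omega⟩
    have hck' : c ≤ k + 2 := by push_cast at hck; exact hck
    -- What remains of the diagram when both arcs are removed.
    set D₄ : AffineDiagram l k := (capDiagram k).comp ((rotDiagram (k + 2) (c - 2)).comp D) with hD₄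
    have e1 : D₁ = (rotDiagram (k + 2) c).comp ((cupDiagram k).comp
        ((rotDiagram k (2 - c)).comp D₄)) := by
      have h6 := cap_rot_cup k hc2 hck'
      have h7 := congrArg (fun E => E.comp D) h6
      simp only [← AffineDiagram.comp_assoc] at h7
      rw [← h3, cap_cup_comp] at h7
      rw [h7]
    have e2 : D = (rotDiagram (k + 2) (2 - c)).comp ((cupDiagram k).comp D₄) := by
      have h6 := congrArg (fun E => E.comp D₄) (cup_rot_cup k hc2 hck')
      simp only [← AffineDiagram.comp_assoc] at h6
      rw [← e1, h3] at h6
      have h7 := congrArg (rotDiagram (k + 2 + 2) (-c)).comp h6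
      rw [rot_rot_comp, rot_rot_comp, neg_add_cancel, rot_zero_comp, rot_zero_comp] at h7
      exact cup_injective h7
    obtain ⟨y, hy⟩ := exists_rep L hl (d' := d + 2) (by omega) D₄
    have hyI := hy.mem (by omega)
    have f1 : x = L.rot (k + 2) (2 - c) * y :=
      ih l (k + 2) (by omega) ⟨d', hl⟩ ⟨d + 1, by omega⟩ A L D _ _ h₂' (e2 ▸ hy.cup (2 - c))
    have f2 : x₁ = L.rot (k + 2) c * (L.rot k (2 - c) * y) := by
      refine ih l (k + 2) (by omega) ⟨d', hl⟩ ⟨d + 1, by omega⟩ A L D₁ _ _ h₁ ?_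
      rw [e1]
      refine (hy.rot_mul (d := d + 2) (by omega) ?_).cup c
      -- Without strands the bounds force `c = 2`, so the rotation by `2 - c` is trivial.
      rintro rfl
      push_cast at hck'
      omega
    rw [f1, f2]
    exact rot_rot_mul (d := d) (by omega) hc2 hck' hyI

/-- An outer and an inner arc never meet: both are split off, leaving `D₃`, and the two orders of
doing so are left and right multiplications, which commute by associativity. -/
theorem uniq_cup_cap {N : ℕ} (ih : ∀ l k, l + k < N →
    (∃ d, l + 2 * d = n) → (∃ d, k + 2 * d = n) → Uniq n l k) (hN : l + 2 + (k + 2) = N)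
    {d d' : ℕ} (hl : l + 2 + 2 * d' = n) (hd : k + 2 + 2 * d = n) {D₁ : AffineDiagram (l + 2) k}
    {D₂ : AffineDiagram l (k + 2)} {x₁ x₂ : A}
    (h₁ : L.Rep (l + 2) k D₁ x₁) (h₂ : L.Rep l (k + 2) D₂ x₂) {m₁ m₂ : ℤ}
    (h : (rotDiagram (k + 2) m₁).comp ((cupDiagram k).comp D₁) =
      (D₂.comp (capDiagram l)).comp (rotDiagram (l + 2) m₂)) :
    L.rot (k + 2) m₁ * x₁ = x₂ * L.rotRight (l + 2) m₂ := by
  set D₃ : AffineDiagram l k := (capDiagram k).comp ((rotDiagram (k + 2) (-m₁)).comp D₂) with hD₃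
  have e1 : D₁ = (D₃.comp (capDiagram l)).comp (rotDiagram (l + 2) m₂) := by
    rw [hD₃]
    simp only [← AffineDiagram.comp_assoc] at h ⊢
    rw [← h, rot_rot_comp, neg_add_cancel, rot_zero_comp, cap_cup_comp]
  have e2 : D₂ = (rotDiagram (k + 2) m₁).comp ((cupDiagram k).comp D₃) := by
    have h1 := congrArg (fun E => (E.comp (rotDiagram (l + 2) (-m₂))).comp (cupDiagram l)) h
    rw [e1] at h1
    simp only [← AffineDiagram.comp_assoc] at h1
    simp only [rot_rot_comp, add_neg_cancel, rot_zero_comp, cap_cup, AffineDiagram.comp_id] at h1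
    exact h1.symm
  obtain ⟨y, hy⟩ := exists_rep L (l := l) (d := d' + 1) (by omega) (d' := d + 1) (by omega) D₃
  rw [ih _ _ (by omega) ⟨d', hl⟩ ⟨d + 1, by omega⟩ A L D₁ x₁ _ h₁ (e1 ▸ hy.cap m₂),
    ih _ _ (by omega) ⟨d' + 1, by omega⟩ ⟨d, hd⟩ A L D₂ x₂ _ h₂ (e2 ▸ hy.cup m₁), mul_assoc]

theorem rot_no_cup {D : AffineDiagram (k + 2) k} {r m : ℤ} :
    rotDiagram (k + 2) r ≠ (rotDiagram (k + 2) m).comp ((cupDiagram k).comp D) := by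
  intro h
  obtain ⟨hk, h1⟩ := (hasArc_cup D).rot m
  rw [← h] at h1
  exact Sum.inl_ne_inr h1

theorem rot_no_cap {D : AffineDiagram k (k + 2)} {r m : ℤ} :
    rotDiagram (k + 2) r ≠ (D.comp (capDiagram k)).comp (rotDiagram (k + 2) m) := by
  intro h
  have h1 := congrArg AffineDiagram.flip h
  rw [AffineDiagram.flip_comp, AffineDiagram.flip_comp, rot_flip, rot_flip, cap_flip] at h1
  exact rot_no_cup h1

theorem rotDiagram_injective (hk : k ≠ 0) {r s : ℤ} (h : rotDiagram k r = rotDiagram k s) :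
    r = s := by
  have h1 := congrArg (fun D : AffineDiagram k k => D.mate (Sum.inl ⟨0, hk⟩)) h
  have h2 : (0 : ℤ) + r = 0 + s := congrArg MarkedPt.pos (Sum.inr_injective h1)
  linarith

/-- Comparison of the last steps of two factorizations, by induction on the number of points. `Uniq`
ranges over all algebras since two caps are compared as cups in the opposite algebra. -/
theorem uniq {d d' : ℕ} (hl : l + 2 * d = n) (hk : k + 2 * d' = n) : Uniq n l k := by
  induction hN : l + k using Nat.strong_induction_on generalizing l k d d' with
  | _ N ih =>
    have ih' : ∀ l k, l + k < N → (∃ d, l + 2 * d = n) → (∃ d, k + 2 * d = n) → Uniq n l k :=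
      fun l k h ⟨d, hd⟩ ⟨d', hd'⟩ => ih _ h hd hd' rfl
    intro A _ _ L D x y h₁ h₂
    -- The two factorizations must not share the index `D`, otherwise case analysis of the second
    -- one is blocked.
    generalize hE : D = E at h₂
    cases h₁ with
    | rot k r hk0 =>
      cases h₂ with
      | rot k s _ => rw [rotDiagram_injective hk0 hE]
      | loops => exact (hk0 rfl).elim
      | cup m h => exact (rot_no_cup hE).elim
      | cap m h => exact (rot_no_cap hE).elim
    | loops r =>
      cases h₂ with
      | rot _ _ h => exact (h rfl).elim
      | loops s => rw [show r = s from congrArg AffineDiagram.loops hE]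
    | cup m h =>
      cases h₂ with
      | rot k s _ => exact (rot_no_cup hE.symm).elim
      | cup m' h' => exact uniq_cup_cup ih' hN hl hk h h' hE
      | cap m' h' => exact uniq_cup_cap ih' hN hl hk h h' hE
    | cap m h =>
      cases h₂ with
      | rot k s _ => exact (rot_no_cap hE.symm).elim
      | cup m' h' => exact (uniq_cup_cap ih' hN hl hk h' h hE.symm).symm
      | cap m' h' =>
        -- Two caps become two cups after reflection.
        have h3 := congrArg AffineDiagram.flip hE
        simp only [AffineDiagram.flip_comp, rot_flip, cap_flip] at h3
        have := uniq_cup_cup (L := L.op) ih' (by omega) hk hl h.flip h'.flip h3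
        rw [op_rot, op_rot, neg_neg, neg_neg, ← MulOpposite.op_mul, ← MulOpposite.op_mul] at this
        exact MulOpposite.op_injective this

theorem Rep.unique {D : AffineDiagram l k} {x y : A} (h₁ : L.Rep l k D x) (h₂ : L.Rep l k D y)
    {d d' : ℕ} (hl : l + 2 * d = n) (hk : k + 2 * d' = n) : x = y :=
  uniq hl hk A L D x y h₁ h₂

end TLSystem


/-! ### Relations in the affine Temperley–Lieb category -/

/-- A diagram as a linear combination of diagrams. -/
noncomputable def hom {l k : ℕ} (D : AffineDiagram l k) : AffineDiagram l k →₀ ℂ :=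
  Finsupp.single D 1

section Relations

variable {s : ℂ} {j k l m : ℕ}

theorem hom_comp_weight (E : AffineDiagram l k) (D : AffineDiagram j l) :
    linComp s (hom E) (hom D) = loopWeight s ^ contractibleLoops E D • hom (E.comp D) := by
  rw [hom, hom, linComp_single, hom, Finsupp.smul_single, smul_eq_mul, one_mul, one_mul, mul_one]

theorem hom_comp {E : AffineDiagram l k} {D : AffineDiagram j l} (h : contractibleLoops E D = 0) :
    linComp s (hom E) (hom D) = hom (E.comp D) := by
  rw [hom_comp_weight, h, pow_zero, one_smul]

theorem rot_hom (r : ℤ) (D : AffineDiagram l k) :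
    linComp s (hom (rotDiagram k r)) (hom D) = hom ((rotDiagram k r).comp D) :=
  hom_comp ((rot_straight k r).loops D).1

theorem cup_hom (D : AffineDiagram l k) :
    linComp s (hom (cupDiagram k)) (hom D) = hom ((cupDiagram k).comp D) :=
  hom_comp ((cup_straight k).loops D).1

theorem hom_rot (D : AffineDiagram l k) (r : ℤ) :
    linComp s (hom D) (hom (rotDiagram l r)) = hom (D.comp (rotDiagram l r)) :=
  hom_comp (comp_rot_loops D r).1

theorem hom_cap (D : AffineDiagram l k) :
    linComp s (hom D) (hom (capDiagram l)) = hom (D.comp (capDiagram l)) :=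
  hom_comp (comp_cap_loops D).1

theorem loop_hom (D : AffineDiagram l 0) :
    linComp s (hom loopDiagram) (hom D) = hom (loopDiagram.comp D) :=
  hom_comp (loop_comp D).2

theorem id_hom (f : AffineDiagram l k →₀ ℂ) : linComp s (hom (idDiagram k)) f = f :=
  id_linComp s f

theorem hom_id (f : AffineDiagram l k →₀ ℂ) : linComp s f (hom (idDiagram l)) = f :=
  linComp_id s f

theorem rot_lin_add (a b : ℤ) :
    linComp s (hom (rotDiagram k a)) (hom (rotDiagram k b)) = hom (rotDiagram k (a + b)) := by
  rw [rot_hom, rot_comp_rot]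

theorem cap_cup_lin (f : AffineDiagram l k →₀ ℂ) :
    linComp s (hom (capDiagram k)) (linComp s (hom (cupDiagram k)) f) = loopWeight s • f := by
  have h := hasArc_cup (idDiagram k)
  rw [AffineDiagram.comp_id] at h
  rw [linComp_assoc, hom_comp_weight, h.contractibleLoops_cap, pow_one, cap_cup, linComp_smul_left,
    id_hom]

theorem cap_rot_cup_one_lin (hk : k ≠ 0) (f : AffineDiagram l k →₀ ℂ) :
    linComp s (hom (capDiagram k)) (linComp s (hom (rotDiagram (k + 2) 1))
      (linComp s (hom (cupDiagram k)) f)) = linComp s (hom (rotDiagram k 1)) f := by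
  rw [linComp_assoc s _ _ f, rot_hom, linComp_assoc, hom_comp (cap_rot_cup_one_loops hk).1,
    cap_rot_cup_one hk]

theorem cap_rot_cup_neg_one_lin (hk : k ≠ 0) (f : AffineDiagram l k →₀ ℂ) :
    linComp s (hom (capDiagram k)) (linComp s (hom (rotDiagram (k + 2) (-1)))
      (linComp s (hom (cupDiagram k)) f)) = linComp s (hom (rotDiagram k (-1))) f := by
  rw [linComp_assoc s _ _ f, rot_hom, linComp_assoc, hom_comp (cap_rot_cup_neg_one_loops hk),
    cap_rot_cup_neg_one hk]

theorem cap_rot_cup_zero_lin (f : AffineDiagram l 0 →₀ ℂ) :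
    linComp s (hom (capDiagram 0)) (linComp s (hom (rotDiagram 2 1))
      (linComp s (hom (cupDiagram 0)) f)) = linComp s (hom loopDiagram) f := by
  rw [linComp_assoc s _ _ f, rot_hom, linComp_assoc, hom_comp cap_rot_cup_zero_loops.1,
    cap_rot_cup_zero]

theorem cap_rot_cup_lin {r : ℤ} (h2 : 2 ≤ r) (hr : r ≤ k + 2) (f : AffineDiagram l (k + 2) →₀ ℂ) :
    linComp s (hom (capDiagram (k + 2))) (linComp s (hom (rotDiagram (k + 2 + 2) r))
      (linComp s (hom (cupDiagram (k + 2))) f)) =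
    linComp s (hom (rotDiagram (k + 2) r)) (linComp s (hom (cupDiagram k))
      (linComp s (hom (rotDiagram k (2 - r))) (linComp s (hom (capDiagram k))
        (linComp s (hom (rotDiagram (k + 2) (r - 2))) f)))) := by
  simp only [linComp_assoc]
  congr 1
  simp only [← linComp_assoc]
  rw [rot_hom, hom_comp (cap_rot_cup_loops k h2 hr).1, cap_rot_cup k h2 hr, hom_rot, rot_hom,
    cup_hom, rot_hom]

end Relations

/-! ### The action of the algebra -/

theorem linearMap_hom_ext {V : Type} [AddCommGroup V] [Module ℂ V] {l k : ℕ}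
    {F G : (AffineDiagram l k →₀ ℂ) →ₗ[ℂ] V} (h : ∀ D, F (hom D) = G (hom D)) : F = G :=
  Finsupp.lhom_ext' fun D => LinearMap.ext_ring (h D)

/-- The composition with `f` on the left as a linear map. -/
noncomputable def linLeft (s : ℂ) {j k l : ℕ} (f : AffineDiagram l k →₀ ℂ) :
    (AffineDiagram j l →₀ ℂ) →ₗ[ℂ] (AffineDiagram j k →₀ ℂ) where
  toFun := linComp s f
  map_add' := linComp_add_right s f
  map_smul' c := linComp_smul_right s c f

/-- The composition with `g` on the right as a linear map. -/
noncomputable def linRight (s : ℂ) {j k l : ℕ} (g : AffineDiagram j l →₀ ℂ) :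
    (AffineDiagram l k →₀ ℂ) →ₗ[ℂ] (AffineDiagram j k →₀ ℂ) where
  toFun f := linComp s f g
  map_add' f f' := linComp_add_left s f f' g
  map_smul' c f := linComp_smul_left s c f g

namespace TLSystem

variable {n : ℕ} {A : Type} [Ring A] [Algebra ℂ A] {L : TLSystem n A} {s : ℂ} {l k d d' : ℕ}

open Classical in
/-- The representative of a diagram. -/
noncomputable def psi (L : TLSystem n A) {l k : ℕ} (D : AffineDiagram l k) : A :=
  if h : ∃ x, L.Rep l k D x then h.choose else 0

theorem psi_rep (L : TLSystem n A) (hl : l + 2 * d' = n) (hk : k + 2 * d = n)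
    (D : AffineDiagram l k) : L.Rep l k D (L.psi D) := by
  have h := exists_rep L hl hk D
  rw [psi, dif_pos h]
  exact h.choose_spec

theorem Rep.psi_eq {D : AffineDiagram l k} {x : A} (h : L.Rep l k D x) (hl : l + 2 * d' = n)
    (hk : k + 2 * d = n) : L.psi D = x :=
  (psi_rep L hl hk D).unique h hl hk

/-- The linear extension of `psi`. -/
noncomputable def Psi (L : TLSystem n A) (l k : ℕ) : (AffineDiagram l k →₀ ℂ) →ₗ[ℂ] A :=
  Finsupp.linearCombination ℂ L.psi

theorem Psi_hom (D : AffineDiagram l k) : L.Psi l k (hom D) = L.psi D := by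
  rw [Psi, hom, Finsupp.linearCombination_single, one_smul]

theorem Psi_left {k' : ℕ} {g : AffineDiagram k k' →₀ ℂ} {a : A}
    (h : ∀ D, L.Psi l k' (linComp s g (hom D)) = a * L.Psi l k (hom D))
    (f : AffineDiagram l k →₀ ℂ) : L.Psi l k' (linComp s g f) = a * L.Psi l k f :=
  LinearMap.congr_fun (linearMap_hom_ext (F := L.Psi l k' ∘ₗ linLeft s g)
    (G := LinearMap.mulLeft ℂ a ∘ₗ L.Psi l k) h) f

theorem Psi_rot (hl : l + 2 * d' = n) (hk : k + 2 * d = n) {r : ℤ} (hr : k = 0 → r = 0)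
    (f : AffineDiagram l k →₀ ℂ) :
    L.Psi l k (linComp s (hom (rotDiagram k r)) f) = L.rot k r * L.Psi l k f := by
  refine Psi_left (fun D => ?_) f
  rw [rot_hom, Psi_hom, Psi_hom]
  exact ((psi_rep L hl hk D).rot_mul hk hr).psi_eq hl hk

theorem Psi_loop (hl : l + 2 * d' = n) (hk : 0 + 2 * d = n) (f : AffineDiagram l 0 →₀ ℂ) :
    L.Psi l 0 (linComp s (hom loopDiagram) f) = L.u 0 * L.Psi l 0 f := by
  refine Psi_left (fun D => ?_) f
  rw [loop_hom, Psi_hom, Psi_hom]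
  exact ((psi_rep L hl hk D).loop_mul rfl).psi_eq hl hk

theorem Psi_cup (hl : l + 2 * d' = n) (hk : k + 2 + 2 * d = n) (f : AffineDiagram l k →₀ ℂ) :
    L.Psi l (k + 2) (linComp s (hom (cupDiagram k)) f) = L.Psi l k f := by
  rw [← one_mul (L.Psi l k f)]
  refine Psi_left (fun D => ?_) f
  rw [cup_hom, Psi_hom, Psi_hom, one_mul]
  exact (psi_rep L hl (d := d + 1) (by omega) D).cup_mul.psi_eq hl hk

theorem Psi_right (hl : l + 2 + 2 * d' = n) (hk : k + 2 * d = n) (r : ℤ)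
    (f : AffineDiagram l k →₀ ℂ) :
    L.Psi (l + 2) k (linComp s (linComp s f (hom (capDiagram l))) (hom (rotDiagram (l + 2) r))) =
      L.Psi l k f * L.rotRight (l + 2) r := by
  refine LinearMap.congr_fun (linearMap_hom_ext
    (F := L.Psi (l + 2) k ∘ₗ linRight s (hom (rotDiagram (l + 2) r)) ∘ₗ linRight s (hom (capDiagram l)))
    (G := LinearMap.mulRight ℂ (L.rotRight (l + 2) r) ∘ₗ L.Psi l k) fun D => ?_) f
  change L.Psi (l + 2) k (linComp s (linComp s (hom D) (hom (capDiagram l)))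
    (hom (rotDiagram (l + 2) r))) = L.Psi l k (hom D) * L.rotRight (l + 2) r
  rw [hom_cap, hom_rot, Psi_hom, Psi_hom]
  exact ((psi_rep L (l := l) (d' := d' + 1) (by omega) hk D).cap r).psi_eq hl hk

theorem Psi_mem (hl : l + 2 * d' = n) (hk : k + 2 * d = n) (f : AffineDiagram l k →₀ ℂ) :
    L.Ideal k (L.Psi l k f) := by
  induction f using Finsupp.induction_linear with
  | zero => exact ⟨0, by rw [map_zero, mul_zero]⟩
  | add f g hf hg =>
    obtain ⟨x, hx⟩ := hf
    obtain ⟨y, hy⟩ := hg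
    exact ⟨x + y, by rw [map_add, hx, hy, mul_add]⟩
  | single D c =>
    obtain ⟨x, hx⟩ := (psi_rep L hl hk D).mem (by omega)
    exact ⟨c • x, by rw [Psi, Finsupp.linearCombination_single, hx, mul_smul_comm]⟩

theorem Psi_id (hk : k + 2 * d = n) : L.Psi k k (hom (idDiagram k)) = L.dead k := by
  rw [Psi_hom]
  by_cases h : k = 0
  · subst h
    have h1 := Rep.loops (L := L) 0 (d - 1) (by have := L.two_le; omega)
    rw [pow_zero, one_mul] at h1
    rw [eq_loopsDiagram (idDiagram 0)]
    exact h1.psi_eq hk hk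
  · have h1 := Rep.rot (L := L) k 0 h
    rw [rot_zero, one_mul] at h1
    exact h1.psi_eq hk hk

/-- According to the position of the cup relative to the cap, there arises a contractible loop (the
weight), a straightened zigzag (one turn), a noncontractible loop (one turn and `k = 0`), or the cap
passes the cup. The last case uses `ih` for the smaller cap and the identity `e_rot_far`. -/
theorem Psi_cap_cup (hs : L.weight = loopWeight s) (hl : l + 2 * d' = n) (hk : k + 2 + 2 * d = n)
    (ih : ∀ i, i < k → ∀ j, i + 2 + 2 * j = n → ∀ D : AffineDiagram l (i + 2),
      L.Psi l i (linComp s (hom (capDiagram i)) (hom D)) = L.e i * L.Psi l (i + 2) (hom D))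
    (r : ℤ) (D : AffineDiagram l k) :
    L.Psi l k (linComp s (hom (capDiagram k))
      (hom ((rotDiagram (k + 2) r).comp ((cupDiagram k).comp D)))) =
    L.e k * L.Psi l (k + 2) (hom ((rotDiagram (k + 2) r).comp ((cupDiagram k).comp D))) := by
  have hk' : k + 2 * (d + 1) = n := by omega
  obtain ⟨c, D', x, hc, hx, h1, -⟩ := (psi_rep L hl hk' D).cup_residue hk r
  rw [h1]
  clear h1
  rw [← rot_hom (s := s), Psi_rot hl hk (by omega), ← cup_hom (s := s), Psi_cup hl hk]
  have hD := Psi_mem (L := L) hl hk' (hom D')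
  rcases hc with rfl | rfl | ⟨rfl, h0⟩ | ⟨hc2, hck⟩
  · rw [rot_zero, one_mul]
    change L.Psi l k (linComp s _ (linComp s (hom (idDiagram (k + 2))) _)) = _
    rw [id_hom, cap_cup_lin, map_smul, hD.e_mul_self (by omega), hs]
  · rw [rot, intPow_one, ← mul_assoc, ← u_step (by omega)]
    -- The same element `e k * u (k + 2) = u k` stands for a loop or for a rotation, depending on
    -- whether strands remain.
    by_cases h0 : k = 0
    · subst h0
      rw [cap_rot_cup_zero_lin, Psi_loop hl hk']
    · rw [cap_rot_cup_one_lin h0, Psi_rot hl hk' (by omega), rot, intPow_one]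
  · rw [rot, intPow_neg_one, ← mul_assoc, ← v_step (by omega), cap_rot_cup_neg_one_lin h0,
      Psi_rot hl hk' (by omega), rot, intPow_neg_one]
  · obtain ⟨k, rfl⟩ : ∃ j, k = j + 2 := ⟨k - 2, by omega⟩
    have hck' : c ≤ k + 2 := by push_cast at hck; exact hck
    have h0 : k = 0 → 2 - c = 0 := by omega
    rw [cap_rot_cup_lin hc2 hck', Psi_rot hl hk' (by omega), Psi_cup hl hk',
      Psi_rot hl (d := d + 2) (by omega) h0, rot_hom, ih k (by omega) (d + 1) (by omega),
      ← rot_hom (s := s), Psi_rot hl hk' (by omega)]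
    exact (e_rot_far (by omega) hc2 hck' hD).symm

/-- The last factor of `D` decides: a cup is treated by `Psi_cap_cup`, and a cap on the inner side
commutes with the action from the left, so the number of points drops. -/
theorem Psi_cap_hom (hs : L.weight = loopWeight s) (hl : l + 2 * d' = n) (hk : k + 2 + 2 * d = n)
    (D : AffineDiagram l (k + 2)) :
    L.Psi l k (linComp s (hom (capDiagram k)) (hom D)) = L.e k * L.Psi l (k + 2) (hom D) := by
  induction hN : l + k using Nat.strong_induction_on generalizing l k d d' with
  | _ N ih =>
    have hk' : k + 2 * (d + 1) = n := by omega
    have h := psi_rep L hl hk D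
    generalize L.psi D = x at h
    cases h with
    | rot _ r _ =>
      -- A cap after a rotation is the identity of `k` strands with a cap and a rotation on its
      -- inner side; `rot_dead` makes the same change on the side of the algebra.
      rw [← linComp_id s (hom (rotDiagram (k + 2) r)), ← hom, Psi_rot hl hk (by omega), Psi_id hk,
        rot_dead, ← mul_assoc, ← L.dead_step (by omega), ← Psi_id hk', ← Psi_right (s := s) hl hk',
        id_hom, hom_id]
    | cup r h =>
      exact Psi_cap_cup hs hl hk (fun i hi j hj D => ih (l + i) (by omega) hl hj D rfl) r _
    | @cap l _ D' _ r h =>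
      rw [← hom_rot (s := s), ← hom_cap (s := s), linComp_assoc, linComp_assoc, Psi_right hl hk',
        ih (l + k) (by omega) (d' := d' + 1) (by omega) hk D' rfl, Psi_right hl hk, mul_assoc]

theorem Psi_cap (hs : L.weight = loopWeight s) (hl : l + 2 * d' = n) (hk : k + 2 + 2 * d = n)
    (f : AffineDiagram l (k + 2) →₀ ℂ) :
    L.Psi l k (linComp s (hom (capDiagram k)) f) = L.e k * L.Psi l (k + 2) f :=
  Psi_left (Psi_cap_hom hs hl hk) f

end TLSystem


/-! ### Generation of the endomorphism algebras -/

/-- The reflection of linear combinations of diagrams. -/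
noncomputable def flipLin (l k : ℕ) : (AffineDiagram l k →₀ ℂ) →ₗ[ℂ] (AffineDiagram k l →₀ ℂ) :=
  Finsupp.lmapDomain ℂ ℂ AffineDiagram.flip

theorem flipLin_hom {l k : ℕ} (D : AffineDiagram l k) : flipLin l k (hom D) = hom D.flip :=
  Finsupp.mapDomain_single

theorem flipLin_comp {s : ℂ} {j l k : ℕ} (f : AffineDiagram l k →₀ ℂ)
    (g : AffineDiagram j l →₀ ℂ) :
    flipLin j k (linComp s f g) = linComp s (flipLin j l g) (flipLin l k f) := by
  induction f using Finsupp.induction_linear with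
  | zero => simp only [linComp_zero_left, linComp_zero_right, map_zero]
  | add f f' hf hf' => simp only [linComp_add_left, linComp_add_right, map_add, hf, hf']
  | single E x =>
    induction g using Finsupp.induction_linear with
    | zero => simp only [linComp_zero_left, linComp_zero_right, map_zero]
    | add f f' hf hf' => simp only [linComp_add_left, linComp_add_right, map_add, hf, hf']
    | single D y =>
      simp only [flipLin, Finsupp.lmapDomain_apply, linComp_single, Finsupp.mapDomain_single,
        AffineDiagram.flip_comp, contractibleLoops_flip, mul_comm x y]

theorem EndTL.mul_eq {s : ℂ} {n : ℕ} (x y : EndTL s n) : x * y = linComp s x y := rfl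

theorem EndTL.algebraMap_eq {s : ℂ} {n : ℕ} (c : ℂ) :
    (algebraMap ℂ (EndTL s n) c : AffineDiagram n n →₀ ℂ) = c • hom (idDiagram n) :=
  Algebra.algebraMap_eq_smul_one (A := EndTL s n) c

/-- The subalgebra generated by a rotation, its inverse, and a composition of a cup and a cap. -/
noncomputable def genAlg (s : ℂ) (N : ℕ) : Subalgebra ℂ (EndTL s (N + 2)) :=
  Algebra.adjoin ℂ {diag s (rotDiagram (N + 2) 1), diag s (rotDiagram (N + 2) (-1)),
    diag s ((cupDiagram N).comp (capDiagram N))}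

theorem flipLin_mem {s : ℂ} {N : ℕ} {x : EndTL s (N + 2)} (h : x ∈ genAlg s N) :
    (flipLin (N + 2) (N + 2) x : EndTL s (N + 2)) ∈ genAlg s N := by
  induction h using Algebra.adjoin_induction with
  | mem x hx =>
    refine Algebra.subset_adjoin ?_
    rcases hx with rfl | rfl | rfl
    · exact Or.inr (Or.inl ((flipLin_hom _).trans (congrArg hom (rot_flip _ _))))
    · exact Or.inl ((flipLin_hom _).trans (congrArg hom (rot_flip _ _)))
    · refine Or.inr (Or.inr ((flipLin_hom _).trans (congrArg hom ?_)))
      rw [AffineDiagram.flip_comp, cap_flip, capDiagram]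
  | algebraMap c =>
    refine (congrArg (· ∈ genAlg s N) ?_).mpr (algebraMap_mem _ c)
    rw [EndTL.algebraMap_eq, map_smul, flipLin_hom, idDiagram, rot_flip, neg_zero]
  | add x y _ _ hx hy =>
    rw [map_add]
    exact add_mem hx hy
  | mul x y _ _ hx hy =>
    rw [EndTL.mul_eq, flipLin_comp]
    exact mul_mem hy hx

/-- Compositions of cups. -/
inductive Cups (n : ℕ) : (k : ℕ) → AffineDiagram k n → Prop
  | refl : Cups n n (idDiagram n)
  | step {k : ℕ} {I : AffineDiagram (k + 2) n} (h : Cups n (k + 2) I) :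
      Cups n k (I.comp (cupDiagram k))

theorem Cups.le {n k : ℕ} {I : AffineDiagram k n} (h : Cups n k I) : k ≤ n := by
  induction h with
  | refl => exact le_rfl
  | step h ih => omega

theorem Cups.straight {n k : ℕ} {I : AffineDiagram k n} (h : Cups n k I) : ∃ f, Straight I f := by
  induction h with
  | refl => exact ⟨_, rot_straight n 0⟩
  | step h ih =>
    obtain ⟨f, hf⟩ := ih
    exact ⟨_, hf.comp (cup_straight _)⟩

/-! ### Carrying endomorphisms through cups -/

section Stable

variable {s : ℂ} {N k : ℕ}

/-- The endomorphisms `f` of `k` that can be moved through `I`. -/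
def Stable (s : ℂ) (N : ℕ) {k : ℕ} (I : AffineDiagram k (N + 2)) (f : AffineDiagram k k →₀ ℂ) :
    Prop := ∃ a ∈ genAlg s N, linComp s (hom I) f = linComp s a (hom I)

variable {I : AffineDiagram k (N + 2)}

theorem Stable.comp {f g : AffineDiagram k k →₀ ℂ} (hf : Stable s N I f) (hg : Stable s N I g) :
    Stable s N I (linComp s f g) := by
  obtain ⟨a, ha, h1⟩ := hf
  obtain ⟨b, hb, h2⟩ := hg
  exact ⟨a * b, mul_mem ha hb, by
    rw [linComp_assoc, h1, ← linComp_assoc, h2, linComp_assoc, EndTL.mul_eq]⟩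

theorem Cups.hom_step {I : AffineDiagram (k + 2) (N + 2)} (h : Cups (N + 2) (k + 2) I) :
    hom (I.comp (cupDiagram k)) = linComp s (hom I) (hom (cupDiagram k)) := by
  obtain ⟨f, hf⟩ := h.straight
  exact (hom_comp (hf.loops _).1).symm

/-- An endomorphism that becomes a composition of stable ones above a cup is stable. -/
theorem Cups.stable_step {I : AffineDiagram (k + 2) (N + 2)} (h : Cups (N + 2) (k + 2) I)
    {f : AffineDiagram k k →₀ ℂ} {g : AffineDiagram (k + 2) (k + 2) →₀ ℂ} (hg : Stable s N I g)
    (hfg : linComp s (hom (cupDiagram k)) f = linComp s g (hom (cupDiagram k))) :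
    Stable s N (I.comp (cupDiagram k)) f := by
  obtain ⟨a, ha, h1⟩ := hg
  refine ⟨a, ha, ?_⟩
  rw [h.hom_step (s := s), ← linComp_assoc, hfg, linComp_assoc, h1, linComp_assoc]

/-- The rotations and the composition of a cup and a cap are stable. -/
theorem Cups.stable_aux {d : ℕ} : (∀ k (I : AffineDiagram k (N + 2)), k + 2 * d = N + 2 →
      Cups (N + 2) k I → k ≠ 0 → Stable s N I (hom (rotDiagram k 1)) ∧
        Stable s N I (hom (rotDiagram k (-1)))) ∧
    (∀ k (I : AffineDiagram (k + 2) (N + 2)), k + 2 + 2 * d = N + 2 → Cups (N + 2) (k + 2) I →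
      Stable s N I (linComp s (hom (cupDiagram k)) (hom (capDiagram k)))) := by
  induction d with
  | zero =>
    constructor
    · intro k I hk h _
      cases h with
      | refl =>
        exact ⟨⟨diag s (rotDiagram (N + 2) 1), Algebra.subset_adjoin (Or.inl rfl),
            (id_hom _).trans (hom_id (s := s) _).symm⟩,
          ⟨diag s (rotDiagram (N + 2) (-1)), Algebra.subset_adjoin (Or.inr (Or.inl rfl)),
            (id_hom _).trans (hom_id (s := s) _).symm⟩⟩
      | step h => have := h.le; omega
    · intro k I hk h
      cases h with
      | refl =>
        refine ⟨diag s ((cupDiagram N).comp (capDiagram N)),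
          Algebra.subset_adjoin (Or.inr (Or.inr rfl)), ?_⟩
        rw [cup_hom]
        exact (id_hom _).trans (hom_id (s := s) _).symm
      | step h => have := h.le; omega
  | succ d ih =>
    have h1 : ∀ k (I : AffineDiagram k (N + 2)), k + 2 * (d + 1) = N + 2 →
      Cups (N + 2) k I → k ≠ 0 → Stable s N I (hom (rotDiagram k 1)) ∧
        Stable s N I (hom (rotDiagram k (-1))) := by
      intro k I hk h h0
      cases h with
      | refl => omega
      | step h =>
        obtain ⟨h2, h3⟩ := ih.1 _ _ (by omega) h (by omega)
        have h4 := ih.2 _ _ (by omega) h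
        constructor
        -- A rotation of `k` strands is `cap ∘ rot ∘ cup`, so above the cup it becomes `(cup ∘ cap)
        -- ∘ rot` on `k + 2` strands.
        · refine h.stable_step (h4.comp h2) ?_
          have := cap_rot_cup_one_lin (s := s) h0 (hom (idDiagram k))
          rw [hom_id, hom_id] at this
          rw [← this]
          simp only [linComp_assoc]
        · refine h.stable_step (h4.comp h3) ?_
          have := cap_rot_cup_neg_one_lin (s := s) h0 (hom (idDiagram k))
          rw [hom_id, hom_id] at this
          rw [← this]
          simp only [linComp_assoc]
    refine ⟨h1, ?_⟩
    intro k I hk h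
    obtain ⟨-, h5⟩ := h1 _ _ hk h (by omega)
    cases h with
    | refl => omega
    | step h =>
      obtain ⟨h2, -⟩ := ih.1 _ _ (by omega) h (by omega)
      have h4 := ih.2 _ _ (by omega) h
      -- Turn the outer cup by two places against its cap. By `cap_rot_cup_lin` with `r = 2` the
      -- result is the wanted cup-cap turned by two, and the rotation is undone by `h5`.
      have h6 := h.stable_step (f := linComp s (linComp s (hom (capDiagram (k + 2)))
        (linComp s (hom (rotDiagram (k + 2 + 2) 1)) (hom (rotDiagram (k + 2 + 2) 1))))
          (hom (cupDiagram (k + 2)))) (h4.comp (h2.comp h2)) (by simp only [linComp_assoc])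
      have h7 := (h5.comp h5).comp h6
      have h8 := cap_rot_cup_lin (s := s) (k := k) (r := 2) le_rfl (by omega)
        (hom (idDiagram (k + 2)))
      rw [hom_id, hom_id, sub_self, ← idDiagram, id_hom, ← idDiagram, hom_id] at h8
      rw [rot_lin_add, rot_lin_add, one_add_one_eq_two, ← linComp_assoc s (hom (capDiagram (k + 2))),
        h8, linComp_assoc, rot_lin_add] at h7
      rw [show (-1 + -1 + 2 : ℤ) = 0 by norm_num, ← idDiagram, id_hom] at h7
      exact h7

theorem Cups.stable_rot {d : ℕ} (hd : k + 2 * d = N + 2) (h : Cups (N + 2) k I) (hk : k ≠ 0)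
    (r : ℤ) : Stable s N I (hom (rotDiagram k r)) := by
  obtain ⟨h1, h2⟩ := (Cups.stable_aux (s := s)).1 k I hd h hk
  induction r using Int.induction_on with
  | zero =>
    exact ⟨1, one_mem _, by rw [← idDiagram, hom_id]; exact (id_hom (s := s) _).symm⟩
  | succ r ih => rw [← rot_lin_add (s := s)]; exact ih.comp h1
  | pred r ih => rw [sub_eq_add_neg, ← rot_lin_add (s := s)]; exact ih.comp h2

theorem Cups.stable_cup_cap {d : ℕ} {I : AffineDiagram (k + 2) (N + 2)}
    (hd : k + 2 + 2 * d = N + 2) (h : Cups (N + 2) (k + 2) I) :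
    Stable s N I (linComp s (hom (cupDiagram k)) (hom (capDiagram k))) :=
  Cups.stable_aux.2 k I hd h

/-- The loop is `cap ∘ rot ∘ cup` on two points, so above the cup it becomes a cup-cap times a
rotation. -/
theorem Cups.stable_loop {d : ℕ} {I : AffineDiagram 0 (N + 2)} (hd : 0 + 2 * d = N + 2)
    (h : Cups (N + 2) 0 I) : Stable s N I (hom loopDiagram) := by
  cases h with
  | step h =>
    have h1 := h.stable_cup_cap (s := s) (d := d - 1) (by omega)
    refine h.stable_step (h1.comp (h.stable_rot (d := d - 1) (by omega) (by omega) 1)) ?_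
    have := cap_rot_cup_zero_lin (s := s) (hom (idDiagram 0))
    rw [hom_id, hom_id] at this
    rw [← this]
    simp only [linComp_assoc]

/-- The composition of `f` with cups on the left and with caps on the right. -/
noncomputable def sandwich (s : ℂ) {l k n : ℕ} (I : AffineDiagram k n) (J : AffineDiagram l n)
    (f : AffineDiagram l k →₀ ℂ) : EndTL s n :=
  linComp s (hom I) (linComp s f (hom J.flip))

theorem flipLin_sandwich {l k n : ℕ} (I : AffineDiagram k n) (J : AffineDiagram l n)
    (f : AffineDiagram l k →₀ ℂ) :
    flipLin n n (sandwich s I J f) = sandwich s J I (flipLin l k f) := by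
  rw [sandwich, sandwich, flipLin_comp, flipLin_comp, flipLin_hom, flipLin_hom,
    AffineDiagram.flip_flip, linComp_assoc]

variable {l : ℕ} {J : AffineDiagram l (N + 2)}

theorem mem_of_flipLin {f : AffineDiagram l k →₀ ℂ}
    (h : sandwich s J I (flipLin l k f) ∈ genAlg s N) : sandwich s I J f ∈ genAlg s N := by
  have h1 := flipLin_mem h
  rw [flipLin_sandwich] at h1
  have h2 : flipLin k l (flipLin l k f) = f := by
    refine LinearMap.congr_fun (linearMap_hom_ext (F := flipLin k l ∘ₗ flipLin l k)
      (G := LinearMap.id) fun D => ?_) f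
    rw [LinearMap.comp_apply, flipLin_hom, flipLin_hom, AffineDiagram.flip_flip, LinearMap.id_apply]
  rwa [h2] at h1

theorem Stable.sandwich_mem {f : AffineDiagram k k →₀ ℂ} {g : AffineDiagram l k →₀ ℂ}
    (hf : Stable s N I f) (hg : sandwich s I J g ∈ genAlg s N) :
    sandwich s I J (linComp s f g) ∈ genAlg s N := by
  obtain ⟨a, ha, h1⟩ := hf
  have h2 : sandwich s I J (linComp s f g) = a * sandwich s I J g := by
    rw [EndTL.mul_eq, sandwich, sandwich, ← linComp_assoc, linComp_assoc, h1, ← linComp_assoc]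
  rw [h2]
  exact mul_mem ha hg

/-- The innermost cup of `I` and the innermost cap of the reflected `J` combine to a cup-cap, which
is stable with two more strands. -/
theorem Cups.sandwich_id {d : ℕ} (hd : k + 2 * d = N + 2) {I J : AffineDiagram k (N + 2)}
    (hI : Cups (N + 2) k I) (hJ : Cups (N + 2) k J) :
    sandwich s I J (hom (idDiagram k)) ∈ genAlg s N := by
  induction d generalizing k with
  | zero =>
    cases hI with
    | refl =>
      cases hJ with
      | refl =>
        have : sandwich s (idDiagram (N + 2)) (idDiagram (N + 2)) (hom (idDiagram (N + 2))) = 1 := by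
          rw [sandwich, id_hom, id_hom, idDiagram, rot_flip, neg_zero]
          rfl
        rw [this]
        exact one_mem _
      | step h => have := h.le; omega
    | step h => have := h.le; omega
  | succ d ih =>
    cases hI with
    | refl => omega
    | step hI =>
      cases hJ with
      | refl => omega
      | step hJ =>
        have h1 := (hI.stable_cup_cap (s := s) (d := d) (by omega)).sandwich_mem
          (ih (by omega) hI hJ)
        have h2 := congrArg (flipLin _ _) (hJ.hom_step (s := s))
        rw [flipLin_hom, flipLin_comp, flipLin_hom, flipLin_hom] at h2
        rw [sandwich, id_hom, h2, hI.hom_step (s := s)]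
        rw [hom_id, sandwich] at h1
        simp only [← linComp_assoc] at h1 ⊢
        exact h1

theorem Cups.sandwich_rot {d : ℕ} (hd : k + 2 * d = N + 2) (hk : k ≠ 0) (r : ℤ)
    {I J : AffineDiagram k (N + 2)} (hI : Cups (N + 2) k I) (hJ : Cups (N + 2) k J) :
    sandwich s I J (hom (rotDiagram k r)) ∈ genAlg s N := by
  rw [← hom_id (s := s) (hom (rotDiagram k r))]
  exact (hI.stable_rot hd hk r).sandwich_mem (hI.sandwich_id hd hJ)

theorem Cups.sandwich_loops {d : ℕ} (hd : 0 + 2 * d = N + 2) (r : ℕ)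
    {I J : AffineDiagram 0 (N + 2)} (hI : Cups (N + 2) 0 I) (hJ : Cups (N + 2) 0 J) :
    sandwich s I J (hom (loopsDiagram r)) ∈ genAlg s N := by
  induction r with
  | zero =>
    rw [show loopsDiagram 0 = idDiagram 0 from (eq_loopsDiagram (idDiagram 0)).symm]
    exact hI.sandwich_id hd hJ
  | succ r ih =>
    rw [← loop_comp_loops, ← loop_hom (s := s)]
    exact (hI.stable_loop hd).sandwich_mem ih

theorem Cups.sandwich_cup {d : ℕ} (hd : k + 2 + 2 * d = N + 2) (r : ℤ) {D : AffineDiagram l k}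
    {I : AffineDiagram (k + 2) (N + 2)} (hI : Cups (N + 2) (k + 2) I)
    (h : sandwich s (I.comp (cupDiagram k)) J (hom D) ∈ genAlg s N) :
    sandwich s I J (hom ((rotDiagram (k + 2) r).comp ((cupDiagram k).comp D))) ∈ genAlg s N := by
  rw [← rot_hom (s := s)]
  refine (hI.stable_rot hd (by omega) r).sandwich_mem ?_
  rw [← cup_hom (s := s)]
  rw [sandwich, hI.hom_step (s := s)] at h
  rw [sandwich]
  simpa only [← linComp_assoc] using h

open TLSystem in
-- Along a factorization of `D`, cups are handed over to `I` and caps to `J`, and rotations and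
-- loops are carried through `I`.
theorem TLSystem.Rep.sandwich_mem {A : Type} [Ring A] [Algebra ℂ A] {L : TLSystem (N + 2) A}
    {D : AffineDiagram l k} {x : A} (h : L.Rep l k D x) {d d' : ℕ} (hl : l + 2 * d' = N + 2)
    (hk : k + 2 * d = N + 2) (hI : Cups (N + 2) k I) (hJ : Cups (N + 2) l J) :
    sandwich s I J (hom D) ∈ genAlg s N := by
  induction h generalizing d d' with
  | rot k r h0 => exact hI.sandwich_rot hk h0 r hJ
  | loops r => exact hI.sandwich_loops hk r hJ
  | cup r h ih => exact hI.sandwich_cup hk r (ih hl (d := d + 1) (by omega) hI.step hJ)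
  | cap r h ih =>
    apply mem_of_flipLin
    rw [flipLin_hom, AffineDiagram.flip_comp, AffineDiagram.flip_comp, rot_flip, cap_flip]
    refine hJ.sandwich_cup hl _ (mem_of_flipLin ?_)
    rw [flipLin_hom, AffineDiagram.flip_flip]
    exact ih (d' := d' + 1) (by omega) hk hI hJ.step

/-- Take no cups and caps at all in the sandwich. The system `L` enters through `exists_rep`, which
supplies a factorization of each diagram. -/
theorem genAlg_eq_top {A : Type} [Ring A] [Algebra ℂ A] (L : TLSystem (N + 2) A) :
    genAlg s N = ⊤ := by
  rw [eq_top_iff]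
  rintro f -
  induction f using Finsupp.induction_linear with
  | zero => exact zero_mem _
  | add f g hf hg => exact add_mem hf hg
  | single D c =>
    obtain ⟨x, hx⟩ := TLSystem.exists_rep L (d := 0) (d' := 0) rfl rfl D
    have h1 := hx.sandwich_mem (s := s) (d := 0) (d' := 0) rfl rfl Cups.refl Cups.refl
    have h2 : (Finsupp.single D c : AffineDiagram (N + 2) (N + 2) →₀ ℂ) =
        c • sandwich s (idDiagram (N + 2)) (idDiagram (N + 2)) (hom D) := by
      rw [sandwich, id_hom, idDiagram, rot_flip, neg_zero, ← idDiagram, hom_id, hom]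
      exact (Finsupp.smul_single_one D c).symm
    rw [h2]
    exact (genAlg s N).smul_mem h1 c

end Stable


/-! ### The diagrams of the generators -/

section EDiagram

variable {n : ℕ}

theorem eDiagram_flip (hn : 2 ≤ n) (i : ZMod n) : (eDiagram n hn i).flip = eDiagram n hn i := by
  refine AffineDiagram.ext' ?_ rfl
  rintro (x | x) <;> rw [AffineDiagram.flip_mate] <;> by_cases h : swapAt n i x.pos = x.pos <;>
    simp [eDiagram, h]

theorem swapAt_succ (i : ZMod n) (x : ℤ) : swapAt n (i + 1) (x + 1) = swapAt n i x + 1 := by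
  simp only [swapAt, Int.cast_add, Int.cast_one, add_left_inj]
  split_ifs <;> ring

theorem rot_eDiagram (hn : 2 ≤ n) (i : ZMod n) :
    (rotDiagram n 1).comp (eDiagram n hn i) = (eDiagram n hn (i + 1)).comp (rotDiagram n 1) := by
  -- Reflection turns the rotation on the inner side into one on the outer side, where
  -- `rot_comp_mate` applies.
  rw [← AffineDiagram.flip_flip ((eDiagram n hn (i + 1)).comp (rotDiagram n 1)),
    AffineDiagram.flip_comp, rot_flip, eDiagram_flip]
  refine AffineDiagram.ext' ?_ ?_
  · rintro (x | x)
    · rw [AffineDiagram.flip_mate, rot_comp_mate, rot_comp_mate]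
      have h := swapAt_succ i x.pos
      by_cases h1 : swapAt n i x.pos = x.pos
      · rw [h1] at h
        simp [eDiagram, movePt, h, h1]
      · have h2 : swapAt n (i + 1) (x.pos + 1) ≠ x.pos + 1 := by omega
        simp [eDiagram, movePt, h, h1]
    · rw [AffineDiagram.flip_mate, rot_comp_mate, rot_comp_mate]
      have h := swapAt_succ i (x.pos - 1)
      rw [sub_add_cancel] at h
      by_cases h1 : swapAt n i (x.pos - 1) = x.pos - 1
      · rw [h1, sub_add_cancel] at h
        simp [eDiagram, movePt, h, h1, ← sub_eq_add_neg]
      · have h2 : swapAt n i (x.pos - 1) + 1 ≠ x.pos := by omega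
        simp [eDiagram, movePt, h, h1, h2, ← sub_eq_add_neg]
  · rw [rot_comp_loops]
    exact (rot_comp_loops (-1) (eDiagram n hn (i + 1))).symm

theorem swapAt_of_emod {N : ℕ} (x : ℤ) :
    (x % (N + 2 : ℕ) = N → swapAt (N + 2) N x = x + 1) ∧
    (x % (N + 2 : ℕ) = N + 1 → swapAt (N + 2) N x = x - 1) ∧
    (x % (N + 2 : ℕ) < N → swapAt (N + 2) N x = x) := by
  have h1 : ((x : ZMod (N + 2)) = N) ↔ x % (N + 2 : ℕ) = N := by
    rw [← Int.cast_natCast, ZMod.intCast_eq_intCast_iff', Int.emod_eq_of_lt (a := (N : ℤ))] <;>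
      push_cast <;> omega
  have h2 : ((x : ZMod (N + 2)) = N + 1) ↔ x % (N + 2 : ℕ) = N + 1 := by
    have : (N + 1 : ZMod (N + 2)) = ((N + 1 : ℤ) : ZMod (N + 2)) := by push_cast; rfl
    rw [this, ZMod.intCast_eq_intCast_iff', Int.emod_eq_of_lt (a := (N + 1 : ℤ))] <;>
      push_cast <;> omega
  refine ⟨fun h => ?_, fun h => ?_, fun h => ?_⟩
  · rw [swapAt, if_pos (h1.2 h)]
  · rw [swapAt, if_neg (by rw [h1]; omega), if_pos (h2.2 h)]
  · rw [swapAt, if_neg (by rw [h1]; omega), if_neg (by rw [h2]; omega)]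

theorem eDiagram_eq_cup_cap (N : ℕ) (hn : 2 ≤ N + 2) :
    eDiagram (N + 2) hn N = (cupDiagram N).comp (capDiagram N) := by
  have key : ∀ x : MarkedPt (N + 2), ¬ x.pos % (N + 2 : ℕ) < N →
      swapAt (N + 2) N x.pos ≠ x.pos ∧ deadPos N x.pos = swapAt (N + 2) N x.pos := by
    intro x hx
    obtain ⟨h1, h2, -⟩ := swapAt_of_emod (N := N) x.pos
    rcases deadPos_cases hx with ⟨h3, h4, -⟩ | ⟨h3, h4, -⟩
    · rw [h1 h3, h4]; omega
    · rw [h2 h3, h4]; omega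
  have hS := (cup_straight N).comp_mate (capDiagram N)
  refine AffineDiagram.ext' ?_ ?_
  · rintro (x | x) <;> rcases exists_emb_or N x with ⟨y, rfl⟩ | hx
    · have h := hS (Sum.inl (emb N y))
      have h1 : (capDiagram N).mate (Sum.inl (emb N y)) = Sum.inr y := by
        rw [← cap_inr, AffineDiagram.mate_mate]
      rw [h1] at h
      refine Eq.trans ?_ h.symm
      exact if_pos ((swapAt_of_emod _).2.2 (emb_alive y))
    · have h := hS (Sum.inl x)
      rw [cap_dead hx] at h
      refine Eq.trans ?_ h.symm
      obtain ⟨h1, h2⟩ := key x hx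
      refine (if_neg h1).trans (congrArg Sum.inl (MarkedPt.ext h2.symm))
    · have h := hS (Sum.inr y)
      rw [cap_inr] at h
      refine Eq.trans ?_ h.symm
      exact if_pos ((swapAt_of_emod _).2.2 (emb_alive y))
    · refine Eq.trans ?_ (comp_mate_of_outer (cup_dead hx) _).symm
      obtain ⟨h1, h2⟩ := key x hx
      refine (if_neg h1).trans (congrArg Sum.inr (MarkedPt.ext h2.symm))
  · rw [cup_comp_loops]
    rfl

end EDiagram

/-! ### The relations of the generators -/

section EndRelations

variable {s : ℂ} {n N : ℕ}

theorem diag_rot_mul (a b : ℤ) :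
    diag s (rotDiagram n a) * diag s (rotDiagram n b) = diag s (rotDiagram n (a + b)) :=
  rot_lin_add a b

theorem diag_rot_zero : diag s (rotDiagram n 0) = 1 := rfl

theorem diag_rot_nat (a : ℕ) : diag s (rotDiagram n a) = diag s (rotDiagram n 1) ^ a := by
  induction a with
  | zero => rw [pow_zero]; exact diag_rot_zero
  | succ a ih => rw [pow_succ, ← ih, diag_rot_mul, Nat.cast_succ]

theorem diag_rot_e (hn : 2 ≤ n) (i : ZMod n) :
    diag s (rotDiagram n 1) * diag s (eDiagram n hn i) =
      diag s (eDiagram n hn (i + 1)) * diag s (rotDiagram n 1) := by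
  change linComp s (hom _) (hom _) = linComp s (hom _) (hom _)
  rw [rot_hom, hom_rot, rot_eDiagram]

theorem diag_rot_e_int (hn : 2 ≤ n) (i : ZMod n) (r : ℤ) :
    diag s (rotDiagram n r) * diag s (eDiagram n hn i) =
      diag s (eDiagram n hn (i + r)) * diag s (rotDiagram n r) := by
  induction r using Int.induction_on generalizing i with
  | zero => simp [diag_rot_zero]
  | succ r ih =>
    rw [add_comm (r : ℤ), ← diag_rot_mul, mul_assoc, ih, ← mul_assoc, diag_rot_e, mul_assoc]
    congr 3
    push_cast
    ring
  | pred r ih =>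
    have h := diag_rot_e (s := s) hn (i - 1)
    rw [sub_add_cancel] at h
    have h1 : diag s (rotDiagram n (-1)) * diag s (eDiagram n hn i) =
        diag s (eDiagram n hn (i - 1)) * diag s (rotDiagram n (-1)) := by
      calc _ = diag s (rotDiagram n (-1)) * (diag s (eDiagram n hn i) * diag s (rotDiagram n 1)) *
            diag s (rotDiagram n (-1)) := by
            rw [mul_assoc, mul_assoc, diag_rot_mul, add_neg_cancel, diag_rot_zero, mul_one]
        _ = _ := by
            rw [← h, ← mul_assoc, diag_rot_mul, neg_add_cancel, diag_rot_zero, one_mul]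
    rw [sub_eq_add_neg, ← diag_rot_mul, mul_assoc, h1, ← mul_assoc, ih, mul_assoc]
    congr 3
    push_cast
    ring

/-- The composition of a cup and a cap. -/
noncomputable def cupCap (s : ℂ) (N : ℕ) : EndTL s (N + 2) :=
  linComp s (hom (cupDiagram N)) (hom (capDiagram N))

theorem cupCap_eq (hn : 2 ≤ N + 2) : cupCap s N = diag s (eDiagram (N + 2) hn N) := by
  rw [eDiagram_eq_cup_cap, cupCap, cup_hom]
  rfl

theorem cupCap_eq_diag : cupCap s N = diag s ((cupDiagram N).comp (capDiagram N)) := by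
  rw [cupCap, cup_hom]
  rfl

theorem diag_e_eq (hn : 2 ≤ N + 2) (r : ℤ) : diag s (eDiagram (N + 2) hn (N + r)) =
    diag s (rotDiagram (N + 2) r) * cupCap s N * diag s (rotDiagram (N + 2) (-r)) := by
  rw [cupCap_eq hn, diag_rot_e_int, mul_assoc, diag_rot_mul, add_neg_cancel, diag_rot_zero, mul_one]

theorem cupCap_mul (f : EndTL s (N + 2)) : cupCap s N * f =
    linComp s (hom (cupDiagram N)) (linComp s (hom (capDiagram N)) f) :=
  (linComp_assoc s _ _ _).symm

theorem cupCap_sq : cupCap s N * cupCap s N = loopWeight s • cupCap s N := by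
  rw [cupCap_mul, cupCap, cap_cup_lin]
  exact linComp_smul_right s _ _ _

theorem cupCap_mul_rot_mul (r : ℤ) (f : EndTL s (N + 2)) :
    cupCap s N * (diag s (rotDiagram (N + 2) r) * (cupCap s N * f)) =
    linComp s (hom (cupDiagram N)) (linComp s (hom (capDiagram N))
      (linComp s (hom (rotDiagram (N + 2) r)) (linComp s (hom (cupDiagram N))
        (linComp s (hom (capDiagram N)) f)))) := by
  rw [cupCap_mul, cupCap_mul]
  rfl

/-- The product is `cup ∘ (cap ∘ rot 1 ∘ cup) ∘ (cap ∘ rot (-1) ∘ cup) ∘ cap`, and the two zigzags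
become opposite turns of `N` strands. -/
theorem cupCap_rot_one (hN : N ≠ 0) : cupCap s N * (diag s (rotDiagram (N + 2) 1) * (cupCap s N *
    (diag s (rotDiagram (N + 2) (-1)) * cupCap s N))) = cupCap s N := by
  rw [cupCap_mul_rot_mul, cap_rot_cup_one_lin hN]
  refine (congrArg (fun g => linComp s (hom (cupDiagram N)) (linComp s (hom (rotDiagram N 1)) g))
    (cap_rot_cup_neg_one_lin hN (hom (capDiagram N)))).trans ?_
  rw [linComp_assoc s (hom (rotDiagram N 1)), rot_lin_add,
    add_neg_cancel, ← idDiagram, id_hom, cupCap]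

theorem cupCap_rot_neg_one (hN : N ≠ 0) : cupCap s N * (diag s (rotDiagram (N + 2) (-1)) *
    (cupCap s N * (diag s (rotDiagram (N + 2) 1) * cupCap s N))) = cupCap s N := by
  rw [cupCap_mul_rot_mul, cap_rot_cup_neg_one_lin hN]
  refine (congrArg (fun g => linComp s (hom (cupDiagram N)) (linComp s (hom (rotDiagram N (-1))) g))
    (cap_rot_cup_one_lin hN (hom (capDiagram N)))).trans ?_
  rw [linComp_assoc s (hom (rotDiagram N (-1))), rot_lin_add,
    neg_add_cancel, ← idDiagram, id_hom, cupCap]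

/-- The left side is two disjoint cups followed by their reflection, hence invariant under
reflection; reflecting the product reverses its factors, which gives the right side. -/
theorem cup_cap_comm {k : ℕ} {r : ℤ} (h2 : 2 ≤ r) (hr : r ≤ k + 2)
    {C : AffineDiagram (k + 2 + 2) (k + 2 + 2) →₀ ℂ}
    (hC : C = linComp s (hom (cupDiagram (k + 2))) (hom (capDiagram (k + 2)))) :
    linComp s C (linComp s (hom (rotDiagram (k + 2 + 2) r))
      (linComp s C (hom (rotDiagram (k + 2 + 2) (-r))))) =
    linComp s (hom (rotDiagram (k + 2 + 2) r)) (linComp s C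
      (linComp s (hom (rotDiagram (k + 2 + 2) (-r))) C)) := by
  -- The two disjoint cups; by `cup_rot_cup` they can be attached in either order.
  obtain ⟨W, hW⟩ : ∃ W, W = linComp s (hom (rotDiagram (k + 2 + 2) r))
    (linComp s (hom (cupDiagram (k + 2))) (linComp s (hom (rotDiagram (k + 2) (2 - r)))
      (hom (cupDiagram k)))) := ⟨_, rfl⟩
  have h3 : W = linComp s (hom (cupDiagram (k + 2))) (linComp s (hom (rotDiagram (k + 2) r))
      (linComp s (hom (cupDiagram k)) (hom (rotDiagram k (2 - r))))) := by
    rw [hW, cup_hom, rot_hom, cup_hom, rot_hom, rot_hom, cup_hom]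
    exact (congrArg hom (cup_rot_cup k h2 hr)).symm
  have cup_flip : ∀ k, (cupDiagram k).flip = capDiagram k := fun _ => rfl
  have h4 : flipLin _ _ W = linComp s (hom (capDiagram k)) (linComp s (hom (rotDiagram (k + 2) (r - 2)))
      (linComp s (hom (capDiagram (k + 2))) (hom (rotDiagram (k + 2 + 2) (-r))))) := by
    rw [hW]
    simp only [flipLin_comp, flipLin_hom, rot_flip, cup_flip, neg_sub, ← linComp_assoc]
  have hCf : flipLin _ _ C = C := by
    rw [hC, flipLin_comp, flipLin_hom, flipLin_hom, cap_flip, capDiagram]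
  have hWf : flipLin _ _ (flipLin _ _ W) = W := by
    rw [h4]
    simp only [flipLin_comp, flipLin_hom, rot_flip, cap_flip, neg_sub, neg_neg, ← linComp_assoc, hW]
  have h1 : linComp s C (linComp s (hom (rotDiagram (k + 2 + 2) r))
      (linComp s C (hom (rotDiagram (k + 2 + 2) (-r))))) = linComp s W (flipLin _ _ W) := by
    rw [h4, h3, hC]
    simp only [← linComp_assoc]
    rw [cap_rot_cup_lin h2 hr]
  have h5 := congrArg (flipLin _ _) h1
  rw [flipLin_comp (s := s) W, hWf, ← h1] at h5
  rw [← h5]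
  simp only [flipLin_comp, flipLin_hom, rot_flip, neg_neg, hCf, ← linComp_assoc]

theorem cupCap_comm {r : ℤ} (h2 : 2 ≤ r) (hr : r ≤ N) :
    cupCap s N * (diag s (rotDiagram (N + 2) r) * (cupCap s N * diag s (rotDiagram (N + 2) (-r)))) =
    diag s (rotDiagram (N + 2) r) * (cupCap s N * (diag s (rotDiagram (N + 2) (-r)) * cupCap s N)) := by
  obtain ⟨k, rfl⟩ : ∃ k, N = k + 2 := ⟨N - 2, by omega⟩
  exact cup_cap_comm h2 (by push_cast at hr; exact hr) rfl

/-- Between consecutive factors the cap and the turned cup form a zigzag, which contributes one turn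
of the `N` strands in the middle. -/
theorem rot_cupCap_pow (hN : N ≠ 0) (c : ℕ) : (diag s (rotDiagram (N + 2) 1) * cupCap s N) ^ (c + 1) =
    linComp s (hom (rotDiagram (N + 2) 1)) (linComp s (hom (cupDiagram N))
      (linComp s (hom (rotDiagram N c)) (hom (capDiagram N)))) := by
  induction c with
  | zero =>
    rw [pow_one, Nat.cast_zero, ← idDiagram, id_hom]
    rfl
  | succ c ih =>
    rw [pow_succ', ih, mul_assoc, cupCap_mul, cap_rot_cup_one_lin hN, linComp_assoc s _ _ (hom (capDiagram N)),
      rot_lin_add, Nat.cast_succ, add_comm 1 (c : ℤ)]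
    rfl

theorem rot_cup_lin : linComp s (hom (rotDiagram (N + 2) (N + 2 : ℕ))) (hom (cupDiagram N)) =
    linComp s (hom (cupDiagram N)) (hom (rotDiagram N N)) := by
  have := rot_cup N 1
  rw [mul_one, mul_one] at this
  rw [rot_hom, cup_hom, this]

/-- With `N` zigzags the middle strands make a full turn, which passes through the cup and becomes a
full turn of `N + 2` strands. -/
theorem rot_cupCap_pow_full (hN : N ≠ 0) : (diag s (rotDiagram (N + 2) 1) * cupCap s N) ^ (N + 1) =
    diag s (rotDiagram (N + 2) 1) ^ (N + 2) * (diag s (rotDiagram (N + 2) 1) * cupCap s N) := by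
  rw [rot_cupCap_pow hN, ← diag_rot_nat, ← mul_assoc, diag_rot_mul, add_comm _ (1 : ℤ), ← diag_rot_mul,
    linComp_assoc s _ _ (hom (capDiagram N)), ← rot_cup_lin, ← linComp_assoc, mul_assoc]
  rfl

theorem rot_sq_cupCap : diag s (rotDiagram (0 + 2) 1) ^ 2 * cupCap s 0 = cupCap s 0 := by
  have h := rot_cup_lin (s := s) (N := 0)
  rw [Nat.cast_zero, ← idDiagram, hom_id] at h
  rw [← diag_rot_nat, EndTL.mul_eq, cupCap, linComp_assoc]
  exact congrArg (fun f => linComp s f (hom (capDiagram 0))) h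

end EndRelations


/-! ### Algebras with generators and relations -/

section Bijective

variable {s : ℂ} {N : ℕ} {A : Type} [Ring A] [Algebra ℂ A] {L : TLSystem (N + 2) A}

/-- It suffices to let `a` be a generator. For `e N`, the cap contributes the factor `e N` and the
cup contributes nothing. -/
theorem TLSystem.Psi_mul (hs : L.weight = loopWeight s)
    (hgen : Algebra.adjoin ℂ {L.rho, L.rhoInv, L.e N} = ⊤) {Φ : A →ₐ[ℂ] EndTL s (N + 2)}
    (h1 : Φ L.rho = diag s (rotDiagram (N + 2) 1))
    (h2 : Φ L.rhoInv = diag s (rotDiagram (N + 2) (-1))) (h3 : Φ (L.e N) = cupCap s N) (a : A)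
    (b : EndTL s (N + 2)) :
    L.Psi (N + 2) (N + 2) (Φ a * b : EndTL s (N + 2)) = a * L.Psi (N + 2) (N + 2) b := by
  have ha : a ∈ Algebra.adjoin ℂ {L.rho, L.rhoInv, L.e N} := hgen ▸ Algebra.mem_top
  have hd : N + 2 + 2 * 0 = N + 2 := rfl
  induction ha using Algebra.adjoin_induction generalizing b with
  | mem x hx =>
    rcases hx with rfl | rfl | rfl
    · rw [h1]
      refine (TLSystem.Psi_rot hd hd (by omega) b).trans ?_
      rw [TLSystem.rot, intPow_one, TLSystem.u, TLSystem.dead_top, one_mul]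
    · rw [h2]
      refine (TLSystem.Psi_rot hd hd (by omega) b).trans ?_
      rw [TLSystem.rot, intPow_neg_one, TLSystem.v, TLSystem.dead_top, one_mul]
    · rw [h3, cupCap_mul]
      exact (TLSystem.Psi_cup hd hd _).trans (TLSystem.Psi_cap hs hd hd b)
  | algebraMap c =>
    rw [AlgHom.commutes, ← Algebra.smul_def, ← Algebra.smul_def]
    exact map_smul _ _ _
  | add x y _ _ hx hy =>
    rw [map_add, add_mul, add_mul, ← hx, ← hy]
    exact map_add _ _ _
  | mul x y _ _ hx hy => rw [map_mul Φ, mul_assoc, hx, hy, mul_assoc]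

/-- With `b = 1` in `Psi_mul`, `Psi` is a left inverse, because the identity diagram is represented
by `dead (N + 2) = 1`. The images of the generators generate everything by `genAlg_eq_top`. -/
theorem TLSystem.bijective (hs : L.weight = loopWeight s)
    (hgen : Algebra.adjoin ℂ {L.rho, L.rhoInv, L.e N} = ⊤) {Φ : A →ₐ[ℂ] EndTL s (N + 2)}
    (h1 : Φ L.rho = diag s (rotDiagram (N + 2) 1))
    (h2 : Φ L.rhoInv = diag s (rotDiagram (N + 2) (-1))) (h3 : Φ (L.e N) = cupCap s N) :
    Function.Bijective Φ := by
  constructor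
  · have key : ∀ a, L.Psi (N + 2) (N + 2) (Φ a) = a := by
      intro a
      have h := TLSystem.Psi_mul hs hgen h1 h2 h3 a 1
      rw [mul_one] at h
      rw [h]
      refine (congrArg (a * ·) (TLSystem.Psi_id (L := L) (d := 0) rfl)).trans ?_
      rw [TLSystem.dead_top, mul_one]
    intro a b h
    rw [← key a, h, key b]
  · rw [← AlgHom.range_eq_top, eq_top_iff, ← genAlg_eq_top (s := s) L, genAlg, Algebra.adjoin_le_iff]
    rintro x (rfl | rfl | rfl)
    · exact ⟨_, h1⟩
    · exact ⟨_, h2⟩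
    · exact ⟨_, h3.trans cupCap_eq_diag⟩

end Bijective

theorem ZMod.exists_eq_add_natCast {n : ℕ} [NeZero n] (a i : ZMod n) : ∃ r : ℕ, i = a + r :=
  ⟨(i - a).val, by rw [ZMod.natCast_zmod_val, add_sub_cancel]⟩

section Quot

variable {s : ℂ} {N : ℕ} (R : FreeAlgebra ℂ (TLGen (N + 2)) → FreeAlgebra ℂ (TLGen (N + 2)) → Prop)

/-- The image of a generator in the quotient of the free algebra. -/
noncomputable def quotGen (g : TLGen (N + 2)) : RingQuot R := RingQuot.mkAlgHom ℂ R (gen g)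

/-- All `e i` are conjugates of one of them under powers of the rotation. -/
theorem adjoin_quotGen (hi : quotGen R TLGen.rho * quotGen R TLGen.rhoInv = 1)
    (he : ∀ i, quotGen R TLGen.rho * quotGen R (TLGen.e i) =
      quotGen R (TLGen.e (i + 1)) * quotGen R TLGen.rho) :
    Algebra.adjoin ℂ {quotGen R TLGen.rho, quotGen R TLGen.rhoInv, quotGen R (TLGen.e (N : ZMod (N + 2)))} =
      ⊤ := by
  set S := Algebra.adjoin ℂ {quotGen R TLGen.rho, quotGen R TLGen.rhoInv,
    quotGen R (TLGen.e (N : ZMod (N + 2)))} with hS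
  have h1 : quotGen R TLGen.rho ∈ S := Algebra.subset_adjoin (Or.inl rfl)
  have h2 : quotGen R TLGen.rhoInv ∈ S := Algebra.subset_adjoin (Or.inr (Or.inl rfl))
  have h3 : ∀ r : ℕ, quotGen R (TLGen.e ((N : ZMod (N + 2)) + r)) ∈ S := by
    intro r
    induction r with
    | zero => rw [Nat.cast_zero, add_zero]; exact Algebra.subset_adjoin (Or.inr (Or.inr rfl))
    | succ r ih =>
      have h := he ((N : ZMod (N + 2)) + r)
      have h4 : quotGen R (TLGen.e ((N : ZMod (N + 2)) + (r + 1 : ℕ))) = quotGen R TLGen.rho *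
          quotGen R (TLGen.e ((N : ZMod (N + 2)) + r)) * quotGen R TLGen.rhoInv := by
        rw [h, mul_assoc, hi, mul_one, Nat.cast_succ, add_assoc]
      rw [h4]
      exact mul_mem (mul_mem h1 ih) h2
  have h4 : ∀ g, quotGen R g ∈ S := by
    rintro (i | - | -)
    · obtain ⟨r, rfl⟩ := ZMod.exists_eq_add_natCast (N : ZMod (N + 2)) i
      exact h3 r
    · exact h1
    · exact h2
  rw [eq_top_iff]
  rintro x -
  obtain ⟨y, rfl⟩ := RingQuot.mkAlgHom_surjective ℂ R x
  have hy : y ∈ Algebra.adjoin ℂ (Set.range (FreeAlgebra.ι ℂ : TLGen (N + 2) → _)) :=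
    (FreeAlgebra.adjoin_range_ι ℂ (TLGen (N + 2))).symm ▸ Algebra.mem_top
  induction hy using Algebra.adjoin_induction with
  | mem x hx =>
    obtain ⟨g, rfl⟩ := hx
    exact h4 g
  | algebraMap c => rw [AlgHom.commutes]; exact algebraMap_mem _ c
  | add x y _ _ hx hy => rw [map_add]; exact add_mem hx hy
  | mul x y _ _ hx hy => rw [map_mul]; exact mul_mem hx hy

/-- The diagrams of the generators. -/
noncomputable def genDiagram (s : ℂ) (N : ℕ) : TLGen (N + 2) → EndTL s (N + 2)
  | TLGen.e i => diag s (eDiagram (N + 2) (by omega) i)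
  | TLGen.rho => diag s (rotDiagram (N + 2) 1)
  | TLGen.rhoInv => diag s (rotDiagram (N + 2) (-1))

/-- The representation of the free algebra by diagrams. -/
noncomputable def freeRep (s : ℂ) (N : ℕ) : FreeAlgebra ℂ (TLGen (N + 2)) →ₐ[ℂ] EndTL s (N + 2) :=
  FreeAlgebra.lift ℂ (genDiagram s N)

theorem freeRep_gen (g : TLGen (N + 2)) : freeRep s N (gen g) = genDiagram s N g :=
  FreeAlgebra.lift_ι_apply _ _

theorem existsUnique_equiv (hR : ∀ ⦃x y⦄, R x y → freeRep s N x = freeRep s N y)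
    (L : TLSystem (N + 2) (RingQuot R)) (hs : L.weight = loopWeight s)
    (hrho : L.rho = quotGen R TLGen.rho) (hinv : L.rhoInv = quotGen R TLGen.rhoInv)
    (hL : L.e N = quotGen R (TLGen.e (N : ZMod (N + 2))))
    (he : ∀ i, quotGen R TLGen.rho * quotGen R (TLGen.e i) =
      quotGen R (TLGen.e (i + 1)) * quotGen R TLGen.rho) :
    ∃! φ : RingQuot R ≃ₐ[ℂ] EndTL s (N + 2),
      φ (quotGen R TLGen.rho) = diag s (rhoDiagram (N + 2)) ∧
      ∀ i, φ (quotGen R (TLGen.e i)) = diag s (eDiagram (N + 2) (by omega) i) := by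
  have hi : quotGen R TLGen.rho * quotGen R TLGen.rhoInv = 1 := by rw [← hrho, ← hinv, L.rho_inv]
  have hgen := adjoin_quotGen R hi he
  have hΦ : ∀ g, RingQuot.liftAlgHom ℂ ⟨freeRep s N, hR⟩ (quotGen R g) = genDiagram s N g := by
    intro g
    rw [quotGen, RingQuot.liftAlgHom_mkAlgHom_apply, freeRep_gen]
  have hbij : Function.Bijective (RingQuot.liftAlgHom ℂ ⟨freeRep s N, hR⟩) := by
    refine TLSystem.bijective (L := L) hs ?_ ?_ ?_ ?_
    · rw [hrho, hinv, hL, hgen]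
    · rw [hrho]; exact hΦ _
    · rw [hinv]; exact hΦ _
    · rw [hL, cupCap_eq (by omega)]; exact hΦ _
  refine ⟨AlgEquiv.ofBijective _ hbij, ⟨hΦ _, fun i => hΦ _⟩, ?_⟩
  rintro φ ⟨h1, h2⟩
  -- The image of the inverse rotation is not prescribed; it is forced by that of the rotation.
  have h3 : φ (quotGen R TLGen.rhoInv) = diag s (rotDiagram (N + 2) (-1)) := by
    have h4 := congrArg φ hi
    rw [map_mul, map_one, h1] at h4
    have h5 := congrArg (diag s (rotDiagram (N + 2) (-1)) * ·) h4
    simp only [mul_one] at h5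
    rw [← mul_assoc, rhoDiagram, diag_rot_mul, neg_add_cancel, diag_rot_zero, one_mul] at h5
    exact h5
  have h6 : (φ : RingQuot R →ₐ[ℂ] EndTL s (N + 2)) = RingQuot.liftAlgHom ℂ ⟨freeRep s N, hR⟩ := by
    refine AlgHom.ext_of_adjoin_eq_top hgen ?_
    rintro x (rfl | rfl | rfl)
    · exact h1.trans (hΦ TLGen.rho).symm
    · exact h3.trans (hΦ TLGen.rhoInv).symm
    · exact (h2 _).trans (hΦ (TLGen.e N)).symm
  exact AlgEquiv.ext fun x => DFunLike.congr_fun h6 x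

end Quot

/-! ### The relations hold for diagrams -/

section Twisted

variable {s : ℂ} {N : ℕ}

/-- A family of endomorphisms whose members are related by the rotation. -/
def Rotates (f : ZMod (N + 2) → EndTL s (N + 2)) : Prop :=
  ∀ i, diag s (rotDiagram (N + 2) 1) * f i = f (i + 1) * diag s (rotDiagram (N + 2) 1)

variable {f g : ZMod (N + 2) → EndTL s (N + 2)}

theorem Rotates.mul (hf : Rotates f) (hg : Rotates g) : Rotates fun i => f i * g i := fun i => by
  rw [← mul_assoc, hf, mul_assoc, hg, mul_assoc]

theorem Rotates.pow (hf : Rotates f) (c : ℕ) : Rotates fun i => f i ^ c := by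
  induction c with
  | zero => exact fun i => by simp only [pow_zero, one_mul, mul_one]
  | succ c ih => simp only [pow_succ]; exact ih.mul hf

theorem Rotates.smul (hf : Rotates f) (c : ℂ) : Rotates fun i => c • f i := fun i => by
  rw [mul_smul_comm, hf, smul_mul_assoc]

theorem Rotates.add (hf : Rotates f) (c : ZMod (N + 2)) : Rotates fun i => f (i + c) := fun i => by
  rw [hf, add_right_comm]

theorem rotates_rho : Rotates (s := s) (N := N) fun _ => diag s (rotDiagram (N + 2) 1) :=
  fun _ => rfl

theorem rotates_e (hn : 2 ≤ N + 2) : Rotates fun i => diag s (eDiagram (N + 2) hn i) :=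
  fun i => diag_rot_e hn i

/-- Conjugation with the rotation raises the index by one. Relations between diagrams thus need to
be checked only at the index `N`, where the generator is a cup after a cap. -/
theorem Rotates.eq (hf : Rotates f) (hg : Rotates g) (h : f N = g N) (i : ZMod (N + 2)) :
    f i = g i := by
  obtain ⟨r, rfl⟩ := ZMod.exists_eq_add_natCast (N : ZMod (N + 2)) i
  induction r with
  | zero => rwa [Nat.cast_zero, add_zero]
  | succ r ih =>
    have h1 := congrArg (fun x => diag s (rotDiagram (N + 2) 1) * x * diag s (rotDiagram (N + 2) (-1))) ih
    rw [hf, hg, mul_assoc, mul_assoc, diag_rot_mul, add_neg_cancel, diag_rot_zero, mul_one, mul_one]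
      at h1
    rwa [Nat.cast_succ, ← add_assoc]

theorem cupCap_eq' (hn : 2 ≤ N + 2) : diag s (eDiagram (N + 2) hn N) = cupCap s N :=
  (cupCap_eq hn).symm

theorem diag_e_sq (hn : 2 ≤ N + 2) (i : ZMod (N + 2)) :
    diag s (eDiagram (N + 2) hn i) ^ 2 = loopWeight s • diag s (eDiagram (N + 2) hn i) := by
  refine ((rotates_e hn).pow 2).eq ((rotates_e hn).smul _) ?_ i
  rw [cupCap_eq', pow_two, cupCap_sq]

theorem diag_e_succ (hn : 2 ≤ N + 2) (hN : N ≠ 0) (i : ZMod (N + 2)) :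
    diag s (eDiagram (N + 2) hn i) * diag s (eDiagram (N + 2) hn (i + 1)) *
      diag s (eDiagram (N + 2) hn i) = diag s (eDiagram (N + 2) hn i) := by
  refine (((rotates_e hn).mul ((rotates_e hn).add 1)).mul (rotates_e hn)).eq (rotates_e hn) ?_ i
  have h := diag_e_eq (s := s) hn 1
  rw [Int.cast_one] at h
  rw [cupCap_eq', h]
  simp only [mul_assoc]
  exact cupCap_rot_one hN

theorem diag_e_pred (hn : 2 ≤ N + 2) (hN : N ≠ 0) (i : ZMod (N + 2)) :
    diag s (eDiagram (N + 2) hn i) * diag s (eDiagram (N + 2) hn (i - 1)) *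
      diag s (eDiagram (N + 2) hn i) = diag s (eDiagram (N + 2) hn i) := by
  simp only [sub_eq_add_neg]
  refine (((rotates_e hn).mul ((rotates_e hn).add (-1))).mul (rotates_e hn)).eq (rotates_e hn) ?_ i
  have h := diag_e_eq (s := s) hn (-1)
  rw [Int.cast_neg, Int.cast_one, neg_neg] at h
  rw [cupCap_eq', h]
  simp only [mul_assoc]
  exact cupCap_rot_neg_one hN

theorem diag_e_comm (hn : 2 ≤ N + 2) (i j : ZMod (N + 2)) (h1 : i - j ≠ 1) (h2 : i - j ≠ -1) :
    diag s (eDiagram (N + 2) hn i) * diag s (eDiagram (N + 2) hn j) =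
      diag s (eDiagram (N + 2) hn j) * diag s (eDiagram (N + 2) hn i) := by
  -- The excluded differences are `c = 1` and `c = N + 1`; `c = 0` is trivial, and `2 ≤ c ≤ N` is
  -- the case of disjoint cups.
  obtain ⟨c, hc, rfl⟩ : ∃ c : ℕ, c < N + 2 ∧ j = i + c :=
    ⟨(j - i).val, ZMod.val_lt _, by rw [ZMod.natCast_zmod_val, add_sub_cancel]⟩
  rw [sub_add_cancel_left] at h1 h2
  have h3 : c ≠ 1 := fun h => h2 (by rw [h, Nat.cast_one])
  have h4 : c ≠ N + 1 := fun h => h1 (by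
    have : ((N + 2 : ℕ) : ZMod (N + 2)) = 0 := ZMod.natCast_self _
    push_cast at this
    rw [h]
    push_cast
    linear_combination -this)
  rcases Nat.eq_zero_or_pos c with rfl | h5
  · simp
  have h6 := (rotates_e (s := s) hn).add (c : ZMod (N + 2))
  refine ((rotates_e hn).mul h6).eq (h6.mul (rotates_e hn)) ?_ i
  have h := diag_e_eq (s := s) hn c
  rw [Int.cast_natCast] at h
  rw [cupCap_eq', h]
  simp only [mul_assoc]
  exact cupCap_comm (by omega) (by omega)

theorem diag_rho_e_pow (hn : 2 ≤ N + 2) (hN : N ≠ 0) (i : ZMod (N + 2)) :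
    (diag s (rotDiagram (N + 2) 1) * diag s (eDiagram (N + 2) hn i)) ^ (N + 1) =
      diag s (rotDiagram (N + 2) 1) ^ (N + 2) *
        (diag s (rotDiagram (N + 2) 1) * diag s (eDiagram (N + 2) hn i)) := by
  refine ((rotates_rho.mul (rotates_e hn)).pow (N + 1)).eq
    ((rotates_rho.pow (N + 2)).mul (rotates_rho.mul (rotates_e hn))) ?_ i
  rw [cupCap_eq']
  exact rot_cupCap_pow_full hN

theorem diag_rho_sq_e (hn : 2 ≤ 0 + 2) (i : ZMod (0 + 2)) :
    diag s (rotDiagram (0 + 2) 1) ^ 2 * diag s (eDiagram (0 + 2) hn i) =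
      diag s (eDiagram (0 + 2) hn i) := by
  refine ((rotates_rho.pow 2).mul (rotates_e hn)).eq (rotates_e hn) ?_ i
  rw [cupCap_eq']
  exact rot_sq_cupCap

end Twisted


/-! ### The algebras given by presentations -/

section Presentation

variable {s : ℂ}

theorem rho_mul_chain {n : ℕ} {A : Type} [Monoid A] {e : ZMod n → A} {ρ : A}
    (he : ∀ i, ρ * e i = e (i + 1) * ρ) (a : ZMod n) (c : ℕ) :
    ρ * chain (fun j => e (a + j)) 0 c = chain (fun j => e (a + 1 + j)) 0 c * ρ := by
  induction c with
  | zero => simp [chain]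
  | succ c ih =>
    rw [chain, chain, ← mul_assoc, ih, mul_assoc, he, mul_assoc, add_right_comm]

theorem rho_mul_e_pow {n : ℕ} {A : Type} [Monoid A] {e : ZMod n → A} {ρ : A}
    (he : ∀ i, ρ * e i = e (i + 1) * ρ) (a : ZMod n) (c : ℕ) :
    (ρ * e a) ^ c = chain (fun j => e (a + 1 + j)) 0 c * ρ ^ c := by
  induction c with
  | zero => simp [chain]
  | succ c ih =>
    have h : ρ ^ c * e (a + 1) = e (a + 1 + c) * ρ ^ c := by
      clear ih
      induction c with
      | zero => simp
      | succ c ih => rw [pow_succ', mul_assoc, ih, ← mul_assoc, he, mul_assoc, Nat.cast_succ, add_assoc]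
    rw [pow_succ, ih, he, mul_assoc, ← mul_assoc _ (e (a + 1)), h, chain, zero_add, mul_assoc,
      mul_assoc, pow_succ]

/-- With `n = p + 3`, moving all rotations to the right gives `(ρ e₁)^(n-1) = e₂ ⋯ e_n ρ^(n-1) = ρ²
(e₀ ⋯ e_(n-2)) ρ^(n-3)`, while the other side is `ρ^(n+1) e₁ = ρ⁴ e_(n-2) ρ^(n-3)`. The outer powers
of the invertible `ρ` cancel. -/
theorem twist_of_pow {p : ℕ} {A : Type} [Monoid A] {e : ZMod (p + 3) → A} {ρ ρ' : A}
    (he : ∀ i, ρ * e i = e (i + 1) * ρ) (h1 : ρ * ρ' = 1) (h2 : ρ' * ρ = 1)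
    (h : (ρ * e 1) ^ (p + 2) = ρ ^ (p + 3) * (ρ * e 1)) :
    ρ * ρ * e ((p + 1 : ℕ) : ZMod (p + 3)) =
      chain (fun j : ℕ => e j) 0 (p + 1) * e ((p + 1 : ℕ) : ZMod (p + 3)) := by
  have hu : IsUnit ρ := ⟨⟨ρ, ρ', h1, h2⟩, rfl⟩
  have h3 : ∀ (c : ℕ) (i : ZMod (p + 3)), ρ ^ c * e i = e (i + c) * ρ ^ c := by
    intro c i
    induction c with
    | zero => simp
    | succ c ih => rw [pow_succ', mul_assoc, ih, ← mul_assoc, he, mul_assoc, Nat.cast_succ, add_assoc]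
  rw [rho_mul_e_pow he] at h
  have h4 := rho_mul_chain he 0 (p + 2)
  rw [zero_add] at h4
  simp only [zero_add] at h4
  have h5 : ρ * ρ * chain (fun j : ℕ => e j) 0 (p + 2) * ρ ^ p =
      ρ * ρ * (ρ * ρ * e ((p + 1 : ℕ) : ZMod (p + 3))) * ρ ^ p := by
    rw [mul_assoc ρ ρ, h4, ← mul_assoc, rho_mul_chain he, mul_assoc, mul_assoc,
      ← pow_succ', ← pow_succ', h, mul_assoc (ρ * ρ), mul_assoc (ρ * ρ),
      show ((p + 1 : ℕ) : ZMod (p + 3)) = 1 + (p : ZMod (p + 3)) by push_cast; ring, ← h3]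
    have h8 : ρ ^ p * (ρ * e 1) = ρ * (ρ ^ p * e 1) := by
      rw [← mul_assoc, ← pow_succ, pow_succ', mul_assoc]
    simp only [pow_succ', mul_assoc, h8]
  have h6 := (hu.pow p).mul_right_cancel h5
  have h7 := (hu.mul hu).mul_left_cancel h6
  rw [← h7, chain, zero_add]

/-- The relation is given for `e 1`, but a system with `n = 2` retains `e 0`; conjugation by the
rotation passes from one to the other. -/
theorem twist_two {A : Type} [Monoid A] {e : ZMod 2 → A} {ρ ρ' : A}
    (he : ∀ i, ρ * e i = e (i + 1) * ρ) (h1 : ρ * ρ' = 1) (h2 : ρ' * ρ = 1)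
    (h : ρ * ρ * e 1 = e 1) : ρ * ρ * e 0 = e 0 := by
  have hu : IsUnit ρ := ⟨⟨ρ, ρ', h1, h2⟩, rfl⟩
  refine hu.mul_left_cancel ?_
  rw [mul_assoc ρ, he, zero_add, ← mul_assoc ρ, ← mul_assoc, h]

theorem quotGen_rel {N : ℕ} {R : FreeAlgebra ℂ (TLGen (N + 2)) → FreeAlgebra ℂ (TLGen (N + 2)) → Prop}
    {x y : FreeAlgebra ℂ (TLGen (N + 2))} (h : R x y) :
    RingQuot.mkAlgHom ℂ R x = RingQuot.mkAlgHom ℂ R y := RingQuot.mkAlgHom_rel ℂ h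

theorem ZMod.natCast_sub_ne {n i j : ℕ} (h : i + 2 ≤ j) (h' : j + 2 ≤ n) :
    (i : ZMod n) - j ≠ 1 ∧ (i : ZMod n) - j ≠ -1 := by
  have key : ∀ c : ℕ, 0 < c → c < n → (c : ZMod n) ≠ 0 := fun c h1 h2 h3 =>
    absurd (Nat.le_of_dvd h1 ((ZMod.natCast_eq_zero_iff c n).1 h3)) (by omega)
  obtain ⟨c, rfl⟩ : ∃ c, j = i + c + 1 := ⟨j - i - 1, by omega⟩
  constructor
  · intro h1
    refine key (c + 2) (by omega) (by omega) ?_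
    push_cast at h1 ⊢
    linear_combination -h1
  · intro h1
    refine key c (by omega) (by omega) ?_
    push_cast at h1 ⊢
    linear_combination -h1

/-- The relations of `TL s (p + 3)`. -/
noncomputable def tlSystem (s : ℂ) (p : ℕ) : TLSystem (p + 1 + 2) (TL s (p + 1 + 2)) where
  e i := quotGen (TLRel s (p + 1 + 2)) (TLGen.e i)
  rho := quotGen (TLRel s (p + 1 + 2)) TLGen.rho
  rhoInv := quotGen (TLRel s (p + 1 + 2)) TLGen.rhoInv
  weight := loopWeight s
  two_le := by omega
  e_sq i _ := by
    have h := quotGen_rel (TLRel.e_sq (s := s) (n := p + 1 + 2) i)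
    rwa [map_pow, map_smul, pow_two] at h
  e_comm i j h h' := by
    obtain ⟨h1, h2⟩ := ZMod.natCast_sub_ne h h'
    have h := quotGen_rel (TLRel.e_comm (s := s) (n := p + 1 + 2) i j h1 h2)
    rwa [map_mul, map_mul] at h
  e_succ i _ := by
    have h := quotGen_rel (TLRel.e_succ (s := s) (n := p + 1 + 2) i)
    rw [map_mul, map_mul, mul_assoc] at h
    rw [Nat.cast_succ]
    exact h
  e_pred i _ := by
    have h := quotGen_rel (TLRel.e_pred (s := s) (n := p + 1 + 2) (i + 1))
    rw [map_mul, map_mul, mul_assoc, add_sub_cancel_right] at h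
    rw [Nat.cast_succ]
    exact h
  rho_inv := by
    have h := quotGen_rel (TLRel.rho_rhoInv (s := s) (n := p + 1 + 2))
    rwa [map_mul, map_one] at h
  inv_rho := by
    have h := quotGen_rel (TLRel.rhoInv_rho (s := s) (n := p + 1 + 2))
    rwa [map_mul, map_one] at h
  rho_e i _ := by
    have h := quotGen_rel (TLRel.rho_e (s := s) (n := p + 1 + 2) i)
    rw [map_mul, map_mul] at h
    rw [Nat.cast_succ]
    exact h
  rho_sq_e := by
    have h : ∀ i, quotGen (TLRel s (p + 1 + 2)) TLGen.rho * quotGen (TLRel s (p + 1 + 2)) (TLGen.e i) =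
        quotGen (TLRel s (p + 1 + 2)) (TLGen.e (i + 1)) * quotGen (TLRel s (p + 1 + 2)) TLGen.rho := by
      intro i
      have h := quotGen_rel (TLRel.rho_e (s := s) (n := p + 1 + 2) i)
      rwa [map_mul, map_mul] at h
    rw [mul_assoc, h, ← mul_assoc, h, mul_assoc]
    congr 3
    -- Two turns raise the index `n - 2` to `n`, which is `0` modulo `n`.
    have := ZMod.natCast_self (p + 1 + 2)
    rw [Nat.add_sub_cancel, Nat.cast_zero, ← this]
    push_cast
    ring
  twist := by
    have h : ∀ i, quotGen (TLRel s (p + 1 + 2)) TLGen.rho * quotGen (TLRel s (p + 1 + 2)) (TLGen.e i) =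
        quotGen (TLRel s (p + 1 + 2)) (TLGen.e (i + 1)) * quotGen (TLRel s (p + 1 + 2)) TLGen.rho := by
      intro i
      have h := quotGen_rel (TLRel.rho_e (s := s) (n := p + 1 + 2) i)
      rwa [map_mul, map_mul] at h
    have h1 := quotGen_rel (TLRel.rho_rhoInv (s := s) (n := p + 1 + 2))
    have h2 := quotGen_rel (TLRel.rhoInv_rho (s := s) (n := p + 1 + 2))
    have h3 := quotGen_rel (TLRel.rho_e_pow (s := s) (n := p + 1 + 2))
    rw [map_mul, map_one] at h1 h2
    rw [map_pow, map_mul, map_mul, map_pow, map_mul] at h3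
    exact twist_of_pow (p := p) h h1 h2 h3

/-- The relations of `TLTwo s`. -/
noncomputable def tlTwoSystem (s : ℂ) : TLSystem (0 + 2) (TLTwo s) where
  e i := quotGen (N := 0) (TLTwoRel s) (TLGen.e i)
  rho := quotGen (N := 0) (TLTwoRel s) TLGen.rho
  rhoInv := quotGen (N := 0) (TLTwoRel s) TLGen.rhoInv
  weight := loopWeight s
  two_le := by omega
  e_sq i _ := by
    have h := quotGen_rel (N := 0) (TLTwoRel.e_sq (s := s) i)
    rwa [map_pow, map_smul, pow_two] at h
  e_comm i j h h' := by omega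
  e_succ i _ := by omega
  e_pred i _ := by omega
  rho_inv := by
    have h := quotGen_rel (N := 0) (TLTwoRel.rho_rhoInv (s := s))
    rwa [map_mul, map_one] at h
  inv_rho := by
    have h := quotGen_rel (N := 0) (TLTwoRel.rhoInv_rho (s := s))
    rwa [map_mul, map_one] at h
  rho_e i _ := by omega
  rho_sq_e := by
    have h : ∀ i, quotGen (N := 0) (TLTwoRel s) TLGen.rho * quotGen (N := 0) (TLTwoRel s) (TLGen.e i) =
        quotGen (N := 0) (TLTwoRel s) (TLGen.e (i + 1)) * quotGen (N := 0) (TLTwoRel s) TLGen.rho := by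
      intro i
      have h := quotGen_rel (N := 0) (TLTwoRel.rho_e (s := s) i)
      rwa [map_mul, map_mul] at h
    rw [mul_assoc, h, ← mul_assoc, h, mul_assoc]
    congr 3
  twist := by
    have h : ∀ i, quotGen (N := 0) (TLTwoRel s) TLGen.rho * quotGen (N := 0) (TLTwoRel s) (TLGen.e i) =
        quotGen (N := 0) (TLTwoRel s) (TLGen.e (i + 1)) * quotGen (N := 0) (TLTwoRel s) TLGen.rho := by
      intro i
      have h := quotGen_rel (N := 0) (TLTwoRel.rho_e (s := s) i)
      rwa [map_mul, map_mul] at h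
    have h1 := quotGen_rel (N := 0) (TLTwoRel.rho_rhoInv (s := s))
    have h2 := quotGen_rel (N := 0) (TLTwoRel.rhoInv_rho (s := s))
    have h3 := quotGen_rel (N := 0) (TLTwoRel.rho_sq_e (s := s))
    rw [map_mul, map_one] at h1 h2
    rw [map_mul, map_pow, pow_two] at h3
    have h4 := twist_two h h1 h2 h3
    rw [chain, one_mul]
    exact h4

theorem tl_existsUnique (s : ℂ) (p : ℕ) : ∃! φ : TL s (p + 1 + 2) ≃ₐ[ℂ] EndTL s (p + 1 + 2),
    φ (TL.gen s (p + 1 + 2) TLGen.rho) = diag s (rhoDiagram (p + 1 + 2)) ∧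
      ∀ i, φ (TL.gen s (p + 1 + 2) (TLGen.e i)) = diag s (eDiagram (p + 1 + 2) (by omega) i) := by
  refine existsUnique_equiv (TLRel s (p + 1 + 2)) ?_ (tlSystem s p) rfl rfl rfl rfl ?_
  · rintro x y (i | ⟨i, j, h1, h2⟩ | i | i | i | - | - | -) <;>
      simp only [map_mul, map_pow, map_smul, map_one, freeRep_gen, genDiagram]
    · exact diag_e_sq _ i
    · exact diag_e_comm _ i j h1 h2
    · exact diag_e_succ _ (by omega) i
    · exact diag_e_pred _ (by omega) i
    · exact diag_rot_e _ i
    · rw [diag_rot_mul, add_neg_cancel, diag_rot_zero]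
    · rw [diag_rot_mul, neg_add_cancel, diag_rot_zero]
    · exact diag_rho_e_pow _ (by omega) 1
  · intro i
    have h := quotGen_rel (TLRel.rho_e (s := s) (n := p + 1 + 2) i)
    rwa [map_mul, map_mul] at h

theorem tlTwo_existsUnique (s : ℂ) : ∃! φ : TLTwo s ≃ₐ[ℂ] EndTL s 2,
    φ (TLTwo.gen s TLGen.rho) = diag s (rhoDiagram 2) ∧
      ∀ i, φ (TLTwo.gen s (TLGen.e i)) = diag s (eDiagram 2 le_rfl i) := by
  refine existsUnique_equiv (N := 0) (TLTwoRel s) ?_ (tlTwoSystem s) rfl rfl rfl rfl ?_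
  · rintro x y (i | i | - | - | -) <;>
      simp only [map_mul, map_pow, map_smul, map_one, freeRep_gen, genDiagram]
    · exact diag_e_sq _ i
    · exact diag_rot_e _ i
    · exact (diag_rot_mul _ _).trans diag_rot_zero
    · exact (diag_rot_mul _ _).trans diag_rot_zero
    · exact diag_rho_sq_e _ 1
  · intro i
    have h := quotGen_rel (N := 0) (TLTwoRel.rho_e (s := s) i)
    rwa [map_mul, map_mul] at h

end Presentation

/-! ### The endomorphism algebras of `0` and `1` -/

section Small

variable {s : ℂ} {n : ℕ}

/-- Extending `g` linearly gives a map back; it inverts `Φ` because it does so on the spanning set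
of the `g D`. -/
theorem bijective_of_span {P : Type} [Ring P] [Algebra ℂ P] {Φ : P →ₐ[ℂ] EndTL s n}
    {g : AffineDiagram n n → P} (h1 : ∀ D, Φ (g D) = diag s D)
    (h2 : ∀ p, p ∈ Submodule.span ℂ (Set.range g)) : Function.Bijective Φ := by
  constructor
  · have key : ∀ p, Finsupp.linearCombination ℂ g (Φ p) = p := by
      intro p
      induction h2 p using Submodule.span_induction with
      | mem x hx =>
        obtain ⟨D, rfl⟩ := hx
        rw [h1]
        exact (Finsupp.linearCombination_single ℂ _ _).trans (one_smul ℂ _)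
      | zero => rw [map_zero]; exact map_zero _
      | add x y _ _ hx hy =>
        rw [map_add Φ]
        exact (map_add _ _ _).trans (congrArg₂ _ hx hy)
      | smul c x _ hx =>
        rw [map_smul Φ]
        exact (map_smul _ _ _).trans (congrArg _ hx)
    intro p q h
    rw [← key p, h, key q]
  · intro f
    induction f using Finsupp.induction_linear with
    | zero => exact ⟨0, map_zero Φ⟩
    | add f f' hf hf' =>
      obtain ⟨x, hx⟩ := hf
      obtain ⟨y, hy⟩ := hf'
      exact ⟨x + y, by rw [map_add, hx, hy]⟩
    | single D c =>
      refine ⟨c • g D, ?_⟩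
      rw [map_smul, h1]
      exact Finsupp.smul_single_one D c

theorem diag_loop_pow (r : ℕ) : diag s loopDiagram ^ r = diag s (loopsDiagram r) := by
  induction r with
  | zero =>
    rw [pow_zero, show loopsDiagram 0 = idDiagram 0 from (eq_loopsDiagram (idDiagram 0)).symm]
    rfl
  | succ r ih =>
    rw [pow_succ', ih, ← loop_comp_loops]
    exact loop_hom _

theorem tlZero_existsUnique (s : ℂ) :
    ∃! φ : Polynomial ℂ ≃ₐ[ℂ] EndTL s 0, φ Polynomial.X = diag s loopDiagram := by
  have h : Function.Bijective (Polynomial.aeval (R := ℂ) (diag s loopDiagram)) := by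
    refine bijective_of_span (g := fun D => Polynomial.X ^ D.loops) (fun D => ?_) fun p => ?_
    · rw [map_pow, Polynomial.aeval_X, diag_loop_pow, ← eq_loopsDiagram]
    · induction p using Polynomial.induction_on' with
      | add p q hp hq => exact add_mem hp hq
      | monomial r c =>
        rw [← Polynomial.C_mul_X_pow_eq_monomial, ← Polynomial.smul_eq_C_mul]
        exact Submodule.smul_mem _ _ (Submodule.subset_span ⟨loopsDiagram r, rfl⟩)
  refine ⟨AlgEquiv.ofBijective _ h, Polynomial.aeval_X _, fun φ hφ => ?_⟩
  have h1 : (φ : Polynomial ℂ →ₐ[ℂ] EndTL s 0) = Polynomial.aeval (diag s loopDiagram) :=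
    Polynomial.algHom_ext (hφ.trans (Polynomial.aeval_X _).symm)
  exact AlgEquiv.ext fun x => DFunLike.congr_fun h1 x

/-- By `HasArc.two_le` a single point on each circle leaves no room for a short arc, so only
rotations remain in `decompose`. -/
theorem exists_eq_rot (D : AffineDiagram 1 1) : ∃ r, D = rotDiagram 1 r := by
  have h : ∀ D : AffineDiagram 1 1, ¬ ∃ p, HasArc D p := fun D ⟨p, hp⟩ => by
    have := hp.two_le
    omega
  rcases D.decompose with h1 | h1 | ⟨-, h1, r, h2⟩ | ⟨h1, -⟩
  · exact (h _ h1).elim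
  · exact (h _ h1).elim
  · exact ⟨r, eq_rot h1 (h _) h2⟩
  · exact (one_ne_zero h1).elim

/-- The representation of Laurent polynomials by diagrams. -/
noncomputable def laurentRep (s : ℂ) : LaurentPolynomial ℂ →ₐ[ℂ] EndTL s 1 :=
  AddMonoidAlgebra.lift ℂ (EndTL s 1) ℤ
    { toFun := fun r => diag s (rotDiagram 1 r.toAdd)
      map_one' := diag_rot_zero
      map_mul' := fun _ _ => (diag_rot_mul _ _).symm }

theorem laurentRep_T (r : ℤ) : laurentRep s (LaurentPolynomial.T r) = diag s (rotDiagram 1 r) :=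
  (AddMonoidAlgebra.lift_single _ _ _).trans (one_smul ℂ _)

theorem tlOne_existsUnique (s : ℂ) : ∃! φ : LaurentPolynomial ℂ ≃ₐ[ℂ] EndTL s 1,
    φ (LaurentPolynomial.T 1) = diag s (rhoDiagram 1) := by
  have h : Function.Bijective (laurentRep s) := by
    choose r hr using exists_eq_rot
    refine bijective_of_span (g := fun D => LaurentPolynomial.T (r D)) (fun D => ?_) fun p => ?_
    · rw [laurentRep_T, ← hr]
    · induction p using LaurentPolynomial.induction_on' with
      | add p q hp hq => exact add_mem hp hq
      | C_mul_T m c =>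
        rw [← LaurentPolynomial.smul_eq_C_mul]
        refine Submodule.smul_mem _ _ (Submodule.subset_span ⟨rotDiagram 1 m, ?_⟩)
        exact congrArg _ (TLSystem.rotDiagram_injective one_ne_zero (hr _)).symm
  refine ⟨AlgEquiv.ofBijective _ h, laurentRep_T 1, fun φ hφ => ?_⟩
  have h1 : (φ : LaurentPolynomial ℂ →ₐ[ℂ] EndTL s 1) = laurentRep s := by
    refine (AddMonoidAlgebra.lift ℂ (EndTL s 1) ℤ).symm.injective (MonoidHom.ext_mint ?_)
    exact hφ.trans (laurentRep_T 1).symm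
  exact AlgEquiv.ext fun x => DFunLike.congr_fun h1 x

end Small

end ATL

theorem mainTheorem6 (s : ℂ) (hs : s ≠ 0) :
    (∃! φ : Polynomial ℂ ≃ₐ[ℂ] ATL.EndTL s 0, φ Polynomial.X = ATL.diag s ATL.loopDiagram) ∧
    (∃! φ : LaurentPolynomial ℂ ≃ₐ[ℂ] ATL.EndTL s 1,
      φ (LaurentPolynomial.T 1) = ATL.diag s (ATL.rhoDiagram 1)) ∧
    (∃! φ : ATL.TLTwo s ≃ₐ[ℂ] ATL.EndTL s 2,
      φ (ATL.TLTwo.gen s ATL.TLGen.rho) = ATL.diag s (ATL.rhoDiagram 2) ∧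
      ∀ i : ZMod 2, φ (ATL.TLTwo.gen s (ATL.TLGen.e i)) = ATL.diag s (ATL.eDiagram 2 le_rfl i)) ∧
    ∀ (n : ℕ) (hn : 3 ≤ n), ∃! φ : ATL.TL s n ≃ₐ[ℂ] ATL.EndTL s n,
      φ (ATL.TL.gen s n ATL.TLGen.rho) = ATL.diag s (ATL.rhoDiagram n) ∧
      ∀ i : ZMod n, φ (ATL.TL.gen s n (ATL.TLGen.e i)) =
        ATL.diag s (ATL.eDiagram n (le_trans (by norm_num) hn) i) := by
  refine ⟨ATL.tlZero_existsUnique s, ATL.tlOne_existsUnique s, ATL.tlTwo_existsUnique s, ?_⟩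
  intro n hn
  obtain ⟨p, rfl⟩ : ∃ p, n = p + 1 + 2 := ⟨n - 3, by omega⟩
  exact ATL.tl_existsUnique s p
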